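/- Let $d\ge 1$, $k\ge 1$. For $S\subseteq\mathbb{R}^d$ write $\|f\|_{C^k(S)}=\sup_{n\le k}\sup_{x\in S}\|D^nf(x)\|$, with $D^nf(x)$ the $n$-th Fréchet derivative and $\|\cdot\|$ the operator norm of multilinear maps for the Euclidean norm. For $L_1>1$, $L_2>0$ let $\mathcal{D}_k(L_1,L_2)$ be the set of probability measures on $[0,1]^d$ that have a Lebesgue density $q\in C^k([0,1]^d)$ with $\|q\|_{C^k([0,1]^d)}\le L_1$ and $\inf_{x\in[0,1]^d}q(x)\ge L_2$. Let $\sigma_2(x)=\max\{0,x\}^2$, applied coordinatewise. For $L\ge 2$, let $\Phi^{d_1,d_2}(L,W,S,B)$ be the set of functions $\mathbb{R}^{d_1}\to\mathbb{R}^{d_2}$ of the form $$\big(W^{(L)}\sigma_2(\cdot)+b^{(L)}\big)\circ\cdots\circ\big(W^{(2)}\sigma_2(\cdot)+b^{(2)}\big)\circ\big(W^{(1)}(\cdot)+b^{(1)}\big),$$ where $W^{(1)}\in\mathbb{R}^{W\times d_1}$, $W^{(l)}\in\mathbb{R}^{W\times W}$ for $1<l<L$, $W^{(L)}\in\mathbb{R}^{d_2\times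 W}$, $b^{(l)}\in\mathbb{R}^W$ for $l<L$, $b^{(L)}\in\mathbb{R}^{d_2}$, the total number of nonzero entries of all $W^{(l)}$, $b^{(l)}$ is at most $S$, and all these entries are at most $B$ in absolute value. For $g:\mathbb{R}^{d}\times\mathbb{R}\to\mathbb{R}^d$ let $X_g(x,\cdot)$ denote the solution of $\frac{d}{dt}X_g(x,t)=g(X_g(x,t),t)$, $X_g(x,0)=x$. For $p\in[1,\infty)$ let $W_p(\mu,\nu)=\big(\inf_\gamma\int|x-y|^p\,d\gamma(x,y)\big)^{1/p}$, where $\gamma$ ranges over the couplings of $\mu$ and $\nu$ and $|\cdot|$ is the Euclidean norm, and let $W_\infty(\mu,\nu)=\inf_\gamma\operatorname{ess\,sup}_{\gamma}|x-y|$. Then there is a constant $C_{d,k}$ depending only on $d,k$, and for all $L_1>1$, $L_2>0$ there are constants $C'=C'_{d,k,L_1,L_2}$ and $C=C_{d,k,L_1,L_2}$ depending only on $d,k,L_1,L_2$, such that for all $\rho,\pi\in\mathcal{D}_k(L_1,L_2)$ and every $\varepsilon\in(0,1]$ there are $L,W,S\in\mathbb{N}$, $B\in\mathbb{R}$ and $g\in\Phi^{d+1,d}(L,W,S,B)$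 with $$L\le C_{d,k},\qquad W\le C'\varepsilon^{-\frac{d+1}{k}},\qquad S\le C'\varepsilon^{-\frac{d+1}{k}},\qquad B\le C'\varepsilon^{-\frac1k},$$ such that for every $x\in[0,1]^d$ the initial value problem for $X_g(x,\cdot)$ has a solution on $[0,1]$ (necessarily unique, since $g$ is locally Lipschitz), the map $x\mapsto X_g(x,1)$ is $\pi$-measurable, and for every $p\in[1,\infty]$ $$W_p\big(\rho,X_g(\cdot,1)_\sharp\pi\big)\le C\varepsilon.$$ -/

import Mathlib

open MeasureTheory Set
open scoped ENNReal

noncomputable section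

/-! ### Densities on the unit cube -/

/-- The closed unit cube `[0,1]^d` in Euclidean space. -/
def unitCube (d : ℕ) : Set (EuclideanSpace ℝ (Fin d)) :=
  {x | ∀ i, x i ∈ Icc (0 : ℝ) 1}

/-- The norm `‖f‖_{C^k(S)} = sup_{n ≤ k} sup_{x ∈ S} ‖D^n f(x)‖`, where `D^n f(x)` is the `n`-th
Fréchet derivative (within `S`) and `‖·‖` is the operator norm of multilinear maps. -/
def ckNormOn {E F : Type*} [NormedAddCommGroup E] [NormedSpace ℝ E] [NormedAddCommGroup F]
    [NormedSpace ℝ F] (k : ℕ) (f : E → F) (S : Set E) : ℝ≥0∞ :=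
  ⨆ (n : ℕ) (_ : n ≤ k) (x : E) (_ : x ∈ S), ‖iteratedFDerivWithin ℝ n f S x‖ₑ

/-- The measure on `ℝ^d` with Lebesgue density `q` on the unit cube and density `0` outside. -/
def cubeMeasure {d : ℕ} (q : EuclideanSpace ℝ (Fin d) → ℝ) :
    Measure (EuclideanSpace ℝ (Fin d)) :=
  (volume.restrict (unitCube d)).withDensity (fun x => ENNReal.ofReal (q x))

/-- `q` is a probability density on `[0,1]^d` of class `C^k` up to the boundary, with
`‖q‖_{C^k} ≤ L₁` and `q ≥ L₂`. -/
structure IsCubeDensity {d : ℕ} (k : ℕ) (L₁ L₂ : ℝ) (q : EuclideanSpace ℝ (Fin d) → ℝ) :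
    Prop where
  contDiffOn : ContDiffOn ℝ k q (unitCube d)
  norm_le : ckNormOn k q (unitCube d) ≤ ENNReal.ofReal L₁
  lower_bound : ∀ x ∈ unitCube d, L₂ ≤ q x
  isProbabilityMeasure : IsProbabilityMeasure (cubeMeasure q)

/-! ### The Wasserstein distance of order `p ∈ [1, ∞]` -/

/-- `γ` is a coupling of `μ` and `ν`. -/
def IsCoupling {E : Type*} [MeasurableSpace E] (μ ν : Measure E) (γ : Measure (E × E)) : Prop :=
  γ.map Prod.fst = μ ∧ γ.map Prod.snd = ν

/-- The Wasserstein distance of order `p`: the infimum over all couplings `γ` of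
`(∫ |x - y|^p dγ(x,y))^{1/p}`, and of the `γ`-essential supremum of `|x - y|` if `p = ∞`. -/
def wasserstein {E : Type*} [NormedAddCommGroup E] [MeasurableSpace E] (p : ℝ≥0∞)
    (μ ν : Measure E) : ℝ≥0∞ :=
  ⨅ (γ : Measure (E × E)) (_ : IsCoupling μ ν γ), eLpNorm (fun z : E × E => z.1 - z.2) p γ

/-! ### ReLU² networks -/

/-- The activation `σ₂(x) = max{0,x}²`, applied to each coordinate. -/
def reluSq {n : ℕ} (v : Fin n → ℝ) : Fin n → ℝ := fun i => max 0 (v i) ^ 2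

/-- An affine layer `ℝ^m → ℝ^n`. -/
structure AffineLayer (m n : ℕ) where
  weight : Matrix (Fin n) (Fin m) ℝ
  bias : Fin n → ℝ

namespace AffineLayer

variable {m n : ℕ}

/-- The affine map `v ↦ A v + b`. -/
def apply (A : AffineLayer m n) (v : Fin m → ℝ) : Fin n → ℝ :=
  A.weight.mulVec v + A.bias

/-- The number `‖A‖₀ + ‖b‖₀` of nonzero parameters. -/
def nnz (A : AffineLayer m n) : ℕ :=
  {ij : Fin n × Fin m | A.weight ij.1 ij.2 ≠ 0}.ncard + {i : Fin n | A.bias i ≠ 0}.ncard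

/-- All entries of the weight matrix and of the bias are at most `B` in absolute value. -/
def BoundedBy (A : AffineLayer m n) (B : ℝ) : Prop :=
  (∀ i j, |A.weight i j| ≤ B) ∧ ∀ i, |A.bias i| ≤ B

end AffineLayer

/-- The parameters of a ReLU² network with input dimension `d₁`, output dimension `d₂` and
width `W`: the first layer, the list of intermediate layers, and the last layer. -/
structure ReLUSqNet (d₁ d₂ W : ℕ) where
  first : AffineLayer d₁ W
  mid : List (AffineLayer W W)
  last : AffineLayer W d₂

namespace ReLUSqNet

variable {d₁ d₂ W : ℕ}

/-- The number of affine layers. -/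
def depth (N : ReLUSqNet d₁ d₂ W) : ℕ := N.mid.length + 2

/-- The number of nonzero parameters of the network. -/
def sparsity (N : ReLUSqNet d₁ d₂ W) : ℕ :=
  N.first.nnz + (N.mid.map AffineLayer.nnz).sum + N.last.nnz

/-- All parameters of the network are at most `B` in absolute value. -/
def BoundedBy (N : ReLUSqNet d₁ d₂ W) (B : ℝ) : Prop :=
  N.first.BoundedBy B ∧ (∀ A ∈ N.mid, A.BoundedBy B) ∧ N.last.BoundedBy B

/-- The function realized by the network: affine layers with `σ₂` between consecutive layers. -/
def eval (N : ReLUSqNet d₁ d₂ W) (x : Fin d₁ → ℝ) : Fin d₂ → ℝ :=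
  N.last.apply (reluSq (N.mid.foldl (fun v A => A.apply (reluSq v)) (N.first.apply x)))

end ReLUSqNet

/-- The class `Φ^{d₁,d₂}(L, W, S, B)` of functions realized by a ReLU² network of depth `L`,
width `W`, with at most `S` nonzero parameters, all of absolute value at most `B`. -/
def reluSqClass (d₁ d₂ L W S : ℕ) (B : ℝ) : Set ((Fin d₁ → ℝ) → (Fin d₂ → ℝ)) :=
  {g | ∃ N : ReLUSqNet d₁ d₂ W,
    N.depth = L ∧ N.sparsity ≤ S ∧ N.BoundedBy B ∧ N.eval = g}

/-! ### Flows -/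

/-- A map `g : ℝ^{d+1} → ℝ^d` seen as the time-dependent velocity field `(x, t) ↦ g(x, t)`;
time is the last input coordinate. -/
def toVelocity {d : ℕ} (g : (Fin (d + 1) → ℝ) → (Fin d → ℝ)) (x : EuclideanSpace ℝ (Fin d))
    (t : ℝ) : EuclideanSpace ℝ (Fin d) :=
  WithLp.toLp 2 (g (Fin.snoc (α := fun _ => ℝ) (fun i => x i) t))

/-- `X` solves the initial value problem `d/dt X(x,t) = f(X(x,t),t)`, `X(x,0) = x`, on the time
interval `[0,1]` for every starting point `x ∈ S`. -/
def IsFlowOn {E : Type*} [NormedAddCommGroup E] [NormedSpace ℝ E] (f : E → ℝ → E) (S : Set E)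
    (X : E → ℝ → E) : Prop :=
  ∀ x ∈ S, X x 0 = x ∧
    ∀ t ∈ Icc (0 : ℝ) 1, HasDerivWithinAt (X x) (f (X x t) t) (Icc 0 1) t

end

/-!
Let `q_s = (1 - s) π + s ρ` interpolate between the densities. The measures `q_s dx` solve the
continuity equation for the velocity `f = (Flux π - Flux ρ) / q_s`, where `Flux q` is a vector field
with divergence `q - ∫ q` and vanishing normal component on the boundary of the cube. It is
triangular: its `j`-th component is the primitive in `x_j` of the difference between the average of
`q` over the coordinates after `j` and the average over the coordinates from `j` on, so it inherits
the `k` derivatives of `q`. Hence the time-one flow of `f` moves `π` to `ρ`.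

On a grid of mesh `1/N`, with `N ≈ ε^(-1/k)`, the field `f` is approximated up to `O(ε)` by
`∑ (quadratic B-spline) · (local polynomial)`. Such a sum is computed exactly by a network of fixed
depth, since polarization turns each product into `2^(ℓ+1)`-th powers, which are iterated squares.
Adding `ε (1/2 - x_j)` before approximating makes the network point strictly into the cube, so its
flow never leaves the cube, and Gronwall's inequality keeps the two flows `O(ε)` apart. Starting
both flows from the same `π`-distributed point couples `ρ` with the pushforward of `π`, and the
supremum bound on this coupling controls every `W_p`.
-/

open scoped Nat

/-! ### Networks computing powers and products of shallow networks -/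

theorem card_filter_bijective {F : Type*} [Fintype F] [DecidableEq F] :
    (Finset.univ.filter fun g : F → F => Function.Bijective g).card = (Fintype.card F)! := by
  rw [← Fintype.card_perm, ← Fintype.card_subtype, Fintype.card_congr Equiv.bijectiveEquiv]

theorem prod_eq_sum_pow_sum {F : Type*} [Fintype F] [DecidableEq F] (y : F → ℝ) :
    ∏ i, y i = ∑ S : Finset F, (-1) ^ Sᶜ.card / (Fintype.card F)! *
      (∑ i ∈ S, y i) ^ Fintype.card F := by
  let avoiding (i : F) : Finset (F → F) := Fintype.piFinset fun _ => {i}ᶜ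
  have avoiding_all (S : Finset F) : S.inf avoiding = Fintype.piFinset fun _ => Sᶜ := by
    ext g
    simp only [avoiding, Finset.mem_inf, Fintype.mem_piFinset, Finset.mem_compl,
      Finset.mem_singleton]
    grind
  have avoiding_none : Finset.univ.inf (fun i => (avoiding i)ᶜ) =
      Finset.univ.filter fun g : F → F => Function.Bijective g := by
    ext g
    rw [Finset.mem_filter_univ, ← Finite.surjective_iff_bijective]
    simp [avoiding, Finset.mem_inf, Function.Surjective]
  have sum_bijective : ∑ g : F → F with Function.Bijective g, ∏ k, y (g k) =
      (Fintype.card F)! * ∏ i, y i := by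
    rw [Finset.sum_congr rfl fun g hg => (Finset.mem_filter.1 hg).2.prod_comp y,
      Finset.sum_const, card_filter_bijective, nsmul_eq_mul]
  have h := Finset.inclusion_exclusion_sum_inf_compl Finset.univ avoiding fun g => ∏ k, y (g k)
  simp only [avoiding_none, sum_bijective, avoiding_all, Finset.powerset_univ,
    ← Finset.prod_univ_sum (fun _ => _) fun _ => y, Finset.prod_const, Finset.card_univ] at h
  rw [← compl_bijective.sum_comp]
  simp only [compl_compl, div_mul_eq_mul_div, ← Finset.sum_div]
  rw [eq_div_iff (by positivity), mul_comm, h]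
  simp

section NetworkConstruction

variable {n m W : ℕ} {Q Λ F : Type*}

theorem sum_blockDiagonal_mul {I J R : Type*} [NonUnitalNonAssocSemiring R] [Fintype J] [Fintype Q]
    [DecidableEq Q] (M : Q → Matrix I J R) (v : J × Q → R) (i : I) (q : Q) :
    ∑ p, Matrix.blockDiagonal M (i, q) p * v p = ∑ j, M q i j * v (j, q) := by
  simp [Fintype.sum_prod_type, Matrix.blockDiagonal_apply]

namespace AffineLayer

variable {α β : Type*}

theorem nnz_le (A : AffineLayer m n) : A.nnz ≤ n * (m + 1) := by
  rw [mul_add, mul_one]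
  exact Nat.add_le_add ((ncard_le_card _).trans_eq (by simp)) ((ncard_le_card _).trans_eq (by simp))

theorem nnz_le_of_bias_eq_zero {A : AffineLayer m n} (h : A.bias = 0) : A.nnz ≤ n * m := by
  rw [nnz, h]
  simpa using ncard_le_card {p : Fin n × Fin m | A.weight p.1 p.2 ≠ 0}

/-- The layer with matrix `M` and bias `b` indexed by arbitrary types, whose elements are numbered
by `e` and `f`. -/
def ofEquiv (e : α ≃ Fin m) (f : β ≃ Fin n) (M : Matrix β α ℝ) (b : β → ℝ) : AffineLayer m n :=
  ⟨Matrix.reindex f e M, b ∘ f.symm⟩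

theorem ofEquiv_apply [Fintype α] (e : α ≃ Fin m) (f : β ≃ Fin n) (M : Matrix β α ℝ) (b : β → ℝ)
    (v : Fin m → ℝ) (i : β) :
    (ofEquiv e f M b).apply v (f i) = ∑ j, M i j * v (e j) + b i := by
  simp [ofEquiv, apply, Matrix.mulVec, dotProduct, ← e.sum_comp]

theorem ofEquiv_boundedBy (e : α ≃ Fin m) (f : β ≃ Fin n) {M : Matrix β α ℝ} {b : β → ℝ} {B : ℝ}
    (hM : ∀ i j, |M i j| ≤ B) (hb : ∀ i, |b i| ≤ B) : (ofEquiv e f M b).BoundedBy B :=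
  ⟨fun _ _ => hM _ _, fun _ => hb _⟩

theorem ofEquiv_blockDiagonal_boundedBy [DecidableEq Q] (e : α × Q ≃ Fin m) (f : β × Q ≃ Fin n)
    {M : Q → Matrix β α ℝ} {b : β × Q → ℝ} {B : ℝ} (hB : 0 ≤ B) (hM : ∀ q i j, |M q i j| ≤ B)
    (hb : ∀ i, |b i| ≤ B) : (ofEquiv e f (Matrix.blockDiagonal M) b).BoundedBy B := by
  refine ofEquiv_boundedBy e f (fun i j => ?_) hb
  rw [Matrix.blockDiagonal_apply]
  split_ifs
  · exact hM _ _ _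
  · simpa using hB

theorem ofEquiv_blockDiagonal_nnz_le [Fintype α] [Fintype β] [Fintype Q] [DecidableEq Q]
    (e : α × Q ≃ Fin m) (f : β × Q ≃ Fin n) (M : Q → Matrix β α ℝ) (b : β × Q → ℝ) :
    (ofEquiv e f (Matrix.blockDiagonal M) b).nnz ≤
      Fintype.card Q * (Fintype.card β * (Fintype.card α + 1)) := by
  let pairing : (β × α) × Q → Fin n × Fin m := fun p => (f (p.1.1, p.2), e (p.1.2, p.2))
  have weights : {p : Fin n × Fin m |
      (ofEquiv e f (Matrix.blockDiagonal M) b).weight p.1 p.2 ≠ 0} ⊆ pairing '' univ := by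
    rintro ⟨i, j⟩ hij
    obtain ⟨⟨i, q⟩, rfl⟩ := f.surjective i
    obtain ⟨⟨j, q'⟩, rfl⟩ := e.surjective j
    obtain rfl : q = q' := by
      by_contra h
      simp [ofEquiv, Matrix.blockDiagonal_apply, h] at hij
    exact ⟨((i, j), q), trivial, rfl⟩
  have numWeights := (ncard_le_ncard weights).trans (ncard_image_le finite_univ)
  have numBiases := ncard_le_card {i : Fin n | (ofEquiv e f (Matrix.blockDiagonal M) b).bias i ≠ 0}
  have hn : Fintype.card β * Fintype.card Q = n := by simpa using Fintype.card_congr f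
  simp only [ncard_univ, Nat.card_eq_fintype_card, Fintype.card_prod, Fintype.card_fin]
    at numWeights numBiases
  exact (Nat.add_le_add numWeights numBiases).trans_eq (by rw [← hn]; ring)

end AffineLayer

/-- A family, indexed by `Q`, of ReLU² networks `ℝ^n → ℝ` with one hidden layer, whose neurons are
indexed by `Λ`. -/
structure ShallowFamily (n : ℕ) (Q Λ : Type*) where
  slope : Q → Λ → Fin n → ℝ
  shift : Q → Λ → ℝ
  weight : Q → Λ → ℝ
  offset : Q → ℝ

namespace ShallowFamily

/-- The value at `z` of the member `q` of the family. -/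
def eval [Fintype Λ] (P : ShallowFamily n Q Λ) (z : Fin n → ℝ) (q : Q) : ℝ :=
  P.offset q + ∑ l, P.weight q l * max 0 (∑ i, P.slope q l i * z i + P.shift q l) ^ 2

/-- All parameters of the family are at most `B` in absolute value. -/
structure BoundedBy (P : ShallowFamily n Q Λ) (B : ℝ) : Prop where
  slope : ∀ q l i, |P.slope q l i| ≤ B
  shift : ∀ q l, |P.shift q l| ≤ B
  weight : ∀ q l, |P.weight q l| ≤ B
  offset : ∀ q, |P.offset q| ≤ B

theorem BoundedBy.mono {P : ShallowFamily n Q Λ} {B B' : ℝ} (hP : P.BoundedBy B) (hB : B ≤ B') :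
    P.BoundedBy B' :=
  ⟨fun q l i => (hP.slope q l i).trans hB, fun q l => (hP.shift q l).trans hB,
    fun q l => (hP.weight q l).trans hB, fun q => (hP.offset q).trans hB⟩

section PowNet

/-- The sign `±1` carried by each of the two neurons `(±y)` that represent a number `y`. -/
def boolSign (s : Bool) : ℝ := if s then 1 else -1

theorem abs_boolSign (s : Bool) : |boolSign s| = 1 := by
  cases s <;> simp [boolSign]

/-- Computes the hidden neurons of all members of the family. The hidden layers of all networks
below consist of one block for every `q : Q`, which holds two neurons for the current value of the
member `q` and one neuron for every `l : Λ`. -/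
def hiddenLayer (P : ShallowFamily n Q Λ) (e : (Bool ⊕ Λ) × Q ≃ Fin W) : AffineLayer n W :=
  .ofEquiv (Equiv.refl _) e (fun h i => Sum.elim (fun _ => 0) (fun l => P.slope h.2 l i) h.1)
    (fun h => Sum.elim (fun _ => 0) (fun l => P.shift h.2 l) h.1)

/-- Computes `±y` for the values `y` of the members of the family from their hidden neurons. -/
def signedValueLayer [DecidableEq Q] (P : ShallowFamily n Q Λ) (e : (Bool ⊕ Λ) × Q ≃ Fin W) :
    AffineLayer W W :=
  .ofEquiv e e
    (Matrix.blockDiagonal fun q =>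
      Matrix.fromBlocks 0 (Matrix.of fun s l => boolSign s * P.weight q l) 0 0)
    (fun h => Sum.elim (fun s => boolSign s * P.offset h.2) (fun _ => 0) h.1)

/-- Squares the current value of every block: `σ₂(y) + σ₂(-y) = y²`. -/
def squareLayer [DecidableEq Q] (e : (Bool ⊕ Λ) × Q ≃ Fin W) : AffineLayer W W :=
  .ofEquiv e e
    (Matrix.blockDiagonal fun _ =>
      Matrix.fromBlocks (Matrix.of fun s _ => if s then 1 else 0) 0 0 0) 0

/-- Squares the current value of every block and takes linear combinations. -/
def outputLayer (e : (Bool ⊕ Λ) × Q ≃ Fin W) (a : Fin m → Q → ℝ) : AffineLayer W m :=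
  .ofEquiv e (Equiv.refl _) (fun j h => Sum.elim (fun _ => a j h.2) (fun _ => 0) h.1) 0

/-- The network computing the linear combinations with coefficients `a` of the `2 ^ (ℓ + 1)`-th
powers of the members of a family of shallow networks. -/
def powNet [DecidableEq Q] (P : ShallowFamily n Q Λ) (e : (Bool ⊕ Λ) × Q ≃ Fin W)
    (a : Fin m → Q → ℝ) (ℓ : ℕ) : ReLUSqNet n m W :=
  ⟨P.hiddenLayer e, P.signedValueLayer e :: List.replicate ℓ (squareLayer e), outputLayer e a⟩

/-- The pre-activations `u` hold a number of square `y q ^ 2` in the two value neurons of every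
block `q`. -/
def Represents (e : (Bool ⊕ Λ) × Q ≃ Fin W) (u : Fin W → ℝ) (y : Q → ℝ) : Prop :=
  ∀ q, ∑ s, reluSq u (e (.inl s, q)) = y q ^ 2

theorem max_sq_add_max_neg_sq (y : ℝ) : max 0 y ^ 2 + max 0 (-y) ^ 2 = y ^ 2 := by
  rcases le_total 0 y with h | h
  · simp [h]
  · simp [h]

section Eval

variable {e : (Bool ⊕ Λ) × Q ≃ Fin W} {u : Fin W → ℝ} {y : Q → ℝ}

theorem hiddenLayer_apply (P : ShallowFamily n Q Λ) (z : Fin n → ℝ) (l : Λ) (q : Q) :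
    (P.hiddenLayer e).apply z (e (.inr l, q)) = ∑ i, P.slope q l i * z i + P.shift q l :=
  (AffineLayer.ofEquiv_apply (Equiv.refl _) e _ _ z (.inr l, q)).trans (by simp)

theorem outputLayer_apply [Fintype Q] [Finite Λ] (a : Fin m → Q → ℝ) (h : Represents e u y)
    (j : Fin m) : (outputLayer e a).apply (reluSq u) j = ∑ q, a j q * y q ^ 2 := by
  have := Fintype.ofFinite Λ
  simp only [Represents, Fintype.sum_bool] at h
  refine (AffineLayer.ofEquiv_apply e (Equiv.refl _) _ _ _ j).trans ?_
  simp [Fintype.sum_prod_type_right, ← h, mul_add]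

variable [DecidableEq Q]

theorem represents_signedValueLayer [Finite Q] [Fintype Λ] (P : ShallowFamily n Q Λ)
    (z : Fin n → ℝ) :
    Represents e ((P.signedValueLayer e).apply (reluSq ((P.hiddenLayer e).apply z)))
      (P.eval z) := by
  have := Fintype.ofFinite Q
  intro q
  have value (s : Bool) : (P.signedValueLayer e).apply (reluSq ((P.hiddenLayer e).apply z))
      (e (.inl s, q)) = boolSign s * P.eval z q := by
    rw [signedValueLayer, AffineLayer.ofEquiv_apply,
      sum_blockDiagonal_mul _ fun p => reluSq ((P.hiddenLayer e).apply z) (e p)]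
    simp [reluSq, hiddenLayer_apply, eval, mul_add, Finset.mul_sum, mul_assoc, add_comm]
  simp only [Fintype.sum_bool, reluSq, value]
  simpa [boolSign] using max_sq_add_max_neg_sq (P.eval z q)

theorem Represents.squareLayer [Finite Q] [Finite Λ] (h : Represents e u y) :
    Represents e ((squareLayer e).apply (reluSq u)) (y ^ 2) := by
  have := Fintype.ofFinite Q
  have := Fintype.ofFinite Λ
  intro q
  have value (s : Bool) : (ShallowFamily.squareLayer e).apply (reluSq u) (e (.inl s, q)) =
      if s then y q ^ 2 else 0 := by
    rw [ShallowFamily.squareLayer, AffineLayer.ofEquiv_apply,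
      sum_blockDiagonal_mul _ fun p => reluSq u (e p), ← h q]
    cases s <;> simp
  simp [reluSq, value, max_eq_right (sq_nonneg (y q))]

theorem Represents.foldl_squareLayer [Finite Q] [Finite Λ] (h : Represents e u y) (ℓ : ℕ) :
    Represents e ((List.replicate ℓ (ShallowFamily.squareLayer e)).foldl
      (fun v A => A.apply (reluSq v)) u) (y ^ 2 ^ ℓ) := by
  induction ℓ with
  | zero => simpa using h
  | succ ℓ ih =>
    rw [List.replicate_succ', List.foldl_append, pow_succ, pow_mul]
    exact ih.squareLayer

theorem powNet_eval [Fintype Q] [Fintype Λ] (P : ShallowFamily n Q Λ)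
    (a : Fin m → Q → ℝ) (ℓ : ℕ) (z : Fin n → ℝ) (j : Fin m) :
    (P.powNet e a ℓ).eval z j = ∑ q, a j q * P.eval z q ^ 2 ^ (ℓ + 1) := by
  refine (outputLayer_apply a ((P.represents_signedValueLayer z).foldl_squareLayer ℓ) j).trans ?_
  simp only [Pi.pow_apply, ← pow_mul, ← pow_succ]

end Eval

theorem powNet_depth [DecidableEq Q] (P : ShallowFamily n Q Λ) (e : (Bool ⊕ Λ) × Q ≃ Fin W)
    (a : Fin m → Q → ℝ) (ℓ : ℕ) : (P.powNet e a ℓ).depth = ℓ + 3 := by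
  simp [powNet, ReLUSqNet.depth]

theorem powNet_boundedBy [DecidableEq Q] {P : ShallowFamily n Q Λ} {B : ℝ} (hB : 1 ≤ B)
    (hP : P.BoundedBy B) (e : (Bool ⊕ Λ) × Q ≃ Fin W) {a : Fin m → Q → ℝ}
    (ha : ∀ j q, |a j q| ≤ B) (ℓ : ℕ) : (P.powNet e a ℓ).BoundedBy B := by
  have hB0 : 0 ≤ B := zero_le_one.trans hB
  refine ⟨AffineLayer.ofEquiv_boundedBy _ _ ?_ ?_, fun A hA => ?_,
    AffineLayer.ofEquiv_boundedBy _ _ ?_ (fun _ => by simpa using hB0)⟩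
  · rintro ⟨_ | _, _⟩ _ <;> simp [hB0, hP.slope]
  · rintro ⟨_ | _, _⟩ <;> simp [hB0, hP.shift]
  · rcases List.mem_cons.1 hA with rfl | hA
    · refine AffineLayer.ofEquiv_blockDiagonal_boundedBy _ _ hB0 ?_ ?_
      · rintro q (_ | _) (_ | _) <;> simp [hB0, abs_mul, abs_boolSign, hP.weight]
      · rintro ⟨_ | _, _⟩ <;> simp [hB0, abs_mul, abs_boolSign, hP.offset]
    · obtain rfl := List.eq_of_mem_replicate hA
      refine AffineLayer.ofEquiv_blockDiagonal_boundedBy _ _ hB0 ?_ (fun _ => by simpa using hB0)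
      rintro _ ((_ | _) | _) (_ | _) <;> simp [hB0, hB]
  · rintro _ ⟨_ | _, _⟩ <;> simp [hB0, ha]

theorem powNet_sparsity_le [Fintype Q] [Fintype Λ] [DecidableEq Q] (P : ShallowFamily n Q Λ)
    (e : (Bool ⊕ Λ) × Q ≃ Fin W) (a : Fin m → Q → ℝ) (ℓ : ℕ) :
    (P.powNet e a ℓ).sparsity ≤ Fintype.card Q * ((2 + Fintype.card Λ) *
      ((n + 1) + (ℓ + 1) * (2 + Fintype.card Λ + 1) + m)) := by
  have hW : (2 + Fintype.card Λ) * Fintype.card Q = W := by simpa using Fintype.card_congr e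
  have first : (P.powNet e a ℓ).first.nnz ≤ W * (n + 1) := AffineLayer.nnz_le _
  have last : (P.powNet e a ℓ).last.nnz ≤ m * W := AffineLayer.nnz_le_of_bias_eq_zero rfl
  have mid : ((P.powNet e a ℓ).mid.map AffineLayer.nnz).sum ≤ (ℓ + 1) *
      (Fintype.card Q * ((2 + Fintype.card Λ) * (2 + Fintype.card Λ + 1))) := by
    refine (List.sum_le_card_nsmul _ (Fintype.card Q *
      ((2 + Fintype.card Λ) * (2 + Fintype.card Λ + 1))) fun k hk => ?_).trans_eq
        (by simp [powNet])
    obtain ⟨A, hA, rfl⟩ := List.mem_map.1 hk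
    have card_block : Fintype.card (Bool ⊕ Λ) = 2 + Fintype.card Λ := by simp
    rw [← card_block]
    rcases List.mem_cons.1 hA with rfl | hA
    · exact AffineLayer.ofEquiv_blockDiagonal_nnz_le ..
    · obtain rfl := List.eq_of_mem_replicate hA
      exact AffineLayer.ofEquiv_blockDiagonal_nnz_le ..
  refine (Nat.add_le_add (Nat.add_le_add first mid) last).trans_eq ?_
  rw [← hW]
  ring

end PowNet

section ProdNet

variable [Fintype F] [DecidableEq F]

/-- The partial sums, over the sets `S : Finset F`, of the families `P.eval z (q, f)` with `f : F`,
as a shallow family. -/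
def partialSums (P : ShallowFamily n (Q × F) Λ) : ShallowFamily n (Q × Finset F) (F × Λ) where
  slope p l := P.slope (p.1, l.1) l.2
  shift p l := P.shift (p.1, l.1) l.2
  weight p l := if l.1 ∈ p.2 then P.weight (p.1, l.1) l.2 else 0
  offset p := ∑ f ∈ p.2, P.offset (p.1, f)

theorem partialSums_eval [Fintype Λ] (P : ShallowFamily n (Q × F) Λ) (z : Fin n → ℝ) (q : Q)
    (S : Finset F) : P.partialSums.eval z (q, S) = ∑ f ∈ S, P.eval z (q, f) := by
  simp [eval, partialSums, Fintype.sum_prod_type, Finset.sum_add_distrib, Finset.sum_ite_mem,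
    ite_mul, Finset.sum_ite_irrel]

theorem BoundedBy.partialSums [Nonempty F] {P : ShallowFamily n (Q × F) Λ} {B : ℝ} (hB : 0 ≤ B)
    (hP : P.BoundedBy B) : P.partialSums.BoundedBy (Fintype.card F * B) := by
  have le_mul : B ≤ Fintype.card F * B :=
    le_mul_of_one_le_left hB (mod_cast Fintype.card_pos (α := F))
  refine ⟨fun _ _ _ => (hP.slope ..).trans le_mul, fun _ _ => (hP.shift ..).trans le_mul,
    fun p l => ?_, fun p => ?_⟩
  · simp only [ShallowFamily.partialSums]
    split_ifs
    · exact (hP.weight ..).trans le_mul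
    · simpa using hB.trans le_mul
  · refine (Finset.abs_sum_le_sum_abs _ _).trans
      ((Finset.sum_le_card_nsmul _ _ B fun f _ => hP.offset _).trans ?_)
    rw [nsmul_eq_mul]
    gcongr
    exact Finset.card_le_univ _

/-- The coefficients which, by polarization, turn linear combinations of products into linear
combinations of powers of partial sums. -/
noncomputable def polarizedCoeff (a : Fin m → Q → ℝ) (j : Fin m) (p : Q × Finset F) : ℝ :=
  a j p.1 * ((-1) ^ p.2ᶜ.card / (Fintype.card F)!)

theorem abs_polarizedCoeff_le (a : Fin m → Q → ℝ) (j : Fin m) (p : Q × Finset F) :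
    |polarizedCoeff a j p| ≤ |a j p.1| := by
  rw [polarizedCoeff, abs_mul, abs_div, abs_neg_one_pow, Nat.abs_cast]
  exact mul_le_of_le_one_right (abs_nonneg _)
    ((div_le_one (by positivity)).2 (mod_cast Nat.factorial_pos _))

variable [Fintype Q] [Fintype Λ] [DecidableEq Q]

/-- The network computing the linear combinations with coefficients `a` of the products over `F`
of the members of a family of shallow networks, if `F` has `2 ^ (ℓ + 1)` elements. -/
noncomputable def prodNet (P : ShallowFamily n (Q × F) Λ) (a : Fin m → Q → ℝ) (ℓ : ℕ) :
    ReLUSqNet n m (Fintype.card ((Bool ⊕ F × Λ) × Q × Finset F)) :=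
  P.partialSums.powNet (Fintype.equivFin _) (polarizedCoeff a) ℓ

theorem prodNet_eval (P : ShallowFamily n (Q × F) Λ) (a : Fin m → Q → ℝ) {ℓ : ℕ}
    (hF : Fintype.card F = 2 ^ (ℓ + 1)) (z : Fin n → ℝ) (j : Fin m) :
    (P.prodNet a ℓ).eval z j = ∑ q, a j q * ∏ f, P.eval z (q, f) := by
  rw [prodNet, powNet_eval, Fintype.sum_prod_type]
  refine Finset.sum_congr rfl fun q _ => ?_
  rw [prod_eq_sum_pow_sum, Finset.mul_sum]
  simp only [polarizedCoeff, partialSums_eval, hF, mul_assoc]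

theorem prodNet_depth (P : ShallowFamily n (Q × F) Λ) (a : Fin m → Q → ℝ) (ℓ : ℕ) :
    (P.prodNet a ℓ).depth = ℓ + 3 :=
  powNet_depth ..

theorem prodNet_boundedBy [Nonempty F] {P : ShallowFamily n (Q × F) Λ} {B : ℝ} (hB : 1 ≤ B)
    (hP : P.BoundedBy B) {a : Fin m → Q → ℝ} (ha : ∀ j q, |a j q| ≤ B) (ℓ : ℕ) :
    (P.prodNet a ℓ).BoundedBy (Fintype.card F * B) := by
  have le_mul : B ≤ Fintype.card F * B :=
    le_mul_of_one_le_left (by linarith) (mod_cast Fintype.card_pos (α := F))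
  exact powNet_boundedBy (hB.trans le_mul) (hP.partialSums (by linarith)) _
    (fun j p => ((abs_polarizedCoeff_le a j p).trans (ha j p.1)).trans le_mul) ℓ

theorem prodNet_sparsity_le (P : ShallowFamily n (Q × F) Λ) (a : Fin m → Q → ℝ) (ℓ : ℕ) :
    (P.prodNet a ℓ).sparsity ≤ Fintype.card Q * (2 ^ Fintype.card F *
      ((2 + Fintype.card F * Fintype.card Λ) * ((n + 1) +
        (ℓ + 1) * (2 + Fintype.card F * Fintype.card Λ + 1) + m))) := by
  refine (powNet_sparsity_le ..).trans_eq ?_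
  simp only [Fintype.card_prod, Fintype.card_finset, mul_assoc]

end ProdNet

end ShallowFamily

end NetworkConstruction

/-! ### Quadratic B-splines as a partition of unity -/

section BSpline

/-- The quadratic B-spline with knots `0, 1, 2, 3`. -/
noncomputable def bSpline (y : ℝ) : ℝ :=
  1 / 2 * max 0 y ^ 2 - 3 / 2 * max 0 (y - 1) ^ 2 + 3 / 2 * max 0 (y - 2) ^ 2
    - 1 / 2 * max 0 (y - 3) ^ 2

theorem bSpline_eq_zero_of_nonpos {y : ℝ} (h : y ≤ 0) : bSpline y = 0 := by
  rw [bSpline, max_eq_left h, max_eq_left (by linarith), max_eq_left (by linarith),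
    max_eq_left (by linarith)]
  norm_num

theorem bSpline_eq_zero_of_three_le {y : ℝ} (h : 3 ≤ y) : bSpline y = 0 := by
  rw [bSpline, max_eq_right (by linarith), max_eq_right (by linarith),
    max_eq_right (by linarith), max_eq_right (by linarith)]
  ring

theorem bSpline_nonneg (y : ℝ) : 0 ≤ bSpline y := by
  rcases le_total y 0 with h0 | h0
  · exact (bSpline_eq_zero_of_nonpos h0).ge
  rcases le_total 3 y with h3 | h3
  · exact (bSpline_eq_zero_of_three_le h3).ge
  rw [bSpline, max_eq_right h0, max_eq_left (sub_nonpos.2 h3)]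
  rcases le_total y 1 with h1 | h1
  · rw [max_eq_left (by linarith), max_eq_left (by linarith)]
    nlinarith
  rcases le_total y 2 with h2 | h2
  · rw [max_eq_right (by linarith), max_eq_left (by linarith)]
    nlinarith
  · rw [max_eq_right (by linarith), max_eq_right (by linarith)]
    nlinarith [sq_nonneg (y - 3)]

theorem sum_bSpline (N : ℕ) {x : ℝ} (h0 : 0 ≤ x) (hN : x ≤ N) :
    ∑ m : Fin (N + 2), bSpline (x - (m : ℕ) + 2) = 1 := by
  rw [Fin.sum_univ_eq_sum_range (fun m : ℕ => bSpline (x - m + 2)) (N + 2)]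
  let primitive (m : ℕ) : ℝ := 1 / 2 * max 0 (x - m + 2) ^ 2 - max 0 (x - m + 1) ^ 2
    + 1 / 2 * max 0 (x - m) ^ 2
  have telescope (m : ℕ) : bSpline (x - m + 2) = primitive m - primitive (m + 1) := by
    simp only [primitive, bSpline]
    push_cast
    ring_nf
  simp only [telescope, Finset.sum_range_sub', primitive]
  push_cast
  rw [max_eq_right (by linarith), max_eq_right (by linarith), max_eq_right (by linarith),
    max_eq_left (by linarith), max_eq_left (by linarith), max_eq_left (by linarith)]
  ring

variable {n N : ℕ}

/-- The tensor product B-splines for the grid of step `1 / N`, which form a partition of unity on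
the unit cube. -/
noncomputable def tensorSpline (N : ℕ) (μ : Fin n → Fin (N + 2)) (z : Fin n → ℝ) : ℝ :=
  ∏ i, bSpline (N * z i - (μ i : ℕ) + 2)

theorem tensorSpline_nonneg (μ : Fin n → Fin (N + 2)) (z : Fin n → ℝ) : 0 ≤ tensorSpline N μ z :=
  Finset.prod_nonneg fun _ _ => bSpline_nonneg _

theorem sum_tensorSpline {z : Fin n → ℝ} (hz : z ∈ Icc (0 : Fin n → ℝ) 1) :
    ∑ μ, tensorSpline N μ z = 1 := by
  simp only [tensorSpline]
  rw [← Fintype.piFinset_univ, ← Finset.prod_univ_sum (fun _ => Finset.univ)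
    fun i (m : Fin (N + 2)) => bSpline (N * z i - (m : ℕ) + 2)]
  exact Finset.prod_eq_one fun i _ => sum_bSpline N (mul_nonneg N.cast_nonneg (hz.1 i))
    (mul_le_of_le_one_right N.cast_nonneg (hz.2 i))

/-- A point of the unit cube close to the support of `tensorSpline N μ`. -/
noncomputable def splineCenter (N : ℕ) (μ : Fin n → Fin (N + 2)) (i : Fin n) : ℝ :=
  min (μ i : ℝ) N / N

theorem splineCenter_mem_Icc (N : ℕ) (μ : Fin n → Fin (N + 2)) :
    splineCenter N μ ∈ Icc (0 : Fin n → ℝ) 1 :=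
  ⟨fun _ => div_nonneg (le_min (Nat.cast_nonneg _) N.cast_nonneg) N.cast_nonneg,
    fun _ => div_le_one_of_le₀ (min_le_right _ _) N.cast_nonneg⟩

theorem dist_splineCenter_le (hN : 1 ≤ N) {μ : Fin n → Fin (N + 2)} {z : Fin n → ℝ} (hz : z ≤ 1)
    (h : tensorSpline N μ z ≠ 0) : dist z (splineCenter N μ) ≤ 2 / N := by
  have hN0 : (0 : ℝ) < N := mod_cast hN
  refine (dist_pi_le_iff (by positivity)).2 fun i => ?_
  have factor_ne_zero := Finset.prod_ne_zero_iff.1 h i (Finset.mem_univ i)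
  have left_lt := not_le.1 (mt bSpline_eq_zero_of_nonpos factor_ne_zero)
  have lt_right := not_le.1 (mt bSpline_eq_zero_of_three_le factor_ne_zero)
  have hzi : N * z i ≤ N := mul_le_of_le_one_right hN0.le (hz i)
  have scaled : z i - splineCenter N μ i = (N * z i - min (μ i : ℝ) N) / N := by
    rw [splineCenter]
    field_simp
  rw [Real.dist_eq, scaled, abs_div, abs_of_pos hN0]
  gcongr
  rw [abs_le]
  rcases le_total (μ i : ℝ) N with hμ | hμ
  · rw [min_eq_left hμ]
    constructor <;> linarith
  · rw [min_eq_right hμ]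
    constructor <;> linarith

theorem abs_sum_tensorSpline_mul_sub_le (hN : 1 ≤ N) {M : ℝ} (hM : 0 ≤ M) {k : ℕ}
    {z : Fin n → ℝ} (hz : z ∈ Icc (0 : Fin n → ℝ) 1) {p : (Fin n → Fin (N + 2)) → ℝ} {y : ℝ}
    (h : ∀ μ, |y - p μ| ≤ M * dist z (splineCenter N μ) ^ k) :
    |∑ μ, tensorSpline N μ z * p μ - y| ≤ M * (2 / N) ^ k := by
  calc |∑ μ, tensorSpline N μ z * p μ - y| = |∑ μ, tensorSpline N μ z * (p μ - y)| := by
        simp only [mul_sub, Finset.sum_sub_distrib, ← Finset.sum_mul, sum_tensorSpline hz, one_mul]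
    _ ≤ ∑ μ, tensorSpline N μ z * (M * (2 / N) ^ k) := by
        refine (Finset.abs_sum_le_sum_abs _ _).trans (Finset.sum_le_sum fun μ _ => ?_)
        rw [abs_mul, abs_of_nonneg (tensorSpline_nonneg μ z), abs_sub_comm]
        rcases eq_or_ne (tensorSpline N μ z) 0 with h0 | h0
        · simp [h0]
        refine mul_le_mul_of_nonneg_left ((h μ).trans ?_) (tensorSpline_nonneg μ z)
        gcongr
        exact dist_splineCenter_le hN hz.2 h0
    _ = M * (2 / N) ^ k := by rw [← Finset.sum_mul, sum_tensorSpline hz, one_mul]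

end BSpline

/-! ### Approximation of functions with local polynomial approximations -/

/-- Polynomials with all exponents at most `D` and all coefficients at most `M`. -/
def IsBddPoly {ι : Type*} [Fintype ι] [DecidableEq ι] (D : ℕ) (M : ℝ) (p : (ι → ℝ) → ℝ) : Prop :=
  ∃ c : (ι → Fin (D + 1)) → ℝ,
    (∀ α, |c α| ≤ M) ∧ ∀ z, p z = ∑ α, c α * ∏ i, z i ^ (α i : ℕ)

/-- Functions on the unit cube approximated to order `k` at each point by polynomials. -/
def LocPoly {ι : Type*} [Fintype ι] [DecidableEq ι] (k D : ℕ) (M : ℝ) (u : (ι → ℝ) → ℝ) : Prop :=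
  ∀ a ∈ Icc (0 : ι → ℝ) 1, ∃ p, IsBddPoly D M p ∧
    ∀ z ∈ Icc (0 : ι → ℝ) 1, |u z - p z| ≤ M * dist z a ^ k

theorem ReLUSqNet.BoundedBy.mono {d₁ d₂ W : ℕ} {net : ReLUSqNet d₁ d₂ W} {B B' : ℝ}
    (h : net.BoundedBy B) (hB : B ≤ B') : net.BoundedBy B' :=
  ⟨⟨fun i j => (h.1.1 i j).trans hB, fun i => (h.1.2 i).trans hB⟩,
    fun A hA => ⟨fun i j => ((h.2.1 A hA).1 i j).trans hB, fun i => ((h.2.1 A hA).2 i).trans hB⟩,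
    ⟨fun i j => (h.2.2.1 i j).trans hB, fun i => (h.2.2.2 i).trans hB⟩⟩

theorem prod_fin_ite_lt {D a : ℕ} (ha : a ≤ D) (x : ℝ) :
    ∏ t : Fin D, (if (t : ℕ) < a then x else 1) = x ^ a := by
  rw [Finset.prod_ite, Finset.prod_const, Finset.prod_const_one, mul_one,
    Fin.card_filter_val_lt, min_eq_right ha]

section SplineNet

variable {n m D N : ℕ}

/-- The index set of the factors of the product of a tensor product B-spline and a monomial: one
for every one-dimensional B-spline, `D` for the powers of every variable, and a set of constant
factors `1` which makes the number of factors a power of two. -/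
abbrev SplineFactor (n D : ℕ) : Type :=
  Fin n ⊕ (Fin n × Fin D) ⊕ Fin (2 ^ (n + n * D + 1) - (n + n * D))

theorem card_splineFactor (n D : ℕ) : Fintype.card (SplineFactor n D) = 2 ^ (n + n * D + 1) := by
  have : n + n * D ≤ 2 ^ (n + n * D + 1) :=
    Nat.lt_two_pow_self.le.trans (Nat.pow_le_pow_right two_pos (Nat.le_succ _))
  simp only [Fintype.card_sum, Fintype.card_prod, Fintype.card_fin]
  lia

/-- The index set of the products of tensor product B-splines and monomials. -/
abbrev SplineMonomial (n N D : ℕ) : Type :=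
  (Fin n → Fin (N + 2)) × (Fin n → Fin (D + 1))

theorem card_splineMonomial_le (hN : 1 ≤ N) :
    Fintype.card (SplineMonomial n N D) ≤ 3 ^ n * (D + 1) ^ n * N ^ n := by
  simp only [Fintype.card_prod, Fintype.card_pi, Fintype.card_fin, Finset.prod_const,
    Finset.card_univ]
  calc (N + 2) ^ n * (D + 1) ^ n ≤ (3 * N) ^ n * (D + 1) ^ n := by gcongr; lia
    _ = _ := by rw [mul_pow]; ring

/-- The factors of the products of tensor product B-splines and monomials, as shallow networks.
On `[0, ∞)` the coordinate functions are realized by `y = ((y + 1)² - y² - 1) / 2`. -/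
noncomputable def splineFactors (n N D : ℕ) :
    ShallowFamily n (SplineMonomial n N D × SplineFactor n D) (Fin 4) where
  slope
    | (_, .inl i), _ => Pi.single i (N : ℝ)
    | (_, .inr (.inl (i, _))), _ => Pi.single i 1
    | (_, .inr (.inr _)), _ => 0
  shift
    | (q, .inl i), l => 2 - (q.1 i : ℕ) - (l : ℕ)
    | (_, .inr (.inl _)), l => if l = 0 then 1 else 0
    | (_, .inr (.inr _)), _ => 0
  weight
    | (_, .inl _), l => ![1 / 2, -3 / 2, 3 / 2, -1 / 2] l
    | (q, .inr (.inl (i, t))), l => if (t : ℕ) < q.2 i then ![1 / 2, -1 / 2, 0, 0] l else 0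
    | (_, .inr (.inr _)), _ => 0
  offset
    | (_, .inl _) => 0
    | (q, .inr (.inl (i, t))) => if (t : ℕ) < q.2 i then -1 / 2 else 1
    | (_, .inr (.inr _)) => 1

theorem splineFactors_boundedBy (hN : 1 ≤ N) : (splineFactors n N D).BoundedBy (4 * N) := by
  have hN' : (1 : ℝ) ≤ N := mod_cast hN
  have of_le {x : ℝ} (hx : |x| ≤ 4) : |x| ≤ 4 * N := hx.trans (by linarith)
  have abs_single_le (i j : Fin n) {c : ℝ} (hc : |c| ≤ 4 * N) :
      |(Pi.single i c : Fin n → ℝ) j| ≤ 4 * N := by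
    rw [Pi.single_apply]
    split_ifs
    exacts [hc, of_le (by norm_num)]
  refine ⟨?_, ?_, ?_, ?_⟩
  · rintro ⟨q, i | ⟨i, _⟩ | _⟩ l j
    · exact abs_single_le i j (by rw [Nat.abs_cast]; linarith)
    · exact abs_single_le i j (of_le (by norm_num))
    · exact of_le (by norm_num [splineFactors])
  · rintro ⟨q, i | ⟨i, _⟩ | _⟩ l
    · have hq : ((q.1 i : ℕ) : ℝ) ≤ N + 1 := mod_cast Nat.lt_succ_iff.1 (q.1 i).2
      have hl : ((l : ℕ) : ℝ) ≤ 3 := mod_cast Nat.lt_succ_iff.1 l.2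
      simp only [splineFactors, abs_le]
      constructor <;> linarith [Nat.cast_nonneg (α := ℝ) (q.1 i : ℕ),
        Nat.cast_nonneg (α := ℝ) (l : ℕ)]
    · refine of_le ?_
      simp only [splineFactors]
      split_ifs <;> norm_num
    · exact of_le (by norm_num [splineFactors])
  · rintro ⟨q, i | ⟨i, t⟩ | _⟩ l <;> refine of_le ?_ <;> simp only [splineFactors]
    · fin_cases l <;> norm_num [abs_of_neg]
    · split_ifs
      · fin_cases l <;> norm_num [abs_of_neg]
      · norm_num
    · norm_num
  · rintro ⟨q, i | ⟨i, t⟩ | _⟩ <;> refine of_le ?_ <;> simp only [splineFactors]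
    · norm_num
    · split_ifs <;> norm_num [abs_of_neg]
    · norm_num

theorem splineFactors_eval_spline (q : SplineMonomial n N D) (i : Fin n) (z : Fin n → ℝ) :
    (splineFactors n N D).eval z (q, .inl i) = bSpline (N * z i - (q.1 i : ℕ) + 2) := by
  simp [ShallowFamily.eval, splineFactors, Fin.sum_univ_four, bSpline, Pi.single_apply]
  ring_nf

theorem splineFactors_eval_coord (q : SplineMonomial n N D) (i : Fin n) (t : Fin D)
    {z : Fin n → ℝ} (hz : 0 ≤ z) :
    (splineFactors n N D).eval z (q, .inr (.inl (i, t))) =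
      if (t : ℕ) < q.2 i then z i else 1 := by
  have hzi : 0 ≤ z i := hz i
  simp only [ShallowFamily.eval, splineFactors]
  split_ifs
  · simp [Fin.sum_univ_four, Pi.single_apply, max_eq_right hzi,
      max_eq_right (add_nonneg hzi zero_le_one)]
    ring
  · simp

theorem prod_splineFactors_eval (q : SplineMonomial n N D) {z : Fin n → ℝ} (hz : 0 ≤ z) :
    ∏ f, (splineFactors n N D).eval z (q, f) = tensorSpline N q.1 z * ∏ i, z i ^ (q.2 i : ℕ) := by
  have padding (s) : (splineFactors n N D).eval z (q, .inr (.inr s)) = 1 := by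
    simp [ShallowFamily.eval, splineFactors]
  simp only [Fintype.prod_sum_type, Fintype.prod_prod_type, splineFactors_eval_spline,
    splineFactors_eval_coord q _ _ hz, prod_fin_ite_lt (Nat.lt_succ_iff.1 (q.2 _).2), padding,
    Finset.prod_const_one, mul_one, tensorSpline]

/-- The network which glues the polynomials with coefficients `c j μ` by the partition of unity
`tensorSpline N μ`. -/
noncomputable def splineNet (c : Fin m → (Fin n → Fin (N + 2)) → (Fin n → Fin (D + 1)) → ℝ) :
    ReLUSqNet n m (Fintype.card
      ((Bool ⊕ SplineFactor n D × Fin 4) × SplineMonomial n N D × Finset (SplineFactor n D))) :=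
  (splineFactors n N D).prodNet (fun j q => c j q.1 q.2) (n + n * D)

theorem splineNet_eval (c : Fin m → (Fin n → Fin (N + 2)) → (Fin n → Fin (D + 1)) → ℝ)
    {z : Fin n → ℝ} (hz : 0 ≤ z) (j : Fin m) :
    (splineNet c).eval z j =
      ∑ μ, tensorSpline N μ z * ∑ α, c j μ α * ∏ i, z i ^ (α i : ℕ) := by
  rw [splineNet, ShallowFamily.prodNet_eval _ _ (card_splineFactor n D)]
  simp only [prod_splineFactors_eval _ hz, Fintype.sum_prod_type, Finset.mul_sum, mul_left_comm]

theorem splineNet_boundedBy (hN : 1 ≤ N) {M : ℝ} (hM : 0 ≤ M)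
    {c : Fin m → (Fin n → Fin (N + 2)) → (Fin n → Fin (D + 1)) → ℝ} (hc : ∀ j μ α, |c j μ α| ≤ M) :
    (splineNet c).BoundedBy (2 ^ (n + n * D + 1) * ((4 + M) * N)) := by
  have hN' : (1 : ℝ) ≤ N := mod_cast hN
  have : Nonempty (SplineFactor n D) :=
    Fintype.card_pos_iff.1 (by rw [card_splineFactor]; positivity)
  have h := ShallowFamily.prodNet_boundedBy (by nlinarith : 1 ≤ (4 + M) * (N : ℝ))
    ((splineFactors_boundedBy (n := n) (D := D) hN).mono (by nlinarith))
    (fun j q => (hc j q.1 q.2).trans (by nlinarith)) (n + n * D)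
  rwa [card_splineFactor, Nat.cast_pow, Nat.cast_ofNat] at h

theorem exists_splineNet_size_le (n m D : ℕ) : ∃ K : ℕ, ∀ N, 1 ≤ N →
    Fintype.card ((Bool ⊕ SplineFactor n D × Fin 4) × SplineMonomial n N D ×
      Finset (SplineFactor n D)) ≤ K * N ^ n ∧
    ∀ c : Fin m → (Fin n → Fin (N + 2)) → (Fin n → Fin (D + 1)) → ℝ,
      (splineNet c).sparsity ≤ K * N ^ n := by
  let s := 2 + Fintype.card (SplineFactor n D) * 4
  let r := (n + 1) + (n + n * D + 1) * (s + 1) + m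
  refine ⟨3 ^ n * (D + 1) ^ n * (2 ^ Fintype.card (SplineFactor n D) * (s * r)),
    fun N hN => ⟨?_, fun c => ?_⟩⟩
  · have hr : 1 ≤ r := by lia
    calc _ = Fintype.card (SplineMonomial n N D) *
          (2 ^ Fintype.card (SplineFactor n D) * (s * 1)) := by
          simp only [s, Fintype.card_prod, Fintype.card_sum, Fintype.card_finset, Fintype.card_bool,
            Fintype.card_fin]
          ring
      _ ≤ 3 ^ n * (D + 1) ^ n * N ^ n * (2 ^ Fintype.card (SplineFactor n D) * (s * r)) := by
          gcongr
          exact card_splineMonomial_le hN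
      _ = _ := by ring
  · calc _ ≤ Fintype.card (SplineMonomial n N D) *
          (2 ^ Fintype.card (SplineFactor n D) * (s * r)) := by
          refine (ShallowFamily.prodNet_sparsity_le ..).trans_eq ?_
          simp only [s, r, Fintype.card_fin]
      _ ≤ 3 ^ n * (D + 1) ^ n * N ^ n * (2 ^ Fintype.card (SplineFactor n D) * (s * r)) := by
          gcongr
          exact card_splineMonomial_le hN
      _ = _ := by ring

end SplineNet

theorem exists_net_approx (n m k D : ℕ) :
    ∃ L K : ℕ, ∀ M : ℝ, 0 ≤ M → ∃ C : ℝ, 0 < C ∧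
      ∀ N : ℕ, 1 ≤ N → ∀ u : Fin m → (Fin n → ℝ) → ℝ, (∀ j, LocPoly k D M (u j)) →
      ∃ W : ℕ, ∃ net : ReLUSqNet n m W, net.depth = L ∧ W ≤ K * N ^ n ∧
        net.sparsity ≤ K * N ^ n ∧ net.BoundedBy (C * N) ∧
        ∀ z ∈ Icc (0 : Fin n → ℝ) 1, ∀ j, |net.eval z j - u j z| ≤ C / N ^ k := by
  obtain ⟨K, hK⟩ := exists_splineNet_size_le n m D
  refine ⟨n + n * D + 3, K, fun M hM =>
    ⟨2 ^ (n + n * D + 1) * (4 + M) + M * 2 ^ k, by positivity, fun N hN u hu => ?_⟩⟩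
  choose p hp hup using fun j (μ : Fin n → Fin (N + 2)) => hu j _ (splineCenter_mem_Icc N μ)
  choose c hc hpc using hp
  refine ⟨_, splineNet c, ShallowFamily.prodNet_depth .., (hK N hN).1, (hK N hN).2 c,
    (splineNet_boundedBy hN hM hc).mono ?_, fun z hz j => ?_⟩
  · rw [← mul_assoc]
    gcongr
    exact le_add_of_nonneg_right (by positivity)
  · rw [splineNet_eval c hz.1]
    simp only [← hpc]
    refine (abs_sum_tensorSpline_mul_sub_le hN hM hz fun μ => hup j μ z hz).trans ?_
    rw [div_pow, ← mul_div_assoc]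
    gcongr
    exact le_add_of_nonneg_left (by positivity)

/-! ### Calculus of local polynomial approximations -/

section BddPoly

variable {ι : Type*} [Fintype ι] [DecidableEq ι] {D D' : ℕ} {M M' : ℝ} {p q : (ι → ℝ) → ℝ}

theorem IsBddPoly.nonneg (hp : IsBddPoly D M p) : 0 ≤ M := by
  obtain ⟨c, hc, -⟩ := hp
  exact (abs_nonneg _).trans (hc 0)

theorem IsBddPoly.mono_right (hp : IsBddPoly D M p) (h : M ≤ M') : IsBddPoly D M' p := by
  obtain ⟨c, hc, hp⟩ := hp
  exact ⟨c, fun α => (hc α).trans h, hp⟩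

theorem isBddPoly_of_eq_sum_monomials {κ : Type*} (s : Finset κ) (c : κ → ℝ)
    (e : κ → ι → Fin (D + 1)) (hp : ∀ z, p z = ∑ κ ∈ s, c κ * ∏ i, z i ^ (e κ i : ℕ)) :
    IsBddPoly D (∑ κ ∈ s, |c κ|) p := by
  refine ⟨fun α => ∑ κ ∈ s with e κ = α, c κ, fun α => ?_, fun z => ?_⟩
  · exact (Finset.abs_sum_le_sum_abs _ _).trans
      (Finset.sum_le_sum_of_subset_of_nonneg (Finset.filter_subset _ _) fun _ _ _ => abs_nonneg _)
  · rw [hp, ← Finset.sum_fiberwise s e]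
    refine Finset.sum_congr rfl fun α _ => ?_
    rw [Finset.sum_mul]
    refine Finset.sum_congr rfl fun κ hκ => ?_
    rw [(Finset.mem_filter.1 hκ).2]

theorem IsBddPoly.mono_left (hp : IsBddPoly D M p) (h : D ≤ D') :
    IsBddPoly D' (Fintype.card (ι → Fin (D + 1)) * M) p := by
  obtain ⟨c, hc, hp⟩ := hp
  refine (isBddPoly_of_eq_sum_monomials Finset.univ c
    (fun α i => Fin.castLE (Nat.succ_le_succ h) (α i)) (fun z => by simpa using hp z)).mono_right ?_
  refine (Finset.sum_le_card_nsmul _ _ M fun i _ => hc i).trans ?_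
  rw [nsmul_eq_mul, Finset.card_univ]

theorem isBddPoly_const (D : ℕ) (c : ℝ) : IsBddPoly D |c| (fun _ : ι → ℝ => c) := by
  simpa using isBddPoly_of_eq_sum_monomials (p := fun _ : ι → ℝ => c) (D := D)
    (Finset.univ : Finset Unit) (fun _ => c) (fun _ _ => 0) (fun z => by simp)

theorem isBddPoly_coord (i : ι) : IsBddPoly 1 1 (fun z : ι → ℝ => z i) := by
  have := isBddPoly_of_eq_sum_monomials (p := fun z : ι → ℝ => z i) (D := 1)
    (Finset.univ : Finset Unit) (fun _ => 1) (fun _ => Pi.single i 1) (fun z => by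
      rw [Finset.univ_unique, Finset.sum_singleton, one_mul,
        Finset.prod_eq_single i (fun j _ hj => by simp [hj]) (by simp)]
      simp)
  simpa using this

theorem IsBddPoly.add (hp : IsBddPoly D M p) (hq : IsBddPoly D M' q) :
    IsBddPoly D (M + M') (fun z => p z + q z) := by
  obtain ⟨c, hc, hp⟩ := hp
  obtain ⟨c', hc', hq⟩ := hq
  refine ⟨fun α => c α + c' α, fun α => (abs_add_le _ _).trans (add_le_add (hc α) (hc' α)),
    fun z => ?_⟩
  simp only [hp, hq, ← Finset.sum_add_distrib]
  exact Finset.sum_congr rfl fun α _ => by ring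

theorem IsBddPoly.mul (hp : IsBddPoly D M p) (hq : IsBddPoly D' M' q) :
    IsBddPoly (D + D') (Fintype.card ((ι → Fin (D + 1)) × (ι → Fin (D' + 1))) * (M * M'))
      (fun z => p z * q z) := by
  have hM := hp.nonneg
  obtain ⟨c, hc, hp⟩ := hp
  obtain ⟨c', hc', hq⟩ := hq
  refine (isBddPoly_of_eq_sum_monomials (D := D + D') Finset.univ
    (fun α : (ι → Fin (D + 1)) × (ι → Fin (D' + 1)) => c α.1 * c' α.2)
    (fun α i => ⟨α.1 i + α.2 i, by have := (α.1 i).2; have := (α.2 i).2; omega⟩)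
    (fun z => ?_)).mono_right ?_
  · rw [hp, hq, Finset.sum_mul_sum, Fintype.sum_prod_type]
    refine Finset.sum_congr rfl fun α _ => Finset.sum_congr rfl fun β _ => ?_
    simp only [pow_add, Finset.prod_mul_distrib]
    ring
  · refine (Finset.sum_le_card_nsmul _ _ (M * M') fun i _ => ?_).trans ?_
    · rw [abs_mul]
      exact mul_le_mul (hc _) (hc' _) (abs_nonneg _) hM
    · rw [nsmul_eq_mul, Finset.card_univ]

theorem IsBddPoly.abs_apply_le (hp : IsBddPoly D M p) {z : ι → ℝ} (hz : z ∈ Icc (0 : ι → ℝ) 1) :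
    |p z| ≤ Fintype.card (ι → Fin (D + 1)) * M := by
  obtain ⟨c, hc, hp⟩ := hp
  rw [hp]
  refine (Finset.abs_sum_le_sum_abs _ _).trans ?_
  refine (Finset.sum_le_card_nsmul _ _ M fun α _ => ?_).trans ?_
  · rw [abs_mul, Finset.abs_prod]
    refine (mul_le_of_le_one_right (abs_nonneg _) ?_).trans (hc α)
    refine Finset.prod_le_one (fun _ _ => abs_nonneg _) fun i _ => ?_
    have hzi : 0 ≤ z i := hz.1 i
    rw [abs_pow, abs_of_nonneg hzi]
    exact pow_le_one₀ hzi (hz.2 i)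
  · rw [nsmul_eq_mul, Finset.card_univ]

theorem abs_prod_sub_prod_le {κ : Type*} (s : Finset κ) {x y : κ → ℝ}
    (hx : ∀ i ∈ s, x i ∈ Icc (0 : ℝ) 1) (hy : ∀ i ∈ s, y i ∈ Icc (0 : ℝ) 1) :
    |∏ i ∈ s, x i - ∏ i ∈ s, y i| ≤ ∑ i ∈ s, |x i - y i| := by
  classical
  induction s using Finset.induction_on with
  | empty => simp
  | insert i s hi ih =>
    rw [Finset.prod_insert hi, Finset.prod_insert hi, Finset.sum_insert hi]
    obtain ⟨hxi, hxs⟩ := Finset.forall_mem_insert _ _ _ |>.1 hx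
    obtain ⟨-, hys⟩ := Finset.forall_mem_insert _ _ _ |>.1 hy
    have hp0 : 0 ≤ ∏ i ∈ s, y i := Finset.prod_nonneg fun j hj => (hys j hj).1
    have hp1 : ∏ i ∈ s, y i ≤ 1 :=
      Finset.prod_le_one (fun j hj => (hys j hj).1) fun j hj => (hys j hj).2
    calc |x i * ∏ i ∈ s, x i - y i * ∏ i ∈ s, y i|
        = |(x i - y i) * ∏ i ∈ s, y i + x i * (∏ i ∈ s, x i - ∏ i ∈ s, y i)| := by ring_nf
      _ ≤ |x i - y i| * ∏ i ∈ s, y i + x i * |∏ i ∈ s, x i - ∏ i ∈ s, y i| := by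
        refine (abs_add_le _ _).trans_eq ?_
        rw [abs_mul, abs_mul, abs_of_nonneg hp0, abs_of_nonneg hxi.1]
      _ ≤ |x i - y i| + ∑ i ∈ s, |x i - y i| :=
        add_le_add (mul_le_of_le_one_right (abs_nonneg _) hp1)
          ((mul_le_of_le_one_left (abs_nonneg _) hxi.2).trans (ih hxs hys))

theorem IsBddPoly.abs_sub_le (hp : IsBddPoly D M p) {z a : ι → ℝ} (hz : z ∈ Icc (0 : ι → ℝ) 1)
    (ha : a ∈ Icc (0 : ι → ℝ) 1) :
    |p z - p a| ≤ Fintype.card (ι → Fin (D + 1)) * (M * (Fintype.card ι * (D * dist z a))) := by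
  have hM := hp.nonneg
  obtain ⟨c, hc, hp⟩ := hp
  rw [hp, hp, ← Finset.sum_sub_distrib]
  refine (Finset.abs_sum_le_sum_abs _ _).trans ?_
  refine (Finset.sum_le_card_nsmul _ _ (M * (Fintype.card ι * (D * dist z a))) fun α _ => ?_).trans
    (by rw [nsmul_eq_mul, Finset.card_univ])
  rw [← mul_sub, abs_mul]
  refine mul_le_mul (hc α) ?_ (abs_nonneg _) hM
  have hpow : ∀ {z : ι → ℝ}, z ∈ Icc (0 : ι → ℝ) 1 → ∀ i, z i ^ (α i : ℕ) ∈ Icc (0 : ℝ) 1 :=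
    fun hz i => ⟨pow_nonneg (hz.1 i) _, pow_le_one₀ (hz.1 i) (hz.2 i)⟩
  refine (abs_prod_sub_prod_le _ (fun i _ => hpow hz i) fun i _ => hpow ha i).trans ?_
  refine (Finset.sum_le_card_nsmul _ _ (D * dist z a) fun i _ => ?_).trans
    (by rw [nsmul_eq_mul, Finset.card_univ])
  calc |z i ^ (α i : ℕ) - a i ^ (α i : ℕ)|
      ≤ |z i - a i| * (α i : ℕ) * max |z i| |a i| ^ ((α i : ℕ) - 1) :=
        abs_pow_sub_pow_le _ _ _
    _ ≤ dist z a * D * 1 := by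
        gcongr
        · exact dist_le_pi_dist z a i
        · exact Nat.lt_succ_iff.1 (α i).2
        · refine pow_le_one₀ (le_max_of_le_left (abs_nonneg _)) (max_le ?_ ?_)
          · exact abs_le.2 ⟨neg_one_lt_zero.le.trans (hz.1 i), hz.2 i⟩
          · exact abs_le.2 ⟨neg_one_lt_zero.le.trans (ha.1 i), ha.2 i⟩
    _ = D * dist z a := by ring

end BddPoly

section UnifLocPoly

variable {ι T : Type*} [Fintype ι] {k D D' : ℕ} {a : T → ι → ℝ} {u w : T → (ι → ℝ) → ℝ}

theorem dist_le_one_of_mem_Icc {z a : ι → ℝ} (hz : z ∈ Icc (0 : ι → ℝ) 1)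
    (ha : a ∈ Icc (0 : ι → ℝ) 1) : dist z a ≤ 1 :=
  (dist_pi_le_iff zero_le_one).2 fun i =>
    Real.dist_le_of_mem_Icc_01 ⟨hz.1 i, hz.2 i⟩ ⟨ha.1 i, ha.2 i⟩

variable [DecidableEq ι]

/-- A family of functions with local polynomial approximations of order `k` at given base points,
uniformly over the family. -/
def UnifLocPoly (k D : ℕ) (a : T → ι → ℝ) (u : T → (ι → ℝ) → ℝ) : Prop :=
  ∃ M : ℝ, ∀ τ, ∃ p, IsBddPoly D M p ∧
    ∀ z ∈ Icc (0 : ι → ℝ) 1, |u τ z - p z| ≤ M * dist z (a τ) ^ k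

namespace UnifLocPoly

theorem congr (hu : UnifLocPoly k D a u) (h : ∀ τ, ∀ z ∈ Icc (0 : ι → ℝ) 1, w τ z = u τ z) :
    UnifLocPoly k D a w := by
  obtain ⟨M, hM⟩ := hu
  refine ⟨M, fun τ => ?_⟩
  obtain ⟨p, hp, hup⟩ := hM τ
  exact ⟨p, hp, fun z hz => by rw [h τ z hz]; exact hup z hz⟩

theorem mono (hu : UnifLocPoly k D a u) (h : D ≤ D') : UnifLocPoly k D' a u := by
  obtain ⟨M, hM⟩ := hu
  refine ⟨Fintype.card (ι → Fin (D + 1)) * M + M, fun τ => ?_⟩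
  obtain ⟨p, hp, hup⟩ := hM τ
  have := hp.nonneg
  refine ⟨p, (hp.mono_left h).mono_right (by linarith), fun z hz => (hup z hz).trans ?_⟩
  gcongr
  exact le_add_of_nonneg_left (by positivity)

theorem of_abs_sub_le (hu : UnifLocPoly k D a u) (C : ℝ)
    (h : ∀ τ, ∀ z ∈ Icc (0 : ι → ℝ) 1, |w τ z - u τ z| ≤ C * dist z (a τ) ^ k) :
    UnifLocPoly k D a w := by
  obtain ⟨M, hM⟩ := hu
  refine ⟨M + |C|, fun τ => ?_⟩
  obtain ⟨p, hp, hup⟩ := hM τ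
  refine ⟨p, hp.mono_right (by linarith [abs_nonneg C]), fun z hz => ?_⟩
  calc |w τ z - p z| ≤ |w τ z - u τ z| + |u τ z - p z| := abs_sub_le _ _ _
    _ ≤ C * dist z (a τ) ^ k + M * dist z (a τ) ^ k := add_le_add (h τ z hz) (hup z hz)
    _ ≤ |C| * dist z (a τ) ^ k + M * dist z (a τ) ^ k := by gcongr; exact le_abs_self C
    _ = (M + |C|) * dist z (a τ) ^ k := by ring

theorem of_isBddPoly (M : ℝ) (h : ∀ τ, IsBddPoly D M (u τ)) : UnifLocPoly k D a u := by
  refine ⟨M, fun τ => ⟨u τ, h τ, fun z _ => ?_⟩⟩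
  have := (h τ).nonneg
  simp only [sub_self, abs_zero]
  positivity

theorem const {c : T → ℝ} {C : ℝ} (h : ∀ τ, |c τ| ≤ C) : UnifLocPoly k D a (fun τ _ => c τ) :=
  .of_isBddPoly C fun τ => (isBddPoly_const D (c τ)).mono_right (h τ)

theorem coord (i : ι) : UnifLocPoly k 1 a (fun _ z => z i) :=
  .of_isBddPoly 1 fun _ => isBddPoly_coord i

theorem add (hu : UnifLocPoly k D a u) (hw : UnifLocPoly k D a w) :
    UnifLocPoly k D a (fun τ z => u τ z + w τ z) := by
  obtain ⟨M, hM⟩ := hu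
  obtain ⟨M', hM'⟩ := hw
  refine ⟨M + M', fun τ => ?_⟩
  obtain ⟨p, hp, hup⟩ := hM τ
  obtain ⟨q, hq, hwq⟩ := hM' τ
  refine ⟨_, hp.add hq, fun z hz => ?_⟩
  rw [add_sub_add_comm, add_mul]
  exact (abs_add_le _ _).trans (add_le_add (hup z hz) (hwq z hz))

theorem exists_abs_le (hu : UnifLocPoly k D a u) (ha : ∀ τ, a τ ∈ Icc (0 : ι → ℝ) 1) :
    ∃ B : ℝ, 0 ≤ B ∧ ∀ τ, ∀ z ∈ Icc (0 : ι → ℝ) 1, |u τ z| ≤ B := by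
  obtain ⟨M, hM⟩ := hu
  refine ⟨|M| + Fintype.card (ι → Fin (D + 1)) * |M|, by positivity, fun τ z hz => ?_⟩
  obtain ⟨p, hp, hup⟩ := hM τ
  rw [abs_of_nonneg hp.nonneg]
  calc |u τ z| = |(u τ z - p z) + p z| := by ring_nf
    _ ≤ |u τ z - p z| + |p z| := abs_add_le _ _
    _ ≤ M + Fintype.card (ι → Fin (D + 1)) * M :=
      add_le_add ((hup z hz).trans (mul_le_of_le_one_right hp.nonneg
        (pow_le_one₀ dist_nonneg (dist_le_one_of_mem_Icc hz (ha τ))))) (hp.abs_apply_le hz)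

theorem mul (ha : ∀ τ, a τ ∈ Icc (0 : ι → ℝ) 1) (hu : UnifLocPoly k D a u)
    (hw : UnifLocPoly k D' a w) : UnifLocPoly k (D + D') a (fun τ z => u τ z * w τ z) := by
  obtain ⟨B, hB0, hB⟩ := hw.exists_abs_le ha
  obtain ⟨M, hM⟩ := hu
  obtain ⟨M', hM'⟩ := hw
  let C : ℝ := Fintype.card (ι → Fin (D + 1))
  let C' : ℝ := Fintype.card ((ι → Fin (D + 1)) × (ι → Fin (D' + 1)))
  refine ⟨C' * (M * M') + (M * B + C * M * M'), fun τ => ?_⟩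
  obtain ⟨p, hp, hup⟩ := hM τ
  obtain ⟨q, hq, hwq⟩ := hM' τ
  have hM0 := hp.nonneg
  have hM0' := hq.nonneg
  refine ⟨_, (hp.mul hq).mono_right (le_add_of_nonneg_right (by positivity)), fun z hz => ?_⟩
  calc |u τ z * w τ z - p z * q z|
      = |(u τ z - p z) * w τ z + p z * (w τ z - q z)| := by ring_nf
    _ ≤ |u τ z - p z| * |w τ z| + |p z| * |w τ z - q z| := by
      rw [← abs_mul, ← abs_mul]; exact abs_add_le _ _
    _ ≤ (M * dist z (a τ) ^ k) * B + (C * M) * (M' * dist z (a τ) ^ k) :=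
      add_le_add (mul_le_mul (hup z hz) (hB τ z hz) (abs_nonneg _) (by positivity))
        (mul_le_mul (hp.abs_apply_le hz) (hwq z hz) (abs_nonneg _) (by positivity))
    _ = (M * B + C * M * M') * dist z (a τ) ^ k := by ring
    _ ≤ (C' * (M * M') + (M * B + C * M * M')) * dist z (a τ) ^ k := by
      refine mul_le_mul_of_nonneg_right ?_ (by positivity)
      exact le_add_of_nonneg_left (by positivity)

theorem const_mul {c : T → ℝ} {C : ℝ} (ha : ∀ τ, a τ ∈ Icc (0 : ι → ℝ) 1)
    (h : ∀ τ, |c τ| ≤ C) (hu : UnifLocPoly k D a u) :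
    UnifLocPoly k D a (fun τ z => c τ * u τ z) :=
  zero_add D ▸ (const (D := 0) h).mul ha hu

theorem sub (ha : ∀ τ, a τ ∈ Icc (0 : ι → ℝ) 1) (hu : UnifLocPoly k D a u)
    (hw : UnifLocPoly k D a w) : UnifLocPoly k D a (fun τ z => u τ z - w τ z) :=
  (hu.add (hw.const_mul (c := fun _ => -1) (C := 1) ha (by simp))).congr fun τ z _ => by ring

theorem sum {κ : Type*} (s : Finset κ) {u : κ → T → (ι → ℝ) → ℝ}
    (h : ∀ i ∈ s, UnifLocPoly k D a (u i)) :
    UnifLocPoly k D a (fun τ z => ∑ i ∈ s, u i τ z) := by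
  classical
  induction s using Finset.induction_on with
  | empty => simpa using const (c := fun _ : T => (0 : ℝ)) (C := 0) (by simp)
  | insert i s hi ih =>
    simp only [Finset.sum_insert hi]
    exact (h i (by simp)).add (ih fun j hj => h j (by simp [hj]))

theorem prod {κ : Type*} (s : Finset κ) {u : κ → T → (ι → ℝ) → ℝ}
    (ha : ∀ τ, a τ ∈ Icc (0 : ι → ℝ) 1) (h : ∀ i ∈ s, UnifLocPoly k D a (u i)) :
    UnifLocPoly k (s.card * D) a (fun τ z => ∏ i ∈ s, u i τ z) := by
  classical
  induction s using Finset.induction_on with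
  | empty => simpa using const (c := fun _ : T => (1 : ℝ)) (C := 1) (by simp)
  | insert i s hi ih =>
    simp only [Finset.prod_insert hi, Finset.card_insert_of_notMem hi, add_mul, one_mul]
    rw [add_comm]
    exact (h i (by simp)).mul ha (ih fun j hj => h j (by simp [hj]))

theorem pow (ha : ∀ τ, a τ ∈ Icc (0 : ι → ℝ) 1) (h : UnifLocPoly k D a u) (n : ℕ) :
    UnifLocPoly k (n * D) a (fun τ z => u τ z ^ n) := by
  simpa using prod (Finset.range n) ha (fun _ _ => h)

theorem exists_abs_sub_le (hu : UnifLocPoly k D a u) (hk : 1 ≤ k)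
    (ha : ∀ τ, a τ ∈ Icc (0 : ι → ℝ) 1) :
    ∃ K : ℝ, 0 ≤ K ∧ ∀ τ, ∀ z ∈ Icc (0 : ι → ℝ) 1, |u τ z - u τ (a τ)| ≤ K * dist z (a τ) := by
  obtain ⟨M, hM⟩ := hu
  refine ⟨|M| + Fintype.card (ι → Fin (D + 1)) * (|M| * (Fintype.card ι * D)), by positivity,
    fun τ z hz => ?_⟩
  obtain ⟨p, hp, hup⟩ := hM τ
  rw [abs_of_nonneg hp.nonneg]
  have hbase : u τ (a τ) = p (a τ) := by
    have h := hup _ (ha τ)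
    rw [dist_self, zero_pow (by omega), mul_zero] at h
    exact sub_eq_zero.1 (abs_nonpos_iff.1 h)
  calc |u τ z - u τ (a τ)| ≤ |u τ z - p z| + |p z - p (a τ)| := hbase ▸ abs_sub_le _ _ _
    _ ≤ M * dist z (a τ)
        + Fintype.card (ι → Fin (D + 1)) * (M * (Fintype.card ι * (D * dist z (a τ)))) := by
      refine add_le_add ((hup z hz).trans (mul_le_mul_of_nonneg_left ?_ hp.nonneg))
        (hp.abs_sub_le hz (ha τ))
      exact pow_le_of_le_one dist_nonneg (dist_le_one_of_mem_Icc hz (ha τ)) (by omega)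
    _ = _ := by ring

end UnifLocPoly

theorem inv_eq_geom_sum_add {K : Type*} [Field K] {c u : K} (hc : c ≠ 0) (hu : u ≠ 0) (k : ℕ) :
    u⁻¹ = ∑ n ∈ Finset.range k, (c⁻¹) ^ (n + 1) * (c - u) ^ n + (c⁻¹ * (c - u)) ^ k * u⁻¹ := by
  induction k with
  | zero => simp
  | succ k ih =>
    rw [Finset.sum_range_succ, add_assoc]
    nth_rewrite 1 [ih]
    congr 1
    have : u⁻¹ = c⁻¹ + c⁻¹ * (c - u) * u⁻¹ := by field_simp; ring
    nth_rewrite 1 [this]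
    generalize c - u = s
    ring

theorem abs_inv_sub_geom_sum_le {L c u δ : ℝ} (hL : 0 < L) (hc : L ≤ c) (hu : L ≤ u)
    (hδ : |c - u| ≤ δ) (k : ℕ) :
    |u⁻¹ - ∑ n ∈ Finset.range k, (c⁻¹) ^ (n + 1) * (c - u) ^ n| ≤ (L⁻¹ * δ) ^ k * L⁻¹ := by
  have hc0 := hL.trans_le hc
  have hu0 := hL.trans_le hu
  have hδ0 := (abs_nonneg _).trans hδ
  rw [sub_eq_of_eq_add' (inv_eq_geom_sum_add hc0.ne' hu0.ne' k), abs_mul, abs_pow, abs_mul,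
    abs_of_pos (inv_pos.2 hu0), abs_of_pos (inv_pos.2 hc0)]
  gcongr

theorem UnifLocPoly.inv (ha : ∀ τ, a τ ∈ Icc (0 : ι → ℝ) 1) (hk : 1 ≤ k)
    (hu : UnifLocPoly k D a u) {L : ℝ} (hL : 0 < L)
    (hlow : ∀ τ, ∀ z ∈ Icc (0 : ι → ℝ) 1, L ≤ u τ z) :
    UnifLocPoly k (k * D) a (fun τ z => (u τ z)⁻¹) := by
  obtain ⟨C, -, hC⟩ := hu.exists_abs_le ha
  obtain ⟨K, -, hK⟩ := hu.exists_abs_sub_le hk ha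
  have hdiff : UnifLocPoly k D a (fun τ z => u τ (a τ) - u τ z) :=
    (const fun τ => hC τ _ (ha τ)).sub ha hu
  have hinv : ∀ τ, |(u τ (a τ))⁻¹| ≤ L⁻¹ := fun τ => by
    have := hlow τ _ (ha τ)
    rw [abs_of_pos (inv_pos.2 (hL.trans_le this))]
    gcongr
  have hsum : UnifLocPoly k (k * D) a (fun τ z => ∑ n ∈ Finset.range k,
      (u τ (a τ))⁻¹ ^ (n + 1) * (u τ (a τ) - u τ z) ^ n) := by
    refine .sum _ fun n hn => .const_mul (C := L⁻¹ ^ (n + 1)) ha (fun τ => ?_)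
      ((hdiff.pow ha n).mono (Nat.mul_le_mul_right _ (Finset.mem_range.1 hn).le))
    rw [abs_pow]
    exact pow_le_pow_left₀ (abs_nonneg _) (hinv τ) _
  refine hsum.of_abs_sub_le ((L⁻¹ * K) ^ k * L⁻¹) fun τ z hz => ?_
  refine (abs_inv_sub_geom_sum_le hL (hlow τ _ (ha τ)) (hlow τ z hz)
    ((abs_sub_comm _ _).trans_le (hK τ z hz)) k).trans_eq ?_
  rw [← mul_assoc, mul_pow]
  ring

end UnifLocPoly

/-! ### Taylor expansion of densities on the cube -/

section Taylor

variable {E F : Type*} [NormedAddCommGroup E] [NormedSpace ℝ E] [NormedAddCommGroup F]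
  [NormedSpace ℝ F] {q : E → F} {S : Set E} {b y : E}

theorem iteratedDerivWithin_comp_lineMap (hS : Convex ℝ S) (hSd : UniqueDiffOn ℝ S) {n : ℕ}
    (hq : ContDiffOn ℝ n q S) (hb : b ∈ S) (hy : y ∈ S) {t : ℝ} (ht : t ∈ Icc (0 : ℝ) 1) :
    iteratedDerivWithin n (q ∘ AffineMap.lineMap b y) (Icc 0 1) t =
      iteratedFDerivWithin ℝ n q S (AffineMap.lineMap b y t) (fun _ => y - b) := by
  let g : ℝ →ᴬ[ℝ] E := ContinuousAffineMap.lineMap b y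
  have hg : ∀ t, g t = b + t • (y - b) := fun t => by
    simp [g, ContinuousAffineMap.coe_lineMap_eq, AffineMap.lineMap_apply, add_comm]
  have hg_contLinear : ∀ t, g.contLinear t = t • (y - b) := fun t => by
    have := g.contLinear_map_vsub t 0
    simpa only [vsub_eq_sub, sub_zero, hg, zero_smul, add_zero, add_sub_cancel_left] using this
  have hmaps : Icc (0 : ℝ) 1 ⊆ g ⁻¹' S := fun t ht => by
    rw [mem_preimage, hg]
    exact hS.add_smul_sub_mem hb hy ht
  have hT := ((hq.ftaylorSeriesWithin hSd).comp_continuousAffineMap g).mono hmaps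
  rw [iteratedDerivWithin_eq_iteratedFDerivWithin]
  change iteratedFDerivWithin ℝ n (q ∘ g) _ t _ = iteratedFDerivWithin ℝ n q S (g t) _
  rw [← hT.eq_iteratedFDerivWithin_of_uniqueDiffOn le_rfl (uniqueDiffOn_Icc zero_lt_one) ht]
  simp [hg_contLinear, ftaylorSeriesWithin]

theorem norm_sub_sum_iteratedFDerivWithin_le {k : ℕ} (hS : Convex ℝ S)
    (hSd : UniqueDiffOn ℝ S) (hq : ContDiffOn ℝ (k + 1 : ℕ) q S) {C : ℝ}
    (hC : ∀ x ∈ S, ‖iteratedFDerivWithin ℝ (k + 1) q S x‖ ≤ C) (hb : b ∈ S) (hy : y ∈ S) :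
    ‖q y - ∑ n ∈ Finset.range (k + 1), (n ! : ℝ)⁻¹ •
      iteratedFDerivWithin ℝ n q S b (fun _ => y - b)‖ ≤ C * ‖y - b‖ ^ (k + 1) / k ! := by
  have hmaps : MapsTo (AffineMap.lineMap b y : ℝ → E) (Icc 0 1) S := fun t ht =>
    hS.segment_subset hb hy (lineMap_mem_segment ℝ b y ht)
  have hderiv : ∀ n ≤ k + 1, ∀ t ∈ Icc (0 : ℝ) 1,
      iteratedDerivWithin n (q ∘ AffineMap.lineMap b y) (Icc 0 1) t =
        iteratedFDerivWithin ℝ n q S (AffineMap.lineMap b y t) (fun _ => y - b) := fun n hn t ht =>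
    iteratedDerivWithin_comp_lineMap hS hSd (hq.of_le (by exact_mod_cast hn)) hb hy ht
  have hcont : ContDiffOn ℝ (k + 1) (q ∘ AffineMap.lineMap b y) (Icc (0 : ℝ) 1) := by
    refine ContDiffOn.comp (by exact_mod_cast hq) ?_ hmaps
    exact (ContinuousAffineMap.lineMap b y : ℝ →ᴬ[ℝ] E).contDiff.contDiffOn
  have h := taylor_mean_remainder_bound (x := 1) (C := C * ‖y - b‖ ^ (k + 1)) zero_le_one hcont
    (by simp) fun t ht => by
      rw [hderiv _ le_rfl t ht]
      refine (ContinuousMultilinearMap.le_opNorm _ _).trans ?_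
      rw [Finset.prod_const, Finset.card_univ, Fintype.card_fin]
      gcongr
      exact hC _ (hmaps ht)
  rw [taylor_within_apply, Finset.sum_congr rfl fun n hn => by
    rw [hderiv n (Finset.mem_range.1 hn).le 0 (by simp)]] at h
  simpa only [Function.comp_apply, AffineMap.lineMap_apply_one, AffineMap.lineMap_apply_zero,
    sub_zero, one_pow, mul_one] using h

end Taylor

theorem convex_unitCube (d : ℕ) : Convex ℝ (unitCube d) := by
  intro x hx y hy a b ha hb hab i
  simpa using convex_Icc (0 : ℝ) 1 (hx i) (hy i) ha hb hab

theorem uniqueDiffOn_unitCube (d : ℕ) : UniqueDiffOn ℝ (unitCube d) := by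
  refine uniqueDiffOn_convex (convex_unitCube d) ⟨WithLp.toLp 2 (fun _ => 1 / 2), ?_⟩
  have hopen : IsOpen {x : EuclideanSpace ℝ (Fin d) | ∀ i, x i ∈ Ioo (0 : ℝ) 1} := by
    simp only [ofPred_forall]
    exact isOpen_iInter_of_finite fun i => isOpen_Ioo.preimage (by fun_prop)
  refine interior_maximal (t := {x : EuclideanSpace ℝ (Fin d) | ∀ i, x i ∈ Ioo (0 : ℝ) 1})
    (fun x hx i => Ioo_subset_Icc_self (hx i)) hopen fun i => ?_
  norm_num

theorem isClosed_unitCube (d : ℕ) : IsClosed (unitCube d) := by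
  simp only [unitCube, ofPred_forall]
  exact isClosed_iInter fun i => isClosed_Icc.preimage (by fun_prop)

theorem euclidean_norm_le_sum {ι : Type*} [Fintype ι] (x : EuclideanSpace ℝ ι) :
    ‖x‖ ≤ ∑ i, |x i| := by
  classical
  conv_lhs => rw [← (EuclideanSpace.basisFun ι ℝ).sum_repr x]
  refine (norm_sum_le _ _).trans_eq (Finset.sum_congr rfl fun i _ => ?_)
  rw [norm_smul, OrthonormalBasis.norm_eq_one, mul_one, EuclideanSpace.basisFun_repr,
    Real.norm_eq_abs]

theorem continuousMultilinearMap_diag_eq_sum {ι F : Type*} [Fintype ι] [NormedAddCommGroup F]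
    [NormedSpace ℝ F] {n : ℕ}
    (m : ContinuousMultilinearMap ℝ (fun _ : Fin n => EuclideanSpace ℝ ι) F)
    (w : EuclideanSpace ℝ ι) :
    m (fun _ => w) = ∑ r : Fin n → ι, (∏ l, w (r l)) •
      m (fun l => EuclideanSpace.basisFun ι ℝ (r l)) := by
  classical
  conv_lhs => rw [← (EuclideanSpace.basisFun ι ℝ).sum_repr w]
  rw [m.map_sum]
  refine Finset.sum_congr rfl fun r _ => ?_
  rw [m.map_smul_univ]
  simp only [EuclideanSpace.basisFun_repr]

/-- The coefficient of `h_{r 0} ⋯ h_{r (n - 1)}` in the Taylor expansion of `q (x + h)` at a point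
`x` of the unit cube. -/
noncomputable def taylorCoeff {d n : ℕ} (q : EuclideanSpace ℝ (Fin d) → ℝ)
    (x : EuclideanSpace ℝ (Fin d)) (r : Fin n → Fin d) : ℝ :=
  (n ! : ℝ)⁻¹ * iteratedFDerivWithin ℝ n q (unitCube d) x
    (fun i => EuclideanSpace.basisFun (Fin d) ℝ (r i))

namespace IsCubeDensity

variable {d k : ℕ} {L₁ L₂ : ℝ} {q : EuclideanSpace ℝ (Fin d) → ℝ}

theorem norm_iteratedFDerivWithin_le (hq : IsCubeDensity k L₁ L₂ q) (hL : 0 ≤ L₁) {n : ℕ}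
    (hn : n ≤ k) {x : EuclideanSpace ℝ (Fin d)} (hx : x ∈ unitCube d) :
    ‖iteratedFDerivWithin ℝ n q (unitCube d) x‖ ≤ L₁ := by
  have h : ‖iteratedFDerivWithin ℝ n q (unitCube d) x‖ₑ ≤ ENNReal.ofReal L₁ := by
    refine le_trans ?_ hq.norm_le
    exact le_iSup₂_of_le n hn (le_iSup₂_of_le x hx le_rfl)
  rw [← ofReal_norm] at h
  exact (ENNReal.ofReal_le_ofReal_iff hL).1 h

theorem abs_le (hq : IsCubeDensity k L₁ L₂ q) (hL : 0 ≤ L₁) {x : EuclideanSpace ℝ (Fin d)}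
    (hx : x ∈ unitCube d) : |q x| ≤ L₁ := by
  have := hq.norm_iteratedFDerivWithin_le hL (Nat.zero_le k) hx
  rwa [norm_iteratedFDerivWithin_zero, Real.norm_eq_abs] at this

theorem abs_taylorCoeff_le (hq : IsCubeDensity k L₁ L₂ q) (hL : 0 ≤ L₁) {n : ℕ} (hn : n ≤ k)
    {x : EuclideanSpace ℝ (Fin d)} (hx : x ∈ unitCube d) (r : Fin n → Fin d) :
    |taylorCoeff q x r| ≤ L₁ := by
  have h := (iteratedFDerivWithin ℝ n q (unitCube d) x).le_opNorm
    (fun i => EuclideanSpace.basisFun (Fin d) ℝ (r i))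
  simp only [OrthonormalBasis.norm_eq_one, Finset.prod_const_one, mul_one] at h
  rw [taylorCoeff, abs_mul, abs_of_nonneg (by positivity)]
  exact (mul_le_of_le_one_left (abs_nonneg _) (inv_le_one_of_one_le₀ (by
    exact_mod_cast Nat.succ_le_of_lt n.factorial_pos))).trans
    (h.trans (hq.norm_iteratedFDerivWithin_le hL hn hx))

theorem continuousOn_taylorCoeff (hq : IsCubeDensity k L₁ L₂ q) {n : ℕ} (hn : n ≤ k)
    (r : Fin n → Fin d) : ContinuousOn (fun x => taylorCoeff q x r) (unitCube d) :=
  continuousOn_const.mul ((ContinuousMultilinearMap.apply ℝ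
    (fun _ : Fin n => EuclideanSpace ℝ (Fin d)) ℝ _).continuous.comp_continuousOn
      (hq.contDiffOn.continuousOn_iteratedFDerivWithin (by exact_mod_cast hn)
        (uniqueDiffOn_unitCube d)))

theorem abs_sub_taylor_le (hq : IsCubeDensity k L₁ L₂ q) (hL : 0 ≤ L₁) {m : ℕ} (hm : m + 1 ≤ k)
    {b y : EuclideanSpace ℝ (Fin d)} (hb : b ∈ unitCube d) (hy : y ∈ unitCube d) :
    |q y - ∑ n ∈ Finset.range (m + 1), ∑ r : Fin n → Fin d,
      taylorCoeff q b r * ∏ i, (y - b) (r i)| ≤ L₁ * ‖y - b‖ ^ (m + 1) := by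
  have h := norm_sub_sum_iteratedFDerivWithin_le (convex_unitCube d)
    (uniqueDiffOn_unitCube d) (hq.contDiffOn.of_le (by exact_mod_cast hm))
    (fun _ hx => hq.norm_iteratedFDerivWithin_le hL hm hx) hb hy
  have hsum : ∀ n, (n ! : ℝ)⁻¹ • iteratedFDerivWithin ℝ n q (unitCube d) b (fun _ => y - b) =
      ∑ r : Fin n → Fin d, taylorCoeff q b r * ∏ i, (y - b) (r i) := fun n => by
    rw [continuousMultilinearMap_diag_eq_sum, Finset.smul_sum]
    refine Finset.sum_congr rfl fun r _ => ?_
    rw [taylorCoeff, smul_eq_mul, smul_eq_mul]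
    ring
  simp only [hsum, Real.norm_eq_abs] at h
  exact h.trans (div_le_self (by positivity) (by
    exact_mod_cast Nat.succ_le_of_lt m.factorial_pos))

end IsCubeDensity

/-! ### Averages of densities over diagonal affine maps of the cube -/

/-- The diagonal affine map `x ↦ (lᵢ xᵢ + bᵢ)ᵢ`. -/
def diagAffine {d : ℕ} (l b : Fin d → ℝ) (x : EuclideanSpace ℝ (Fin d)) :
    EuclideanSpace ℝ (Fin d) :=
  WithLp.toLp 2 (fun i => l i * x i + b i)

/-- The spatial part of a point `(x, t)`. -/
def spatial {d : ℕ} (z : Fin (d + 1) → ℝ) : EuclideanSpace ℝ (Fin d) :=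
  WithLp.toLp 2 (fun i => z i.castSucc)

theorem spatial_mem {d : ℕ} {z : Fin (d + 1) → ℝ} (hz : z ∈ Icc (0 : Fin (d + 1) → ℝ) 1) :
    spatial z ∈ unitCube d := fun i => ⟨hz.1 i.castSucc, hz.2 i.castSucc⟩

/-- A probability space of diagonal affine maps of the cube into itself. -/
structure IsCubeAverage {d : ℕ} {Ω : Type*} [MeasurableSpace Ω] (P : Measure Ω)
    (l b : Ω → Fin d → ℝ) : Prop where
  prob : IsProbabilityMeasure P
  meas_l : Measurable l
  meas_b : Measurable b
  l_mem : ∀ᵐ ω ∂P, ∀ i, l ω i ∈ Icc (0 : ℝ) 1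
  maps : ∀ᵐ ω ∂P, ∀ x ∈ unitCube d, diagAffine (l ω) (b ω) x ∈ unitCube d

theorem diagAffine_sub {d : ℕ} {l b : Fin d → ℝ} (x y : EuclideanSpace ℝ (Fin d)) (i : Fin d) :
    (diagAffine l b x - diagAffine l b y) i = l i * (x i - y i) := by
  simp only [diagAffine, PiLp.sub_apply]
  ring

theorem norm_diagAffine_sub_le {d : ℕ} {l b : Fin d → ℝ} (hl : ∀ i, l i ∈ Icc (0 : ℝ) 1)
    (z a : Fin (d + 1) → ℝ) :
    ‖diagAffine l b (spatial z) - diagAffine l b (spatial a)‖ ≤ d * dist z a := by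
  refine (euclidean_norm_le_sum _).trans ?_
  refine (Finset.sum_le_card_nsmul _ _ (dist z a) fun i _ => ?_).trans (by simp)
  rw [diagAffine_sub, abs_mul, abs_of_nonneg (hl i).1]
  exact (mul_le_of_le_one_left (abs_nonneg _) (hl i).2).trans (dist_le_pi_dist z a i.castSucc)

namespace IsCubeAverage

variable {d k : ℕ} {L₁ L₂ : ℝ} {Ω : Type*} [MeasurableSpace Ω] {P : Measure Ω}
  {l b : Ω → Fin d → ℝ}

theorem aestronglyMeasurable (hA : IsCubeAverage P l b) {f : EuclideanSpace ℝ (Fin d) → ℝ}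
    (hf : ContinuousOn f (unitCube d)) {x : EuclideanSpace ℝ (Fin d)} (hx : x ∈ unitCube d) :
    AEStronglyMeasurable (fun ω => f (diagAffine (l ω) (b ω) x)) P := by
  have hmeas : Measurable fun ω => diagAffine (l ω) (b ω) x :=
    (WithLp.measurable_toLp 2 _).comp (measurable_pi_lambda _ fun i =>
      (((measurable_pi_apply i).comp hA.meas_l).mul_const _).add
        ((measurable_pi_apply i).comp hA.meas_b))
  classical
  have hf' : Measurable ((unitCube d).piecewise f fun _ => 0) :=
    hf.measurable_piecewise continuousOn_const (isClosed_unitCube d).measurableSet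
  refine (hf'.comp hmeas).aestronglyMeasurable.congr ?_
  filter_upwards [hA.maps] with ω h
  exact Set.piecewise_eq_of_mem _ _ _ (h x hx)

theorem integrable (hA : IsCubeAverage P l b) {f : EuclideanSpace ℝ (Fin d) → ℝ}
    (hf : ContinuousOn f (unitCube d)) {C : ℝ} (hC : ∀ x ∈ unitCube d, |f x| ≤ C)
    {x : EuclideanSpace ℝ (Fin d)} (hx : x ∈ unitCube d) :
    Integrable (fun ω => f (diagAffine (l ω) (b ω) x)) P := by
  have := hA.prob
  refine Integrable.of_bound (hA.aestronglyMeasurable hf hx) C ?_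
  filter_upwards [hA.maps] with ω h
  exact hC _ (h x hx)

variable {n : ℕ} {x : EuclideanSpace ℝ (Fin d)}

section Coeff

variable {q : EuclideanSpace ℝ (Fin d) → ℝ}

theorem norm_taylorCoeff_mul_prod_le (hA : IsCubeAverage P l b) (hq : IsCubeDensity k L₁ L₂ q)
    (hL : 0 ≤ L₁) (hn : n ≤ k) (hx : x ∈ unitCube d) (r : Fin n → Fin d) :
    ∀ᵐ ω ∂P, ‖taylorCoeff q (diagAffine (l ω) (b ω) x) r * ∏ i, l ω (r i)‖ ≤ L₁ := by
  filter_upwards [hA.maps, hA.l_mem] with ω hmaps hl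
  rw [norm_mul, Real.norm_eq_abs, Real.norm_eq_abs,
    abs_of_nonneg (Finset.prod_nonneg fun i _ => (hl (r i)).1)]
  exact (mul_le_of_le_one_right (abs_nonneg _) (Finset.prod_le_one (fun i _ => (hl (r i)).1)
    fun i _ => (hl (r i)).2)).trans (hq.abs_taylorCoeff_le hL hn (hmaps x hx) r)

theorem integrable_taylorCoeff_mul_prod (hA : IsCubeAverage P l b) (hq : IsCubeDensity k L₁ L₂ q)
    (hL : 0 ≤ L₁) (hn : n ≤ k) (hx : x ∈ unitCube d) (r : Fin n → Fin d) :
    Integrable (fun ω => taylorCoeff q (diagAffine (l ω) (b ω) x) r * ∏ i, l ω (r i)) P := by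
  have := hA.prob
  refine Integrable.of_bound (.mul ?_ ?_) L₁ (hA.norm_taylorCoeff_mul_prod_le hq hL hn hx r)
  · exact hA.aestronglyMeasurable (hq.continuousOn_taylorCoeff hn r) hx
  · exact (Finset.measurable_prod _ fun i _ =>
      (measurable_pi_apply (r i)).comp hA.meas_l).aestronglyMeasurable

theorem abs_integral_sub_taylor_le (hA : IsCubeAverage P l b) (hq : IsCubeDensity k L₁ L₂ q)
    (hL : 0 ≤ L₁) {m : ℕ} (hm : m + 1 ≤ k) {z a : Fin (d + 1) → ℝ}
    (hz : z ∈ Icc (0 : Fin (d + 1) → ℝ) 1) (ha : a ∈ Icc (0 : Fin (d + 1) → ℝ) 1) :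
    |∫ ω, q (diagAffine (l ω) (b ω) (spatial z)) ∂P -
      ∑ n ∈ Finset.range (m + 1), ∑ r : Fin n → Fin d,
        (∫ ω, taylorCoeff q (diagAffine (l ω) (b ω) (spatial a)) r * ∏ i, l ω (r i) ∂P) *
          ∏ i, (z (r i).castSucc - a (r i).castSucc)| ≤ L₁ * d ^ (m + 1) * dist z a ^ (m + 1) := by
  have := hA.prob
  have hcoeff : ∀ n ∈ Finset.range (m + 1), ∀ r : Fin n → Fin d, Integrable (fun ω =>
      taylorCoeff q (diagAffine (l ω) (b ω) (spatial a)) r * (∏ i, l ω (r i)) *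
        ∏ i, (z (r i).castSucc - a (r i).castSucc)) P := fun n hn r =>
    (hA.integrable_taylorCoeff_mul_prod hq hL (by have := Finset.mem_range.1 hn; omega)
      (spatial_mem ha) r).mul_const _
  have hq_int : Integrable (fun ω => q (diagAffine (l ω) (b ω) (spatial z))) P :=
    hA.integrable hq.contDiffOn.continuousOn (fun x hx => hq.abs_le hL hx) (spatial_mem hz)
  simp only [← integral_mul_const]
  rw [Finset.sum_congr rfl fun n hn => (integral_finsetSum _ fun r _ => hcoeff n hn r).symm,
    ← integral_finsetSum _ fun n hn => integrable_finsetSum _ fun r _ => hcoeff n hn r,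
    ← integral_sub hq_int (integrable_finsetSum _ fun n hn =>
      integrable_finsetSum _ fun r _ => hcoeff n hn r)]
  rw [← Real.norm_eq_abs]
  refine (norm_integral_le_of_norm_le_const (C := L₁ * d ^ (m + 1) * dist z a ^ (m + 1))
    ?_).trans_eq (by rw [probReal_univ, mul_one])
  filter_upwards [hA.maps, hA.l_mem] with ω hmaps hl
  have htaylor := hq.abs_sub_taylor_le hL hm (hmaps _ (spatial_mem ha)) (hmaps _ (spatial_mem hz))
  simp only [diagAffine_sub, Finset.prod_mul_distrib, ← mul_assoc] at htaylor
  refine htaylor.trans ?_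
  rw [mul_assoc, ← mul_pow]
  gcongr
  exact norm_diagAffine_sub_le hl z a

end Coeff

theorem unifLocPoly {T : Type*} (hA : IsCubeAverage P l b)
    {q : T → EuclideanSpace ℝ (Fin d) → ℝ} (hq : ∀ τ, IsCubeDensity k L₁ L₂ (q τ)) (hL : 0 ≤ L₁)
    (hk : 1 ≤ k) {a : T → Fin (d + 1) → ℝ} (ha : ∀ τ, a τ ∈ Icc (0 : Fin (d + 1) → ℝ) 1) :
    UnifLocPoly k k a (fun τ z => ∫ ω, q τ (diagAffine (l ω) (b ω) (spatial z)) ∂P) := by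
  have := hA.prob
  obtain ⟨m, rfl⟩ : ∃ m, k = m + 1 := ⟨k - 1, by omega⟩
  have hpoly : UnifLocPoly (m + 1) (m + 1) a (fun τ z => ∑ n ∈ Finset.range (m + 1),
      ∑ r : Fin n → Fin d,
        (∫ ω, taylorCoeff (q τ) (diagAffine (l ω) (b ω) (spatial (a τ))) r * ∏ i, l ω (r i) ∂P) *
          ∏ i, (z (r i).castSucc - a τ (r i).castSucc)) := by
    refine .sum _ fun n hn => .sum _ fun r _ => ?_
    have hn' := (Finset.mem_range.1 hn).le
    refine .const_mul (C := L₁) ha (fun τ => ?_)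
      (.mono (.prod (D := 1) Finset.univ ha fun i _ => ?_) (by simpa using hn'))
    · simpa using norm_integral_le_of_norm_le_const
        (hA.norm_taylorCoeff_mul_prod_le (hq τ) hL hn' (spatial_mem (ha τ)) r)
    · refine (UnifLocPoly.coord (r i).castSucc).sub ha (.const (C := 1) fun τ => ?_)
      exact abs_le.2 ⟨neg_one_lt_zero.le.trans ((ha τ).1 _), (ha τ).2 _⟩
  exact hpoly.of_abs_sub_le (L₁ * d ^ (m + 1)) fun τ z hz =>
    hA.abs_integral_sub_taylor_le (hq τ) hL le_rfl hz (ha τ)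

end IsCubeAverage

/-! ### The uniform measure on the cube and resampling of a coordinate -/

theorem measurePreserving_update {ι : Type*} [Fintype ι] [DecidableEq ι] {X : ι → Type*}
    [∀ i, MeasurableSpace (X i)] (μ : ∀ i, Measure (X i)) [∀ i, IsProbabilityMeasure (μ i)]
    (j : ι) :
    MeasurePreserving (fun p : (∀ i, X i) × X j => Function.update p.1 j p.2)
      ((Measure.pi μ).prod (μ j)) (Measure.pi μ) := by
  refine ⟨measurable_update', (Measure.pi_eq fun s hs => ?_).symm⟩
  have hpre : (fun p : (∀ i, X i) × X j => Function.update p.1 j p.2) ⁻¹' Set.pi univ s =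
      Set.pi univ (Function.update s j univ) ×ˢ s j := by
    ext ⟨r, x⟩
    simp only [mem_preimage, mem_prod, Set.mem_pi, mem_univ, true_implies]
    rw [Function.forall_update_iff r (p := fun i y => y ∈ s i),
      Function.forall_update_iff s (p := fun i t => r i ∈ t)]
    simp [and_comm]
  rw [Measure.map_apply measurable_update' (MeasurableSet.univ_pi hs), hpre, Measure.prod_prod,
    Measure.pi_pi, ← Finset.prod_erase_mul _ _ (Finset.mem_univ j),
    ← Finset.prod_erase_mul Finset.univ (fun i => μ i (s i)) (Finset.mem_univ j),
    Function.update_self, measure_univ, mul_one]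
  congr 1
  refine Finset.prod_congr rfl fun i hi => ?_
  rw [Function.update_of_ne (Finset.ne_of_mem_erase hi)]

instance isProbabilityMeasure_restrict_Icc :
    IsProbabilityMeasure (volume.restrict (Icc (0 : ℝ) 1)) := ⟨by simp⟩

theorem measurePreserving_toLp_unitCube (d : ℕ) :
    MeasurePreserving (MeasurableEquiv.toLp 2 (Fin d → ℝ))
      (Measure.pi fun _ => volume.restrict (Icc (0 : ℝ) 1)) (volume.restrict (unitCube d)) := by
  have h := (PiLp.volume_preserving_toLp (Fin d)).restrict_preimage
    (isClosed_unitCube d).measurableSet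
  have hpre : WithLp.toLp 2 ⁻¹' unitCube d = Set.pi univ fun _ : Fin d => Icc (0 : ℝ) 1 := by
    ext r
    simp only [unitCube, mem_preimage, mem_ofPred_eq, Set.mem_pi, mem_univ, true_implies]
  rwa [hpre, volume_pi, Measure.restrict_pi_pi] at h

instance isProbabilityMeasure_restrict_unitCube (d : ℕ) :
    IsProbabilityMeasure (volume.restrict (unitCube d)) :=
  (measurePreserving_toLp_unitCube d).map_eq ▸
    Measure.isProbabilityMeasure_map (measurePreserving_toLp_unitCube d).aemeasurable

section SetCoord

variable {d : ℕ}

/-- The point `x` with its `j`-th coordinate replaced by `s`. -/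
def setCoord (j : Fin d) (x : EuclideanSpace ℝ (Fin d)) (s : ℝ) : EuclideanSpace ℝ (Fin d) :=
  WithLp.toLp 2 (Function.update x.ofLp j s)

@[simp] theorem setCoord_self (j : Fin d) (x : EuclideanSpace ℝ (Fin d)) (s : ℝ) :
    setCoord j x s j = s := by
  simp [setCoord]

theorem setCoord_of_ne {i j : Fin d} (h : i ≠ j) (x : EuclideanSpace ℝ (Fin d)) (s : ℝ) :
    setCoord j x s i = x i := by
  simp [setCoord, h]

theorem setCoord_setCoord (j : Fin d) (x : EuclideanSpace ℝ (Fin d)) (s t : ℝ) :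
    setCoord j (setCoord j x s) t = setCoord j x t := by
  simp [setCoord]

theorem setCoord_add (j : Fin d) (x : EuclideanSpace ℝ (Fin d)) (s t : ℝ) :
    setCoord j x (s + t) = setCoord j x s + t • EuclideanSpace.single j 1 := by
  ext i
  by_cases h : i = j
  · subst h; simp
  · simp [setCoord_of_ne h, h]

theorem continuous_setCoord (j : Fin d) :
    Continuous fun p : EuclideanSpace ℝ (Fin d) × ℝ => setCoord j p.1 p.2 :=
  (PiLp.continuous_toLp 2 _).comp (Continuous.update (by fun_prop) j continuous_snd)

theorem measurePreserving_setCoord (j : Fin d) :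
    MeasurePreserving (fun p : EuclideanSpace ℝ (Fin d) × ℝ => setCoord j p.1 p.2)
      ((volume.restrict (unitCube d)).prod (volume.restrict (Icc 0 1)))
      (volume.restrict (unitCube d)) :=
  (measurePreserving_toLp_unitCube d).comp ((measurePreserving_update _ j).comp
    ((measurePreserving_toLp_unitCube d).symm.prod (.id _)))

variable {F : EuclideanSpace ℝ (Fin d) → ℝ}

theorem integrable_comp_setCoord (j : Fin d) (hF : IntegrableOn F (unitCube d)) :
    Integrable (fun p : EuclideanSpace ℝ (Fin d) × ℝ => F (setCoord j p.1 p.2))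
      ((volume.restrict (unitCube d)).prod (volume.restrict (Icc 0 1))) :=
  ((measurePreserving_setCoord j).integrable_comp hF.aestronglyMeasurable).2 hF

theorem setIntegral_integral_setCoord (j : Fin d) (hF : IntegrableOn F (unitCube d)) :
    ∫ x in unitCube d, ∫ s in Icc (0 : ℝ) 1, F (setCoord j x s) = ∫ x in unitCube d, F x := by
  have h := measurePreserving_setCoord j
  rw [← integral_prod _ (integrable_comp_setCoord j hF)]
  conv_rhs => rw [← h.map_eq]
  exact (integral_map h.aemeasurable (h.map_eq.symm ▸ hF.aestronglyMeasurable)).symm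

theorem integral_setIntegral_setCoord (j : Fin d) (hF : IntegrableOn F (unitCube d)) :
    ∫ s in Icc (0 : ℝ) 1, ∫ x in unitCube d, F (setCoord j x s) = ∫ x in unitCube d, F x := by
  rw [← setIntegral_integral_setCoord j hF]
  exact (integral_integral_swap (f := fun x s => F (setCoord j x s))
    (integrable_comp_setCoord j hF)).symm

end SetCoord

/-! ### Partial averages and the triangular flux -/

/-- The point whose coordinates of index less than `j` are those of `x`, and whose other
coordinates are those of `y`. -/
def splice {d : ℕ} (j : ℕ) (x y : EuclideanSpace ℝ (Fin d)) : EuclideanSpace ℝ (Fin d) :=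
  WithLp.toLp 2 fun i => if (i : ℕ) < j then x i else y i

/-- The average of `q` over all coordinates with index at least `j`. -/
noncomputable def margAvg {d : ℕ} (q : EuclideanSpace ℝ (Fin d) → ℝ) (j : ℕ)
    (x : EuclideanSpace ℝ (Fin d)) : ℝ :=
  ∫ y in unitCube d, q (splice j x y)

/-- The triangular vector field whose divergence on the cube is `q - ∫ q`: its `j`-th coordinate
is the primitive of `margAvg q (j + 1) - margAvg q j` in the `j`-th variable, with the integral
over `[0, x j]` rescaled to `[0, 1]`. -/
noncomputable def flux {d : ℕ} (q : EuclideanSpace ℝ (Fin d) → ℝ) (j : Fin d)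
    (x : EuclideanSpace ℝ (Fin d)) : ℝ :=
  x j * ((∫ s in Icc (0 : ℝ) 1, margAvg q (j + 1) (setCoord j x (s * x j))) - margAvg q j x)

section Flux

variable {d : ℕ}

theorem splice_setCoord (j : Fin d) (x y : EuclideanSpace ℝ (Fin d)) (s : ℝ) :
    splice j (setCoord j x s) y = splice j x y := by
  ext i
  by_cases h : i < j
  · simp [splice, setCoord_of_ne h.ne]
  · simp [splice, h]

theorem splice_succ_setCoord (j : Fin d) (x y : EuclideanSpace ℝ (Fin d)) (s : ℝ) :
    splice (j + 1) (setCoord j x s) y = splice j x (setCoord j y s) := by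
  ext i
  rcases lt_trichotomy i j with h | rfl | h
  · simp [splice, setCoord_of_ne h.ne, h, h.le]
  · simp [splice]
  · simp [splice, setCoord_of_ne h.ne', h.not_gt, h.not_ge]

theorem continuous_splice (j : ℕ) :
    Continuous fun p : EuclideanSpace ℝ (Fin d) × EuclideanSpace ℝ (Fin d) =>
      splice j p.1 p.2 := by
  refine (PiLp.continuous_toLp 2 _).comp (continuous_pi fun i => ?_)
  split_ifs <;> fun_prop

theorem integral_Icc_scale (g : ℝ → ℝ) (y : ℝ) :
    y * ∫ s in Icc (0 : ℝ) 1, g (s * y) = ∫ s in (0 : ℝ)..y, g s := by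
  rw [integral_Icc_eq_integral_Ioc, ← intervalIntegral.integral_of_le zero_le_one,
    ← smul_eq_mul, intervalIntegral.smul_integral_comp_mul_right]
  simp

theorem integral_deriv_mul_primitive {ψ g : ℝ → ℝ} {K : NNReal} (hψ : LipschitzWith K ψ)
    (hg : Continuous g) (h1 : ∫ s in (0 : ℝ)..1, g s = 0) :
    ∫ s in (0 : ℝ)..1, deriv ψ s * ∫ t in (0 : ℝ)..s, g t = -∫ s in (0 : ℝ)..1, ψ s * g s := by
  have hψ_ac : AbsolutelyContinuousOnInterval ψ 0 1 :=
    hψ.lipschitzOnWith.absolutelyContinuousOnInterval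
  have hprim_ac : AbsolutelyContinuousOnInterval (fun s => ∫ t in (0 : ℝ)..s, g t) 0 1 :=
    (hg.intervalIntegrable 0 1).absolutelyContinuousOnInterval_intervalIntegral (by simp)
  have h := hψ_ac.integral_mul_deriv_eq_deriv_mul hprim_ac
  simp only [h1, intervalIntegral.integral_same, mul_zero, sub_zero, zero_sub,
    hg.deriv_integral g 0] at h
  linarith

theorem lineDeriv_setCoord (ψ : EuclideanSpace ℝ (Fin d) → ℝ) (j : Fin d)
    (x : EuclideanSpace ℝ (Fin d)) (s : ℝ) :
    lineDeriv ℝ ψ (setCoord j x s) (EuclideanSpace.single j 1) =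
      deriv (fun t => ψ (setCoord j x t)) s := by
  simp only [lineDeriv, ← setCoord_add]
  rw [deriv_comp_const_add (f := fun t => ψ (setCoord j x t)), add_zero]

theorem lipschitzWith_setCoord (j : Fin d) (x : EuclideanSpace ℝ (Fin d)) :
    LipschitzWith 1 (setCoord j x) := by
  refine LipschitzWith.of_dist_le_mul fun s t => ?_
  have hsub : setCoord j x s - setCoord j x t = (s - t) • EuclideanSpace.single j 1 := by
    rw [sub_eq_iff_eq_add', ← setCoord_add, add_sub_cancel]
  rw [dist_eq_norm, hsub, norm_smul]
  simp [Real.dist_eq]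

variable {q : EuclideanSpace ℝ (Fin d) → ℝ}

theorem margAvg_zero (x : EuclideanSpace ℝ (Fin d)) :
    margAvg q 0 x = ∫ y in unitCube d, q y := by
  simp [margAvg, splice]

theorem margAvg_self (x : EuclideanSpace ℝ (Fin d)) : margAvg q d x = q x := by
  simp [margAvg, splice]

theorem margAvg_setCoord (j : Fin d) (x : EuclideanSpace ℝ (Fin d)) (s : ℝ) :
    margAvg q j (setCoord j x s) = margAvg q j x := by
  simp only [margAvg, splice_setCoord]

section Bounded

variable {C : ℝ} (hC : ∀ x, |q x| ≤ C)
include hC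

theorem abs_margAvg_le (j : ℕ) (x : EuclideanSpace ℝ (Fin d)) : |margAvg q j x| ≤ C := by
  have h : ∀ᵐ y ∂volume.restrict (unitCube d), ‖q (splice j x y)‖ ≤ C := .of_forall fun _ => hC _
  simpa only [margAvg, probReal_univ, mul_one, Real.norm_eq_abs] using
    norm_integral_le_of_norm_le_const h

theorem abs_margAvg_sub_margAvg_le (i j : ℕ) (x : EuclideanSpace ℝ (Fin d)) :
    |margAvg q i x - margAvg q j x| ≤ 2 * C :=
  (abs_sub _ _).trans ((add_le_add (abs_margAvg_le hC i x) (abs_margAvg_le hC j x)).trans_eq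
    (two_mul C).symm)

theorem abs_flux_le (j : Fin d) {x : EuclideanSpace ℝ (Fin d)} (hx : x ∈ unitCube d) :
    |flux q j x| ≤ 2 * C := by
  have havg : ∀ᵐ s ∂volume.restrict (Icc (0 : ℝ) 1),
      ‖margAvg q (j + 1) (setCoord j x (s * x j))‖ ≤ C :=
    .of_forall fun s => abs_margAvg_le hC _ _
  have hint := norm_integral_le_of_norm_le_const havg
  rw [probReal_univ, mul_one, Real.norm_eq_abs] at hint
  rw [flux, abs_mul, abs_of_nonneg (hx j).1]
  exact (mul_le_of_le_one_left (abs_nonneg _) (hx j).2).trans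
    ((abs_sub _ _).trans (by linarith [abs_margAvg_le hC j x]))

variable (hq : Continuous q)
include hq

theorem continuous_margAvg (j : ℕ) : Continuous (margAvg q j) := by
  have hc := hq.comp (continuous_splice (d := d) j)
  refine continuous_of_dominated (bound := fun _ => C)
    (fun x => (hc.comp (Continuous.prodMk_right x)).aestronglyMeasurable)
    (fun x => .of_forall fun y => hC _) (integrable_const _)
    (.of_forall fun y => hc.comp (Continuous.prodMk_left y))

theorem integral_margAvg_succ (j : Fin d) (x : EuclideanSpace ℝ (Fin d)) :
    ∫ s in Icc (0 : ℝ) 1, margAvg q (j + 1) (setCoord j x s) = margAvg q j x := by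
  simp only [margAvg, splice_succ_setCoord]
  exact integral_setIntegral_setCoord j (F := fun y => q (splice j x y)) (Integrable.of_bound
    (hq.comp ((continuous_splice j).comp (Continuous.prodMk_right x))).aestronglyMeasurable C
    (.of_forall fun _ => hC _))

theorem continuous_margAvg_setCoord (i : ℕ) (j : Fin d) (x : EuclideanSpace ℝ (Fin d)) :
    Continuous fun t => margAvg q i (setCoord j x t) :=
  (continuous_margAvg hC hq i).comp ((continuous_setCoord j).comp (Continuous.prodMk_right x))

theorem flux_setCoord (j : Fin d) (x : EuclideanSpace ℝ (Fin d)) (s : ℝ) :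
    flux q j (setCoord j x s) =
      ∫ t in (0 : ℝ)..s, (margAvg q (j + 1) (setCoord j x t) - margAvg q j x) := by
  simp only [flux, margAvg_setCoord, setCoord_self, setCoord_setCoord]
  rw [mul_sub, integral_Icc_scale (fun t => margAvg q (j + 1) (setCoord j x t)),
    intervalIntegral.integral_sub
      ((continuous_margAvg_setCoord hC hq _ j x).intervalIntegrable _ _) (by simp)]
  simp

theorem flux_eq_zero_of_coord (j : Fin d) {x : EuclideanSpace ℝ (Fin d)}
    (hx : x j = 0 ∨ x j = 1) : flux q j x = 0 := by
  rcases hx with h | h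
  · simp [flux, h]
  · simp only [flux, h, mul_one, integral_margAvg_succ hC hq, sub_self, mul_zero]

theorem continuous_flux (j : Fin d) : Continuous (flux q j) := by
  have hc : Continuous fun p : EuclideanSpace ℝ (Fin d) × ℝ =>
      margAvg q (j + 1) (setCoord j p.1 (p.2 * p.1 j)) :=
    (continuous_margAvg hC hq _).comp ((continuous_setCoord j).comp
      (f := fun p : EuclideanSpace ℝ (Fin d) × ℝ => (p.1, p.2 * p.1 j)) (by fun_prop))
  have hint : Continuous fun x : EuclideanSpace ℝ (Fin d) =>
      ∫ s in Icc (0 : ℝ) 1, margAvg q (j + 1) (setCoord j x (s * x j)) :=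
    continuous_of_dominated (bound := fun _ => C)
      (fun x => (hc.comp (Continuous.prodMk_right x)).aestronglyMeasurable)
      (fun x => .of_forall fun s => abs_margAvg_le hC _ _) (integrable_const _)
      (.of_forall fun s => hc.comp (Continuous.prodMk_left s))
  exact Continuous.mul (by fun_prop) (hint.sub (continuous_margAvg hC hq _))

variable {ψ : EuclideanSpace ℝ (Fin d) → ℝ} {K : NNReal} (hψ : LipschitzWith K ψ)
include hψ

theorem integrableOn_lineDeriv_mul_flux (j : Fin d) :
    IntegrableOn (fun x => lineDeriv ℝ ψ x (EuclideanSpace.single j 1) * flux q j x)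
      (unitCube d) := by
  refine Integrable.of_bound ((measurable_lineDeriv hψ.continuous).aestronglyMeasurable.mul
    (continuous_flux hC hq j).aestronglyMeasurable) (K * (2 * C)) ?_
  filter_upwards [ae_restrict_mem (isClosed_unitCube d).measurableSet] with x hx
  rw [norm_mul]
  refine mul_le_mul ?_ (abs_flux_le hC j hx) (norm_nonneg _) K.2
  simpa using norm_lineDeriv_le_of_lipschitz ℝ hψ (v := EuclideanSpace.single j (1 : ℝ)) (x₀ := x)

variable {B : ℝ} (hB : ∀ x, |ψ x| ≤ B)
include hB

theorem integrableOn_mul_margAvg_sub (i j : ℕ) :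
    IntegrableOn (fun x => ψ x * (margAvg q i x - margAvg q j x)) (unitCube d) := by
  refine Integrable.of_bound (hψ.continuous.mul ((continuous_margAvg hC hq i).sub
    (continuous_margAvg hC hq j))).aestronglyMeasurable (B * (2 * C)) (.of_forall fun x => ?_)
  rw [norm_mul]
  exact mul_le_mul (hB x) (abs_margAvg_sub_margAvg_le hC i j x) (norm_nonneg _)
    ((abs_nonneg _).trans (hB x))

theorem integral_lineDeriv_mul_flux (j : Fin d) :
    ∫ x in unitCube d, lineDeriv ℝ ψ x (EuclideanSpace.single j 1) * flux q j x =
      -∫ x in unitCube d, ψ x * (margAvg q (j + 1) x - margAvg q j x) := by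
  rw [← setIntegral_integral_setCoord j (integrableOn_lineDeriv_mul_flux hC hq hψ j),
    ← setIntegral_integral_setCoord j (integrableOn_mul_margAvg_sub hC hq hψ hB (j + 1) j),
    ← integral_neg]
  congr 1
  ext x
  simp only [integral_Icc_eq_integral_Ioc, ← intervalIntegral.integral_of_le zero_le_one,
    flux_setCoord hC hq, margAvg_setCoord, lineDeriv_setCoord]
  refine integral_deriv_mul_primitive (hψ.comp (lipschitzWith_setCoord j x))
    ((continuous_margAvg_setCoord hC hq _ j x).sub continuous_const) ?_
  rw [← flux_setCoord hC hq]
  exact flux_eq_zero_of_coord hC hq j (.inr (setCoord_self j x 1))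

theorem sum_integral_lineDeriv_mul_flux :
    ∑ j, ∫ x in unitCube d, lineDeriv ℝ ψ x (EuclideanSpace.single j 1) * flux q j x =
      -∫ x in unitCube d, ψ x * (q x - ∫ y in unitCube d, q y) := by
  simp only [integral_lineDeriv_mul_flux hC hq hψ hB, Finset.sum_neg_distrib]
  rw [← integral_finsetSum _ fun (j : Fin d) _ =>
    integrableOn_mul_margAvg_sub hC hq hψ hB (j + 1) j]
  congr 2
  ext x
  rw [← Finset.mul_sum, Fin.sum_univ_eq_sum_range (fun j => margAvg q (j + 1) x - margAvg q j x) d,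
    Finset.sum_range_sub (fun j => margAvg q j x), margAvg_self, margAvg_zero]

end Bounded

end Flux

/-! ### Flows of bounded Lipschitz fields -/

section Flow

open scoped NNReal

variable {E : Type*} [NormedAddCommGroup E] [NormedSpace ℝ E] {F : E → ℝ → E} {K B : ℝ≥0}

/-- Bounded time-dependent vector fields that are Lipschitz in space and time. -/
structure IsLipField (F : E → ℝ → E) (K B : ℝ≥0) : Prop where
  lip : ∀ x y t s, ‖F x t - F y s‖ ≤ K * (‖x - y‖ + |t - s|)
  bound : ∀ x t, ‖F x t‖ ≤ B

/-- `α` is an integral curve of `F` on the time interval `[0,1]`. -/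
def IsCurve (F : E → ℝ → E) (α : ℝ → E) : Prop :=
  ∀ t ∈ Icc (0 : ℝ) 1, HasDerivWithinAt α (F (α t) t) (Icc 0 1) t

/-- `Φ s y` is an integral curve of `F` passing through `y` at time `s`, for `s ∈ [0,1]`. -/
def IsEvolution (F : E → ℝ → E) (Φ : ℝ → E → ℝ → E) : Prop :=
  ∀ s ∈ Icc (0 : ℝ) 1, ∀ y, Φ s y s = y ∧ IsCurve F (Φ s y)

omit [NormedSpace ℝ E] in
theorem IsLipField.lipschitzWith (hF : IsLipField F K B) (t : ℝ) : LipschitzWith K (F · t) :=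
  LipschitzWith.of_dist_le_mul fun x y => by
    simpa [dist_eq_norm] using hF.lip x y t t

omit [NormedSpace ℝ E] in
theorem IsLipField.lipschitzWith_time (hF : IsLipField F K B) (x : E) : LipschitzWith K (F x) :=
  LipschitzWith.of_dist_le_mul fun s t => by
    simpa [dist_eq_norm] using hF.lip x x s t

theorem IsLipField.exists_curve [CompleteSpace E] (hF : IsLipField F K B) {t₀ : ℝ}
    (ht₀ : t₀ ∈ Icc (0 : ℝ) 1) (y : E) : ∃ α, α t₀ = y ∧ IsCurve F α := by
  have hP : IsPicardLindelof (fun t x => F x t) (tmin := 0) (tmax := 1) ⟨t₀, ht₀⟩ y B 0 B K := by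
    refine ⟨fun t _ => (hF.lipschitzWith t).lipschitzOnWith,
      fun x _ => (hF.lipschitzWith_time x).continuous.continuousOn,
      fun t _ x _ => hF.bound x t, ?_⟩
    simp only [NNReal.coe_zero, sub_zero]
    refine mul_le_of_le_one_right B.2 (max_le ?_ ?_) <;> linarith [ht₀.1, ht₀.2]
  exact hP.exists_eq_forall_mem_Icc_hasDerivWithinAt₀

theorem IsLipField.exists_isEvolution [CompleteSpace E] (hF : IsLipField F K B) :
    ∃ Φ, IsEvolution F Φ := by
  choose! Φ hΦ using fun (s : ℝ) (hs : s ∈ Icc (0 : ℝ) 1) y => hF.exists_curve hs y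
  exact ⟨Φ, fun s hs y => hΦ s hs y⟩

namespace IsCurve

variable {α β : ℝ → E}

theorem continuousOn (h : IsCurve F α) : ContinuousOn α (Icc 0 1) :=
  fun t ht => (h t ht).continuousWithinAt

theorem hasDerivWithinAt_Ici (h : IsCurve F α) {t : ℝ} (ht : t ∈ Ico (0 : ℝ) 1) :
    HasDerivWithinAt α (F (α t) t) (Ici t) t :=
  (h t (Ico_subset_Icc_self ht)).mono_of_mem_nhdsWithin (Icc_mem_nhdsGE_of_mem ht)

variable (hF : IsLipField F K B) (hα : IsCurve F α) {s t : ℝ} (hs : 0 ≤ s) (hst : s ≤ t)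
  (ht : t ≤ 1)
include hF hα hs hst ht

theorem dist_le (hβ : IsCurve F β) :
    dist (α t) (β t) ≤ dist (α s) (β s) * Real.exp (K * (t - s)) :=
  dist_le_of_trajectories_ODE (v := fun t x => F x t) (a := s) (b := 1)
    (fun t => hF.lipschitzWith t)
    (hα.continuousOn.mono (Icc_subset_Icc_left hs))
    (fun _ ht => hα.hasDerivWithinAt_Ici ⟨hs.trans ht.1, ht.2⟩)
    (hβ.continuousOn.mono (Icc_subset_Icc_left hs))
    (fun _ ht => hβ.hasDerivWithinAt_Ici ⟨hs.trans ht.1, ht.2⟩) le_rfl t ⟨hst, ht⟩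

theorem norm_sub_le : ‖α t - α s‖ ≤ B * (t - s) :=
  norm_image_sub_le_of_norm_deriv_le_segment'
    (fun u hu => (hα u ⟨hs.trans hu.1, hu.2.trans ht⟩).mono (Icc_subset_Icc hs ht))
    (fun _ _ => hF.bound _ _) t ⟨hst, le_rfl⟩

theorem norm_sub_sub_le :
    ‖α t - α s - (t - s) • F (α s) t‖ ≤ K * (B + 1) * (t - s) * (t - s) := by
  have hderiv : ∀ u ∈ Icc s t, HasDerivWithinAt (fun u => α u - u • F (α s) t)
      (F (α u) u - F (α s) t) (Icc s t) u := fun u hu => by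
    have hu' := (hα u ⟨hs.trans hu.1, hu.2.trans ht⟩).mono (Icc_subset_Icc hs ht)
    simpa using! hu'.sub ((hasDerivWithinAt_id u _).smul_const (F (α s) t))
  have hbound : ∀ u ∈ Ico s t, ‖F (α u) u - F (α s) t‖ ≤ K * (B + 1) * (t - s) := fun u hu => by
    have hdist : ‖α u - α s‖ ≤ B * (t - s) :=
      (hα.norm_sub_le hF hs hu.1 (hu.2.le.trans ht)).trans (by gcongr; exact hu.2.le)
    have htime : |u - t| ≤ t - s := by
      rw [abs_sub_comm, abs_of_nonneg (by linarith [hu.2])]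
      linarith [hu.1]
    refine (hF.lip _ _ _ _).trans ?_
    rw [mul_assoc]
    gcongr
    linarith
  have h := norm_image_sub_le_of_norm_deriv_le_segment' hderiv hbound t ⟨hst, le_rfl⟩
  rwa [sub_sub_sub_comm, ← sub_smul] at h

end IsCurve

namespace IsEvolution

open Asymptotics Filter Topology

variable {Φ : ℝ → E → ℝ → E} (hΦ : IsEvolution F Φ) (hF : IsLipField F K B) {s t : ℝ}
  (hs : 0 ≤ s) (hst : s ≤ t) (ht : t ≤ 1)
include hΦ hF hs hst ht

theorem lipschitzWith : LipschitzWith (Real.toNNReal (Real.exp K)) fun y => Φ s y t := by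
  refine LipschitzWith.of_dist_le_mul fun y z => ?_
  have hys := hΦ s ⟨hs, hst.trans ht⟩ y
  have hzs := hΦ s ⟨hs, hst.trans ht⟩ z
  have h := hys.2.dist_le hF hs hst ht hzs.2
  rw [hys.1, hzs.1] at h
  rw [Real.coe_toNNReal _ (Real.exp_pos _).le, mul_comm]
  exact h.trans (by gcongr; exact mul_le_of_le_one_right K.2 (by linarith))

theorem comp (y : E) : Φ t (Φ s y t) 1 = Φ s y 1 := by
  have hys := hΦ s ⟨hs, hst.trans ht⟩ y
  have hyt := hΦ t ⟨hs.trans hst, ht⟩ (Φ s y t)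
  have h := hyt.2.dist_le hF (hs.trans hst) ht le_rfl hys.2
  rwa [hyt.1, dist_self, zero_mul, dist_le_zero] at h

theorem dist_le (y : E) : dist (Φ s y 1) (Φ t y 1) ≤ Real.exp K * B * (t - s) := by
  have hys := hΦ s ⟨hs, hst.trans ht⟩ y
  have hlip := (hΦ.lipschitzWith hF (hs.trans hst) ht le_rfl).dist_le_mul (Φ s y t) y
  have hmove := hys.2.norm_sub_le hF hs hst ht
  rw [hys.1, ← dist_eq_norm] at hmove
  rw [hΦ.comp hF hs hst ht y, Real.coe_toNNReal _ (Real.exp_pos _).le] at hlip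
  rw [mul_assoc]
  exact hlip.trans (by gcongr)

omit hs hst in
theorem hasDerivWithinAt_start (h0 : 0 ≤ t) (y : E) :
    HasDerivWithinAt (fun s => Φ s y t) (-F y t) (Icc 0 t) t := by
  have hquad : (fun s => Φ s y t - Φ t y t - (s - t) • -F y t) =O[𝓝[Icc 0 t] t]
      fun s => ‖s - t‖ ^ 2 := by
    refine IsBigO.of_bound (K * (B + 1)) ?_
    filter_upwards [self_mem_nhdsWithin] with s hs
    have hys := hΦ s ⟨hs.1, hs.2.trans ht⟩ y
    have h := hys.2.norm_sub_sub_le hF hs.1 hs.2 ht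
    rw [hys.1] at h
    rw [(hΦ t ⟨h0, ht⟩ y).1, smul_neg, ← neg_smul, neg_sub, norm_pow, norm_norm,
      Real.norm_eq_abs, sq_abs]
    exact h.trans_eq (by ring)
  exact hasDerivWithinAt_iff_isLittleO.2 (hquad.trans_isLittleO
    ((isLittleO_pow_sub_sub t one_lt_two).mono nhdsWithin_le_nhds))

end IsEvolution

end Flow

/-! ### Transport of densities along a flow -/

section LeftDerivative

open Filter Topology

theorem eq_of_hasDerivWithinAt_Iic_eq_zero {E : Type*} [NormedAddCommGroup E] [NormedSpace ℝ E]
    {f : ℝ → E} {a b : ℝ} (hab : a ≤ b) (hc : ContinuousOn f (Icc a b))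
    (hd : ∀ t ∈ Ioc a b, HasDerivWithinAt f 0 (Iic t) t) : f a = f b := by
  have hc' : ContinuousOn (fun s => f (-s)) (Icc (-b) (-a)) :=
    hc.comp continuousOn_neg fun s hs => ⟨le_neg.2 hs.2, neg_le.2 hs.1⟩
  have hd' : ∀ s ∈ Ico (-b) (-a), HasDerivWithinAt (fun s => f (-s)) 0 (Ici s) s := fun s hs => by
    have h := (hd (-s) ⟨lt_neg.2 hs.2, neg_le.2 hs.1⟩).scomp s
      (hasDerivWithinAt_neg s (Ici s)) fun u hu => neg_le_neg (mem_Ici.1 hu)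
    simpa using! h
  simpa using constant_of_has_deriv_right_zero hc' hd' (-a) ⟨neg_le_neg hab, le_rfl⟩

variable {α E : Type*} [MeasurableSpace α] {μ : Measure α} [IsFiniteMeasure μ]
  [NormedAddCommGroup E] [NormedSpace ℝ E] {g : ℝ → α → E} {M : NNReal} {S : Set ℝ}
  (hint : ∀ t ∈ S, Integrable (g t) μ) (hlip : ∀ a, LipschitzOnWith M (g · a) S)
include hint hlip

theorem continuousOn_integral_of_lipschitzOnWith : ContinuousOn (fun t => ∫ a, g t a ∂μ) S := by
  refine LipschitzOnWith.continuousOn (K := M * (μ univ).toNNReal)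
    (LipschitzOnWith.of_dist_le_mul fun s hs t ht => ?_)
  rw [dist_eq_norm, ← integral_sub (hint s hs) (hint t ht), NNReal.coe_mul, mul_right_comm]
  refine norm_integral_le_of_norm_le_const (.of_forall fun a => ?_)
  simpa only [dist_eq_norm] using (hlip a).dist_le_mul s hs t ht

theorem hasDerivWithinAt_integral_of_lipschitzOnWith {g' : α → E} {t : ℝ} (ht : t ∈ S)
    (hd : ∀ᵐ a ∂μ, HasDerivWithinAt (g · a) (g' a) S t) :
    HasDerivWithinAt (fun t => ∫ a, g t a ∂μ) (∫ a, g' a ∂μ) S t := by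
  rw [hasDerivWithinAt_iff_tendsto_slope]
  have hmem : ∀ᶠ s in 𝓝[S \ {t}] t, s ∈ S \ {t} := self_mem_nhdsWithin
  have hlim : Tendsto (fun s => ∫ a, slope (g · a) t s ∂μ) (𝓝[S \ {t}] t) (𝓝 (∫ a, g' a ∂μ)) := by
    refine tendsto_integral_filter_of_dominated_convergence (fun _ => (M : ℝ)) ?_ ?_
      (integrable_const _) (hd.mono fun a ha => hasDerivWithinAt_iff_tendsto_slope.1 ha)
    · filter_upwards [hmem] with s hs
      exact (((hint s hs.1).sub (hint t ht)).smul _).aestronglyMeasurable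
    · filter_upwards [hmem] with s hs
      refine .of_forall fun a => ?_
      have hpos : 0 < ‖s - t‖ := norm_pos_iff.2 (sub_ne_zero.2 hs.2)
      rw [slope_def_module, norm_smul, norm_inv, inv_mul_le_iff₀ hpos, mul_comm]
      simpa only [dist_eq_norm] using (hlip a).dist_le_mul s hs.1 t ht
  refine hlim.congr' ?_
  filter_upwards [hmem] with s hs
  simp only [slope_def_module]
  rw [integral_smul, integral_sub (hint s hs.1) (hint t ht)]

end LeftDerivative

section Interp

variable {d : ℕ} {ρ π : EuclideanSpace ℝ (Fin d) → ℝ}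

/-- The linear interpolation in time from the density `π` at time `0` to `ρ` at time `1`. -/
def interp (π ρ : EuclideanSpace ℝ (Fin d) → ℝ) (t : ℝ) (x : EuclideanSpace ℝ (Fin d)) : ℝ :=
  (1 - t) * π x + t * ρ x

/-- The momentum `F · interp π ρ` is the difference of the fluxes of `π` and `ρ`, so that `F` and
`interp π ρ` solve the continuity equation on the cube for times in `[0,1]`. -/
def IsTransportField (F : EuclideanSpace ℝ (Fin d) → ℝ → EuclideanSpace ℝ (Fin d))
    (π ρ : EuclideanSpace ℝ (Fin d) → ℝ) : Prop :=
  ∀ x ∈ unitCube d, ∀ t ∈ Icc (0 : ℝ) 1, ∀ j, F x t j * interp π ρ t x = flux π j x - flux ρ j x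

theorem abs_interp_le {C t : ℝ} {x : EuclideanSpace ℝ (Fin d)} (hπC : |π x| ≤ C)
    (hρC : |ρ x| ≤ C) (ht : t ∈ Icc (0 : ℝ) 1) : |interp π ρ t x| ≤ C := by
  have ht' : 0 ≤ 1 - t := sub_nonneg.2 ht.2
  calc |interp π ρ t x| ≤ (1 - t) * |π x| + t * |ρ x| := by
        refine (abs_add_le _ _).trans_eq ?_
        rw [abs_mul, abs_mul, abs_of_nonneg ht.1, abs_of_nonneg ht']
    _ ≤ (1 - t) * C + t * C := add_le_add (mul_le_mul_of_nonneg_left hπC ht')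
        (mul_le_mul_of_nonneg_left hρC ht.1)
    _ = C := by ring

theorem interp_sub_interp (s t : ℝ) (x : EuclideanSpace ℝ (Fin d)) :
    interp π ρ s x - interp π ρ t x = (s - t) * (ρ x - π x) := by
  simp only [interp]
  ring

theorem hasDerivAt_interp (t : ℝ) (x : EuclideanSpace ℝ (Fin d)) :
    HasDerivAt (fun t => interp π ρ t x) (ρ x - π x) t := by
  convert! (((hasDerivAt_id t).const_sub 1).mul_const (π x)).add
    ((hasDerivAt_id t).mul_const (ρ x)) using 1
  ring

theorem continuous_interp (hπ : Continuous π) (hρ : Continuous ρ) (t : ℝ) :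
    Continuous (interp π ρ t) :=
  (hπ.const_mul _).add (hρ.const_mul _)

end Interp

section ContinuityEquation

variable {d : ℕ}

theorem fderiv_apply_eq_sum_lineDeriv {ψ : EuclideanSpace ℝ (Fin d) → ℝ}
    {y : EuclideanSpace ℝ (Fin d)} (h : DifferentiableAt ℝ ψ y) (w : EuclideanSpace ℝ (Fin d)) :
    fderiv ℝ ψ y w = ∑ j, lineDeriv ℝ ψ y (EuclideanSpace.single j 1) * w j := by
  conv_lhs => rw [← (EuclideanSpace.basisFun (Fin d) ℝ).sum_repr w]
  rw [map_sum]
  refine Finset.sum_congr rfl fun j _ => ?_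
  rw [map_smul, (h.hasFDerivAt.hasLineDerivAt _).lineDeriv]
  simp [mul_comm]

variable {q ψ : EuclideanSpace ℝ (Fin d) → ℝ} {C : ℝ} {K : NNReal} {B : ℝ}

theorem integrableOn_mul_of_abs_le (hC : ∀ x, |q x| ≤ C) (hq : Continuous q) (hψ : Continuous ψ)
    (hB : ∀ x, |ψ x| ≤ B) : IntegrableOn (fun x => ψ x * q x) (unitCube d) := by
  refine Integrable.of_bound (hψ.mul hq).aestronglyMeasurable (B * C) (.of_forall fun x => ?_)
  rw [norm_mul]
  exact mul_le_mul (hB x) (hC x) (norm_nonneg _) ((abs_nonneg _).trans (hB x))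

theorem integrableOn_sum_lineDeriv_mul_flux_add (hC : ∀ x, |q x| ≤ C) (hq : Continuous q)
    (hψ : LipschitzWith K ψ) (hB : ∀ x, |ψ x| ≤ B) :
    IntegrableOn (fun x => ∑ j, lineDeriv ℝ ψ x (EuclideanSpace.single j 1) * flux q j x +
      ψ x * q x) (unitCube d) :=
  (integrable_finsetSum _ fun j _ => integrableOn_lineDeriv_mul_flux hC hq hψ j).add
    (integrableOn_mul_of_abs_le hC hq hψ.continuous hB)

theorem integral_sum_lineDeriv_mul_flux_add (hC : ∀ x, |q x| ≤ C) (hq : Continuous q)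
    (hψ : LipschitzWith K ψ) (hB : ∀ x, |ψ x| ≤ B) (h1 : ∫ x in unitCube d, q x = 1) :
    ∫ x in unitCube d, (∑ j, lineDeriv ℝ ψ x (EuclideanSpace.single j 1) * flux q j x +
      ψ x * q x) = ∫ x in unitCube d, ψ x := by
  have hψint : IntegrableOn ψ (unitCube d) :=
    Integrable.of_bound hψ.continuous.aestronglyMeasurable B (.of_forall hB)
  have hψq := integrableOn_mul_of_abs_le hC hq hψ.continuous hB
  have hflux := fun j (_ : j ∈ Finset.univ) => integrableOn_lineDeriv_mul_flux hC hq hψ j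
  rw [integral_add (integrable_finsetSum _ hflux) hψq, integral_finsetSum _ hflux,
    sum_integral_lineDeriv_mul_flux hC hq hψ hB, h1]
  simp only [mul_sub, mul_one]
  rw [integral_sub hψq hψint]
  ring

variable {F : EuclideanSpace ℝ (Fin d) → ℝ → EuclideanSpace ℝ (Fin d)}
  {ρ π : EuclideanSpace ℝ (Fin d) → ℝ}

theorem IsTransportField.integral_continuity_eq (hF : IsTransportField F π ρ)
    (hπC : ∀ x, |π x| ≤ C) (hρC : ∀ x, |ρ x| ≤ C) (hπ : Continuous π) (hρ : Continuous ρ)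
    (hπ1 : ∫ x in unitCube d, π x = 1) (hρ1 : ∫ x in unitCube d, ρ x = 1)
    (hψ : LipschitzWith K ψ) (hB : ∀ x, |ψ x| ≤ B) {t : ℝ} (ht : t ∈ Icc (0 : ℝ) 1) :
    ∫ x in unitCube d, (-fderiv ℝ ψ x (F x t) * interp π ρ t x + ψ x * (ρ x - π x)) = 0 := by
  have hae : ∀ᵐ x ∂volume.restrict (unitCube d),
      -fderiv ℝ ψ x (F x t) * interp π ρ t x + ψ x * (ρ x - π x) =
        (∑ j, lineDeriv ℝ ψ x (EuclideanSpace.single j 1) * flux ρ j x + ψ x * ρ x) -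
        (∑ j, lineDeriv ℝ ψ x (EuclideanSpace.single j 1) * flux π j x + ψ x * π x) := by
    filter_upwards [ae_restrict_of_ae hψ.ae_differentiableAt,
      ae_restrict_mem (isClosed_unitCube d).measurableSet] with x hx hxQ
    have hsum : fderiv ℝ ψ x (F x t) * interp π ρ t x =
        ∑ j, lineDeriv ℝ ψ x (EuclideanSpace.single j 1) * flux π j x -
        ∑ j, lineDeriv ℝ ψ x (EuclideanSpace.single j 1) * flux ρ j x := by
      rw [fderiv_apply_eq_sum_lineDeriv hx, Finset.sum_mul, ← Finset.sum_sub_distrib]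
      refine Finset.sum_congr rfl fun j _ => ?_
      rw [mul_assoc, hF x hxQ t ht j, mul_sub]
    rw [neg_mul, hsum]
    ring
  rw [integral_congr_ae hae, integral_sub
    (integrableOn_sum_lineDeriv_mul_flux_add hρC hρ hψ hB)
    (integrableOn_sum_lineDeriv_mul_flux_add hπC hπ hψ hB),
    integral_sum_lineDeriv_mul_flux_add hρC hρ hψ hB hρ1,
    integral_sum_lineDeriv_mul_flux_add hπC hπ hψ hB hπ1, sub_self]

end ContinuityEquation

section Transport

open Filter Topology

variable {d : ℕ} {F : EuclideanSpace ℝ (Fin d) → ℝ → EuclideanSpace ℝ (Fin d)} {K B : NNReal}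
  {ρ π f : EuclideanSpace ℝ (Fin d) → ℝ}
  {Φ : ℝ → EuclideanSpace ℝ (Fin d) → ℝ → EuclideanSpace ℝ (Fin d)} {Kf : NNReal} {C Bf : ℝ}

theorem IsEvolution.lipschitzOnWith_comp_mul_interp (hΦ : IsEvolution F Φ) (hF : IsLipField F K B)
    (hπC : ∀ x, |π x| ≤ C) (hρC : ∀ x, |ρ x| ≤ C) (hf : LipschitzWith Kf f)
    (hBf : ∀ x, |f x| ≤ Bf) (y : EuclideanSpace ℝ (Fin d)) :
    LipschitzOnWith (Real.toNNReal (Kf * (Real.exp K * B) * C + Bf * (2 * C)))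
      (fun t => f (Φ t y 1) * interp π ρ t y) (Icc 0 1) := by
  have hC0 : 0 ≤ C := (abs_nonneg _).trans (hπC 0)
  have hB0 : 0 ≤ Bf := (abs_nonneg _).trans (hBf 0)
  have hdiff : |ρ y - π y| ≤ 2 * C := (abs_sub _ _).trans (by linarith [hπC y, hρC y])
  have hle : ∀ s ∈ Icc (0 : ℝ) 1, ∀ t ∈ Icc (0 : ℝ) 1, s ≤ t →
      dist (f (Φ s y 1) * interp π ρ s y) (f (Φ t y 1) * interp π ρ t y) ≤
        (Kf * (Real.exp K * B) * C + Bf * (2 * C)) * (t - s) := by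
    intro s hs t ht hst
    have hfst : |f (Φ s y 1) - f (Φ t y 1)| ≤ Kf * (Real.exp K * B * (t - s)) :=
      (hf.dist_le_mul _ _).trans (by gcongr; exact hΦ.dist_le hF hs.1 hst ht.2 y)
    calc dist (f (Φ s y 1) * interp π ρ s y) (f (Φ t y 1) * interp π ρ t y)
      _ = |(f (Φ s y 1) - f (Φ t y 1)) * interp π ρ s y +
            f (Φ t y 1) * (interp π ρ s y - interp π ρ t y)| := by rw [Real.dist_eq]; ring_nf
      _ ≤ |f (Φ s y 1) - f (Φ t y 1)| * |interp π ρ s y| +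
            |f (Φ t y 1)| * (|s - t| * |ρ y - π y|) := by
          rw [← abs_mul, interp_sub_interp, ← abs_mul, ← abs_mul]
          exact abs_add_le _ _
      _ ≤ Kf * (Real.exp K * B * (t - s)) * C + Bf * ((t - s) * (2 * C)) := by
          rw [abs_sub_comm s t, abs_of_nonneg (sub_nonneg.2 hst)]
          have := sub_nonneg.2 hst
          gcongr
          · exact abs_interp_le (hπC y) (hρC y) hs
          · exact hBf _
      _ = _ := by ring
  refine LipschitzOnWith.of_dist_le_mul fun s hs t ht => ?_
  rw [Real.coe_toNNReal _ (by positivity), Real.dist_eq s t]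
  rcases le_total s t with h | h
  · rw [abs_sub_comm, abs_of_nonneg (sub_nonneg.2 h)]
    exact hle s hs t ht h
  · rw [dist_comm, abs_of_nonneg (sub_nonneg.2 h)]
    exact hle t ht s hs h

theorem IsEvolution.hasDerivWithinAt_comp_mul_interp (hΦ : IsEvolution F Φ)
    (hF : IsLipField F K B) {t : ℝ} (ht : t ∈ Icc (0 : ℝ) 1) {y : EuclideanSpace ℝ (Fin d)}
    (hy : DifferentiableAt ℝ (fun y => f (Φ t y 1)) y) :
    HasDerivWithinAt (fun s => f (Φ s y 1) * interp π ρ s y)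
      (-fderiv ℝ (fun y => f (Φ t y 1)) y (F y t) * interp π ρ t y +
        f (Φ t y 1) * (ρ y - π y)) (Icc 0 t) t := by
  have hgrad : HasFDerivAt (fun y => f (Φ t y 1)) (fderiv ℝ (fun y => f (Φ t y 1)) y)
      (Φ t y t) := by
    rw [(hΦ t ht y).1]
    exact hy.hasFDerivAt
  have hchain := hgrad.comp_hasDerivWithinAt (f := fun s => Φ s y t) t
    (hΦ.hasDerivWithinAt_start hF ht.2 ht.1 y)
  rw [map_neg] at hchain
  refine (hchain.congr_of_mem (fun s hs => ?_) ⟨ht.1, le_rfl⟩).mul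
    (hasDerivAt_interp t y).hasDerivWithinAt
  exact congrArg f (hΦ.comp hF hs.1 hs.2 ht.2 y).symm

theorem IsEvolution.integral_comp_mul_eq (hΦ : IsEvolution F Φ) (hF : IsLipField F K B)
    (hFT : IsTransportField F π ρ) (hπC : ∀ x, |π x| ≤ C) (hρC : ∀ x, |ρ x| ≤ C)
    (hπ : Continuous π) (hρ : Continuous ρ) (hπ1 : ∫ x in unitCube d, π x = 1)
    (hρ1 : ∫ x in unitCube d, ρ x = 1) (hf : LipschitzWith Kf f) (hBf : ∀ x, |f x| ≤ Bf) :
    ∫ x in unitCube d, f (Φ 0 x 1) * π x = ∫ x in unitCube d, f x * ρ x := by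
  have hψ : ∀ t ∈ Icc (0 : ℝ) 1, LipschitzWith _ fun y => f (Φ t y 1) := fun t ht =>
    hf.comp (hΦ.lipschitzWith hF ht.1 ht.2 le_rfl)
  have hlip := hΦ.lipschitzOnWith_comp_mul_interp hF hπC hρC hf hBf
  have hint : ∀ t ∈ Icc (0 : ℝ) 1,
      IntegrableOn (fun y => f (Φ t y 1) * interp π ρ t y) (unitCube d) := fun t ht =>
    integrableOn_mul_of_abs_le (q := interp π ρ t)
      (fun y => abs_interp_le (hπC y) (hρC y) ht) (continuous_interp hπ hρ t)
      (hψ t ht).continuous fun _ => hBf _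
  have hderiv : ∀ t ∈ Ioc (0 : ℝ) 1, HasDerivWithinAt
      (fun t => ∫ y in unitCube d, f (Φ t y 1) * interp π ρ t y) 0 (Iic t) t := by
    intro t ht
    have ht' := Ioc_subset_Icc_self ht
    have hsub : Icc 0 t ⊆ Icc (0 : ℝ) 1 := Icc_subset_Icc_right ht.2
    have h := hasDerivWithinAt_integral_of_lipschitzOnWith (fun s hs => hint s (hsub hs))
      (fun y => (hlip y).mono hsub) ⟨ht'.1, le_rfl⟩
      ((ae_restrict_of_ae (hψ t ht').ae_differentiableAt).mono fun y hy =>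
        hΦ.hasDerivWithinAt_comp_mul_interp (π := π) (ρ := ρ) hF ht' hy)
    rw [hFT.integral_continuity_eq hπC hρC hπ hρ hπ1 hρ1 (hψ t ht') (fun _ => hBf _) ht'] at h
    exact h.mono_of_mem_nhdsWithin (Icc_mem_nhdsLE ht.1)
  have h := eq_of_hasDerivWithinAt_Iic_eq_zero zero_le_one
    (continuousOn_integral_of_lipschitzOnWith hint hlip) hderiv
  have hend : ∀ y, Φ 1 y 1 = y := fun y => (hΦ 1 ⟨zero_le_one, le_rfl⟩ y).1
  simpa only [interp, hend, sub_self, sub_zero, zero_mul, one_mul, zero_add, add_zero] using h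

theorem integral_cubeMeasure {q : EuclideanSpace ℝ (Fin d) → ℝ} (hq : Continuous q)
    (h0 : ∀ x ∈ unitCube d, 0 ≤ q x) (f : EuclideanSpace ℝ (Fin d) → ℝ) :
    ∫ x, f x ∂cubeMeasure q = ∫ x in unitCube d, f x * q x := by
  unfold cubeMeasure
  rw [integral_withDensity_eq_integral_toReal_smul hq.measurable.ennreal_ofReal
    (.of_forall fun _ => ENNReal.ofReal_lt_top)]
  refine setIntegral_congr_fun (isClosed_unitCube d).measurableSet fun x hx => ?_
  simp only [ENNReal.toReal_ofReal (h0 x hx), smul_eq_mul, mul_comm]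

theorem setIntegral_eq_one {q : EuclideanSpace ℝ (Fin d) → ℝ} (hq : Continuous q)
    (h0 : ∀ x ∈ unitCube d, 0 ≤ q x) (hP : IsProbabilityMeasure (cubeMeasure q)) :
    ∫ x in unitCube d, q x = 1 := by
  simpa using (integral_cubeMeasure hq h0 fun _ => 1).symm

theorem eq_of_forall_integral_lipschitz_eq {Ω : Type*} [PseudoMetricSpace Ω] [MeasurableSpace Ω]
    [BorelSpace Ω] {μ ν : Measure Ω} [IsProbabilityMeasure μ] [IsProbabilityMeasure ν]
    (h : ∀ (f : Ω → ℝ) (K : NNReal) (C : ℝ), LipschitzWith K f → (∀ x y, dist (f x) (f y) ≤ C) →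
      ∫ x, f x ∂μ = ∫ x, f x ∂ν) : μ = ν := by
  obtain ⟨μ', rfl⟩ : ∃ μ' : ProbabilityMeasure Ω, μ' = μ := ⟨⟨μ, ‹_›⟩, rfl⟩
  obtain ⟨ν', rfl⟩ : ∃ ν' : ProbabilityMeasure Ω, ν' = ν := ⟨⟨ν, ‹_›⟩, rfl⟩
  have hlim : Tendsto (fun _ : ℕ => μ') atTop (𝓝 ν') :=
    tendsto_iff_forall_lipschitz_integral_tendsto.2 fun f ⟨C, hC⟩ ⟨K, hK⟩ =>
      tendsto_const_nhds.congr' (.of_forall fun _ => (h f K C hK hC).symm)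
  rw [tendsto_nhds_unique tendsto_const_nhds hlim]

theorem IsEvolution.map_cubeMeasure_eq (hΦ : IsEvolution F Φ) (hF : IsLipField F K B)
    (hFT : IsTransportField F π ρ) (hπC : ∀ x, |π x| ≤ C) (hρC : ∀ x, |ρ x| ≤ C)
    (hπ : Continuous π) (hρ : Continuous ρ) (hπ0 : ∀ x ∈ unitCube d, 0 ≤ π x)
    (hρ0 : ∀ x ∈ unitCube d, 0 ≤ ρ x) (hπP : IsProbabilityMeasure (cubeMeasure π))
    (hρP : IsProbabilityMeasure (cubeMeasure ρ)) :
    (cubeMeasure π).map (fun x => Φ 0 x 1) = cubeMeasure ρ := by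
  have hX := (hΦ.lipschitzWith hF le_rfl zero_le_one le_rfl).continuous
  have := Measure.isProbabilityMeasure_map (μ := cubeMeasure π) hX.measurable.aemeasurable
  refine eq_of_forall_integral_lipschitz_eq fun f Kf A hf hA => ?_
  have hBf : ∀ x, |f x| ≤ A + |f 0| := fun x => by
    have := abs_add_le (f x - f 0) (f 0)
    rw [sub_add_cancel] at this
    exact this.trans (add_le_add_left (hA x 0) _)
  rw [integral_map hX.measurable.aemeasurable hf.continuous.aestronglyMeasurable,
    integral_cubeMeasure hπ hπ0, integral_cubeMeasure hρ hρ0]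
  exact hΦ.integral_comp_mul_eq hF hFT hπC hρC hπ hρ (setIntegral_eq_one hπ hπ0 hπP)
    (setIntegral_eq_one hρ hρ0 hρP) hf hBf

end Transport

/-! ### The retraction onto the cube -/

section Clamp

variable {ι : Type*} {d : ℕ}

/-- The coordinatewise projection of `ι → ℝ` to `[0,1]`. -/
noncomputable def clamp (z : ι → ℝ) : ι → ℝ := fun i => (projIcc 0 1 zero_le_one (z i) : ℝ)

theorem clamp_mem (z : ι → ℝ) : clamp z ∈ Icc (0 : ι → ℝ) 1 :=
  ⟨fun _ => (projIcc _ _ _ _).2.1, fun _ => (projIcc _ _ _ _).2.2⟩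

theorem clamp_eq_self {z : ι → ℝ} (hz : z ∈ Icc (0 : ι → ℝ) 1) : clamp z = z :=
  funext fun i => congrArg Subtype.val (projIcc_of_mem zero_le_one ⟨hz.1 i, hz.2 i⟩)

theorem lipschitzWith_clamp [Fintype ι] : LipschitzWith 1 (clamp (ι := ι)) :=
  LipschitzWith.of_dist_le_mul fun z a => by
    rw [NNReal.coe_one, one_mul]
    refine (dist_pi_le_iff dist_nonneg).2 fun i => le_trans ?_ (dist_le_pi_dist z a i)
    simpa [clamp, Subtype.dist_eq] using
      (LipschitzWith.projIcc (zero_le_one (α := ℝ))).dist_le_mul (z i) (a i)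

/-- The coordinatewise projection of Euclidean space to the unit cube. -/
noncomputable def clampCube (x : EuclideanSpace ℝ (Fin d)) : EuclideanSpace ℝ (Fin d) :=
  WithLp.toLp 2 (clamp x.ofLp)

theorem clampCube_mem (x : EuclideanSpace ℝ (Fin d)) : clampCube x ∈ unitCube d :=
  fun i => ⟨(clamp_mem x.ofLp).1 i, (clamp_mem x.ofLp).2 i⟩

theorem clampCube_eq_self {x : EuclideanSpace ℝ (Fin d)} (hx : x ∈ unitCube d) :
    clampCube x = x := by
  rw [clampCube, clamp_eq_self ⟨fun i => (hx i).1, fun i => (hx i).2⟩]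

theorem continuous_clampCube : Continuous (clampCube (d := d)) :=
  (PiLp.continuous_toLp 2 _).comp (lipschitzWith_clamp.continuous.comp (PiLp.continuous_ofLp 2 _))

theorem IsCubeDensity.continuous_comp_clampCube {k : ℕ} {L₁ L₂ : ℝ}
    {q : EuclideanSpace ℝ (Fin d) → ℝ} (hq : IsCubeDensity k L₁ L₂ q) :
    Continuous (q ∘ clampCube) :=
  hq.contDiffOn.continuousOn.comp_continuous continuous_clampCube clampCube_mem

theorem cubeMeasure_comp_clampCube (q : EuclideanSpace ℝ (Fin d) → ℝ) :
    cubeMeasure (q ∘ clampCube) = cubeMeasure q := by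
  refine withDensity_congr_ae ?_
  filter_upwards [ae_restrict_mem (isClosed_unitCube d).measurableSet] with x hx
  rw [Function.comp_apply, clampCube_eq_self hx]

end Clamp

/-! ### Local approximation of the flux -/

section FluxAverage

variable {d k : ℕ} {L₁ L₂ : ℝ} {q : EuclideanSpace ℝ (Fin d) → ℝ}

theorem splice_mem (j : ℕ) {x y : EuclideanSpace ℝ (Fin d)} (hx : x ∈ unitCube d)
    (hy : y ∈ unitCube d) : splice j x y ∈ unitCube d := fun i => by
  simp only [splice]
  split_ifs
  exacts [hx i, hy i]

theorem setCoord_mem (j : Fin d) {x : EuclideanSpace ℝ (Fin d)} (hx : x ∈ unitCube d) {s : ℝ}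
    (hs : s ∈ Icc (0 : ℝ) 1) : setCoord j x s ∈ unitCube d := fun i => by
  rcases eq_or_ne i j with rfl | h
  · rwa [setCoord_self]
  · rw [setCoord_of_ne h]
    exact hx i

theorem diagAffine_eq_splice (j : ℕ) (x y : EuclideanSpace ℝ (Fin d)) :
    diagAffine (fun i => if (i : ℕ) < j then 1 else 0) (fun i => if (i : ℕ) < j then 0 else y i) x =
      splice j x y := by
  ext i
  simp only [diagAffine, splice]
  split_ifs <;> simp

theorem diagAffine_eq_splice_setCoord (j : Fin d) (x y : EuclideanSpace ℝ (Fin d)) (s : ℝ) :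
    diagAffine (fun i => if i < j then 1 else if i = j then s else 0)
      (fun i => if i ≤ j then 0 else y i) x = splice (j + 1) (setCoord j x (s * x j)) y := by
  ext i
  rcases lt_trichotomy i j with h | rfl | h
  · simp [diagAffine, splice, setCoord_of_ne h.ne, h, h.le]
  · simp [diagAffine, splice]
  · simp [diagAffine, splice, h.not_gt, h.not_ge, h.ne']

theorem isCubeAverage_splice (d j : ℕ) :
    IsCubeAverage (volume.restrict (unitCube d)) (fun _ i => if (i : ℕ) < j then (1 : ℝ) else 0)
      (fun y i => if (i : ℕ) < j then 0 else y i) where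
  prob := inferInstance
  meas_l := measurable_const
  meas_b := measurable_pi_lambda _ fun i => by split_ifs <;> fun_prop
  l_mem := .of_forall fun _ i => by split_ifs <;> simp
  maps := by
    filter_upwards [ae_restrict_mem (isClosed_unitCube d).measurableSet] with y hy x hx
    rw [diagAffine_eq_splice]
    exact splice_mem j hx hy

theorem isCubeAverage_splice_setCoord (j : Fin d) :
    IsCubeAverage ((volume.restrict (Icc (0 : ℝ) 1)).prod (volume.restrict (unitCube d)))
      (fun p i => if i < j then (1 : ℝ) else if i = j then p.1 else 0)
      (fun p i => if i ≤ j then 0 else p.2 i) where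
  prob := inferInstance
  meas_l := measurable_pi_lambda _ fun i => by split_ifs <;> fun_prop
  meas_b := measurable_pi_lambda _ fun i => by split_ifs <;> fun_prop
  l_mem := by
    filter_upwards [Measure.quasiMeasurePreserving_fst.ae (ae_restrict_mem measurableSet_Icc)]
      with p hp i
    split_ifs
    exacts [by simp, hp, by simp]
  maps := by
    filter_upwards [Measure.quasiMeasurePreserving_fst.ae (ae_restrict_mem measurableSet_Icc),
      Measure.quasiMeasurePreserving_snd.ae
        (ae_restrict_mem (isClosed_unitCube d).measurableSet)] with p hs hy x hx
    rw [diagAffine_eq_splice_setCoord]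
    exact splice_mem _ (setCoord_mem j hx ⟨mul_nonneg hs.1 (hx j).1,
      mul_le_one₀ hs.2 (hx j).1 (hx j).2⟩) hy

theorem margAvg_comp_clampCube (j : ℕ) {x : EuclideanSpace ℝ (Fin d)} (hx : x ∈ unitCube d) :
    margAvg (q ∘ clampCube) j x = ∫ y in unitCube d,
      q (diagAffine (fun i => if (i : ℕ) < j then 1 else 0)
        (fun i => if (i : ℕ) < j then 0 else y i) x) := by
  refine setIntegral_congr_fun (isClosed_unitCube d).measurableSet fun y hy => ?_
  simp only [Function.comp_apply, diagAffine_eq_splice, clampCube_eq_self (splice_mem j hx hy)]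

theorem integral_margAvg_comp_clampCube (hq : IsCubeDensity k L₁ L₂ q) (hL : 0 ≤ L₁) (j : Fin d)
    {x : EuclideanSpace ℝ (Fin d)} (hx : x ∈ unitCube d) :
    ∫ s in Icc (0 : ℝ) 1, margAvg (q ∘ clampCube) (j + 1) (setCoord j x (s * x j)) =
      ∫ p, q (diagAffine (fun i => if i < j then 1 else if i = j then p.1 else 0)
        (fun i => if i ≤ j then 0 else p.2 i) x)
        ∂(volume.restrict (Icc (0 : ℝ) 1)).prod (volume.restrict (unitCube d)) := by
  rw [integral_prod _ ((isCubeAverage_splice_setCoord j).integrable hq.contDiffOn.continuousOn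
    (fun x hx => hq.abs_le hL hx) hx)]
  refine setIntegral_congr_fun measurableSet_Icc fun s hs =>
    setIntegral_congr_fun (isClosed_unitCube d).measurableSet fun y hy => ?_
  have hmem : splice (j + 1) (setCoord j x (s * x j)) y ∈ unitCube d :=
    splice_mem _ (setCoord_mem j hx ⟨mul_nonneg hs.1 (hx j).1,
      mul_le_one₀ hs.2 (hx j).1 (hx j).2⟩) hy
  simp only [Function.comp_apply, diagAffine_eq_splice_setCoord, clampCube_eq_self hmem]

variable {T : Type*} {a : T → Fin (d + 1) → ℝ} {q r : T → EuclideanSpace ℝ (Fin d) → ℝ}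

theorem unifLocPoly_margAvg (hq : ∀ τ, IsCubeDensity k L₁ L₂ (q τ)) (hL : 0 ≤ L₁) (hk : 1 ≤ k)
    (ha : ∀ τ, a τ ∈ Icc (0 : Fin (d + 1) → ℝ) 1) (j : ℕ) :
    UnifLocPoly k k a (fun τ z => margAvg (q τ ∘ clampCube) j (spatial z)) :=
  ((isCubeAverage_splice d j).unifLocPoly hq hL hk ha).congr fun _ _ hz =>
    margAvg_comp_clampCube j (spatial_mem hz)

theorem unifLocPoly_density (hq : ∀ τ, IsCubeDensity k L₁ L₂ (q τ)) (hL : 0 ≤ L₁) (hk : 1 ≤ k)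
    (ha : ∀ τ, a τ ∈ Icc (0 : Fin (d + 1) → ℝ) 1) :
    UnifLocPoly k k a (fun τ z => (q τ ∘ clampCube) (spatial z)) :=
  (unifLocPoly_margAvg hq hL hk ha d).congr fun _ _ _ => (margAvg_self _).symm

theorem unifLocPoly_flux (hq : ∀ τ, IsCubeDensity k L₁ L₂ (q τ)) (hL : 0 ≤ L₁) (hk : 1 ≤ k)
    (ha : ∀ τ, a τ ∈ Icc (0 : Fin (d + 1) → ℝ) 1) (j : Fin d) :
    UnifLocPoly k (1 + k) a (fun τ z => flux (q τ ∘ clampCube) j (spatial z)) := by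
  have hint : UnifLocPoly k k a fun τ z => ∫ s in Icc (0 : ℝ) 1,
      margAvg (q τ ∘ clampCube) (j + 1) (setCoord j (spatial z) (s * spatial z j)) :=
    ((isCubeAverage_splice_setCoord j).unifLocPoly hq hL hk ha).congr fun τ _ hz =>
      integral_margAvg_comp_clampCube (hq τ) hL j (spatial_mem hz)
  exact (UnifLocPoly.coord j.castSucc).mul ha (hint.sub ha (unifLocPoly_margAvg hq hL hk ha j))

end FluxAverage

/-! ### The transport field -/

section TransportField

variable {d k : ℕ} {L₁ L₂ : ℝ} {π ρ : EuclideanSpace ℝ (Fin d) → ℝ}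

/-- The `j`-th coordinate of the field transporting `π` to `ρ`, at the point `z = (x, t)`. -/
noncomputable def transportCoord (π ρ : EuclideanSpace ℝ (Fin d) → ℝ) (j : Fin d)
    (z : Fin (d + 1) → ℝ) : ℝ :=
  (flux π j (spatial z) - flux ρ j (spatial z)) * (interp π ρ (z (Fin.last d)) (spatial z))⁻¹

theorem le_interp {x : EuclideanSpace ℝ (Fin d)} (hπ : L₂ ≤ π x) (hρ : L₂ ≤ ρ x) {t : ℝ}
    (ht : t ∈ Icc (0 : ℝ) 1) : L₂ ≤ interp π ρ t x :=
  convex_Ici L₂ hπ hρ (sub_nonneg.2 ht.2) ht.1 (sub_add_cancel _ _)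

theorem transportCoord_eq_zero (hπ : IsCubeDensity k L₁ L₂ π) (hρ : IsCubeDensity k L₁ L₂ ρ)
    (hL : 0 ≤ L₁) (j : Fin d) {z : Fin (d + 1) → ℝ}
    (hz : z j.castSucc = 0 ∨ z j.castSucc = 1) :
    transportCoord (π ∘ clampCube) (ρ ∘ clampCube) j z = 0 := by
  have hflux : ∀ {q}, IsCubeDensity k L₁ L₂ q → flux (q ∘ clampCube) j (spatial z) = 0 := fun hq =>
    flux_eq_zero_of_coord (fun x => hq.abs_le hL (clampCube_mem x)) hq.continuous_comp_clampCube j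
      (x := spatial z) hz
  rw [transportCoord, hflux hπ, hflux hρ, sub_self, zero_mul]

theorem unifLocPoly_transportCoord {T : Type*} {a : T → Fin (d + 1) → ℝ}
    {π ρ : T → EuclideanSpace ℝ (Fin d) → ℝ} (hπ : ∀ τ, IsCubeDensity k L₁ L₂ (π τ))
    (hρ : ∀ τ, IsCubeDensity k L₁ L₂ (ρ τ)) (hL : 0 ≤ L₁) (hL₂ : 0 < L₂) (hk : 1 ≤ k)
    (ha : ∀ τ, a τ ∈ Icc (0 : Fin (d + 1) → ℝ) 1) (j : Fin d) :
    UnifLocPoly k (1 + k + k * (1 + k)) a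
      (fun τ => transportCoord (π τ ∘ clampCube) (ρ τ ∘ clampCube) j) := by
  have htime : UnifLocPoly k 1 a fun _ z => z (Fin.last d) := .coord _
  have hone_sub : UnifLocPoly k 1 a fun _ z => 1 - z (Fin.last d) :=
    (UnifLocPoly.const (C := 1) (c := fun _ => 1) (by simp)).sub ha htime
  have hinterp : UnifLocPoly k (1 + k) a fun τ z =>
      interp (π τ ∘ clampCube) (ρ τ ∘ clampCube) (z (Fin.last d)) (spatial z) :=
    .add (hone_sub.mul ha (unifLocPoly_density hπ hL hk ha))
      (htime.mul ha (unifLocPoly_density hρ hL hk ha))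
  exact ((unifLocPoly_flux hπ hL hk ha j).sub ha (unifLocPoly_flux hρ hL hk ha j)).mul ha
    (hinterp.inv ha hk hL₂ fun τ z hz => le_interp ((hπ τ).lower_bound _ (clampCube_mem _))
      ((hρ τ).lower_bound _ (clampCube_mem _)) ⟨hz.1 _, hz.2 _⟩)

end TransportField

/-! ### Velocity fields of networks -/

section NetLipschitz

open scoped NNReal

theorem AffineLayer.locallyLipschitz_apply {m n : ℕ} (A : AffineLayer m n) :
    LocallyLipschitz A.apply := by
  have h : ContDiff ℝ 1 A.apply :=
    (LinearMap.toContinuousLinearMap (Matrix.mulVecLin A.weight)).contDiff.add contDiff_const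
  exact h.locallyLipschitz

theorem locallyLipschitz_reluSq {n : ℕ} : LocallyLipschitz (reluSq (n := n)) := by
  have hsq : ContDiff ℝ 1 fun (v : Fin n → ℝ) i => v i ^ 2 := by fun_prop
  have hmax : LipschitzWith 1 fun (v : Fin n → ℝ) i => max 0 (v i) :=
    LipschitzWith.of_dist_le_mul fun v w => by
      rw [NNReal.coe_one, one_mul]
      refine (dist_pi_le_iff dist_nonneg).2 fun i => ?_
      refine le_trans ?_ (dist_le_pi_dist v w i)
      rw [Real.dist_eq, Real.dist_eq, max_comm 0, max_comm 0]
      exact abs_max_sub_max_le_abs _ _ _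
  exact hsq.locallyLipschitz.comp hmax.locallyLipschitz

variable {m n W : ℕ}

theorem ReLUSqNet.locallyLipschitz_foldl (l : List (AffineLayer W W))
    {f : (Fin m → ℝ) → Fin W → ℝ} (hf : LocallyLipschitz f) :
    LocallyLipschitz fun x => l.foldl (fun v A => A.apply (reluSq v)) (f x) := by
  induction l generalizing f with
  | nil => exact hf
  | cons A _ ih => exact ih (A.locallyLipschitz_apply.comp (locallyLipschitz_reluSq.comp hf))

theorem ReLUSqNet.locallyLipschitz_eval (N : ReLUSqNet m n W) : LocallyLipschitz N.eval :=
  N.last.locallyLipschitz_apply.comp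
    (locallyLipschitz_reluSq.comp (locallyLipschitz_foldl N.mid N.first.locallyLipschitz_apply))

variable {d : ℕ}

/-- The point of `ℝ^{d+1}` with spatial part `x` and last coordinate `t`, at which `toVelocity`
evaluates its argument. -/
def spaceTime (x : EuclideanSpace ℝ (Fin d)) (t : ℝ) : Fin (d + 1) → ℝ :=
  Fin.snoc (α := fun _ => ℝ) (fun i => x i) t

@[simp]
theorem spaceTime_castSucc (x : EuclideanSpace ℝ (Fin d)) (t : ℝ) (j : Fin d) :
    spaceTime x t j.castSucc = x j :=
  Fin.snoc_castSucc (α := fun _ => ℝ) _ _ j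

@[simp]
theorem spaceTime_last (x : EuclideanSpace ℝ (Fin d)) (t : ℝ) : spaceTime x t (Fin.last d) = t :=
  Fin.snoc_last (α := fun _ => ℝ) _ _

@[simp]
theorem spatial_spaceTime (x : EuclideanSpace ℝ (Fin d)) (t : ℝ) : spatial (spaceTime x t) = x := by
  ext j
  exact spaceTime_castSucc x t j

theorem spaceTime_mem {x : EuclideanSpace ℝ (Fin d)} (hx : x ∈ unitCube d) {t : ℝ}
    (ht : t ∈ Icc (0 : ℝ) 1) : spaceTime x t ∈ Icc (0 : Fin (d + 1) → ℝ) 1 :=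
  ⟨Fin.lastCases (by simpa using ht.1) fun j => by simpa using (hx j).1,
    Fin.lastCases (by simpa using ht.2) fun j => by simpa using (hx j).2⟩

theorem dist_spaceTime_le (x y : EuclideanSpace ℝ (Fin d)) (t s : ℝ) :
    dist (spaceTime x t) (spaceTime y s) ≤ ‖x - y‖ + |t - s| := by
  refine (dist_pi_le_iff (by positivity)).2 (Fin.lastCases ?_ fun j => ?_)
  · rw [spaceTime_last, spaceTime_last, Real.dist_eq]
    exact le_add_of_nonneg_left (norm_nonneg _)
  · rw [spaceTime_castSucc, spaceTime_castSucc, dist_eq_norm]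
    exact (PiLp.norm_apply_le (x - y) j).trans (le_add_of_nonneg_right (abs_nonneg _))

theorem norm_toLp_two_le (v : Fin d → ℝ) : ‖WithLp.toLp 2 v‖ ≤ d * ‖v‖ :=
  calc ‖WithLp.toLp 2 v‖ ≤ ∑ i, |v i| := euclidean_norm_le_sum _
    _ ≤ ∑ _ : Fin d, ‖v‖ := Finset.sum_le_sum fun i _ => norm_le_pi_norm v i
    _ = d * ‖v‖ := by simp

theorem isLipField_toVelocity_comp_clamp {u : (Fin (d + 1) → ℝ) → Fin d → ℝ} {K B : ℝ≥0}
    (hK : LipschitzOnWith K u (Icc 0 1)) (hB : ∀ z ∈ Icc (0 : Fin (d + 1) → ℝ) 1, ‖u z‖ ≤ B) :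
    IsLipField (toVelocity (u ∘ clamp)) (d * K) (d * B) where
  lip x y t s := by
    have hlip : LipschitzWith K (u ∘ clamp) := by
      simpa using lipschitzOnWith_univ.1 (hK.comp lipschitzWith_clamp.lipschitzOnWith
        fun z _ => clamp_mem z)
    have h := hlip.dist_le_mul (spaceTime x t) (spaceTime y s)
    rw [dist_eq_norm] at h
    calc ‖toVelocity (u ∘ clamp) x t - toVelocity (u ∘ clamp) y s‖
        ≤ d * ‖(u ∘ clamp) (spaceTime x t) - (u ∘ clamp) (spaceTime y s)‖ := norm_toLp_two_le _
      _ ≤ d * (K * (‖x - y‖ + |t - s|)) := by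
        gcongr
        exact h.trans (by gcongr; exact dist_spaceTime_le x y t s)
      _ = (d * K : ℝ≥0) * (‖x - y‖ + |t - s|) := by push_cast; ring
  bound x t := by
    have h := hB _ (clamp_mem (spaceTime x t))
    push_cast
    exact (norm_toLp_two_le _).trans (by gcongr; exact h)

theorem toVelocity_comp_clamp (u : (Fin (d + 1) → ℝ) → Fin d → ℝ)
    {x : EuclideanSpace ℝ (Fin d)} (hx : x ∈ unitCube d) {t : ℝ} (ht : t ∈ Icc (0 : ℝ) 1) :
    toVelocity (u ∘ clamp) x t = toVelocity u x t :=
  congrArg (fun z => WithLp.toLp 2 (u z)) (clamp_eq_self (spaceTime_mem hx ht))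

theorem ReLUSqNet.exists_isLipField (N : ReLUSqNet (d + 1) d W) :
    ∃ K B, IsLipField (toVelocity (N.eval ∘ clamp)) K B := by
  have hlip := N.locallyLipschitz_eval
  obtain ⟨K, hK⟩ :=
    (hlip.locallyLipschitzOn (s := Icc 0 1)).exists_lipschitzOnWith_of_compact isCompact_Icc
  obtain ⟨B, hB⟩ := isCompact_Icc.exists_bound_of_continuousOn (s := Icc 0 1)
    hlip.continuous.continuousOn
  exact ⟨_, _, isLipField_toVelocity_comp_clamp (B := B.toNNReal) hK fun z hz =>
    (hB z hz).trans (Real.le_coe_toNNReal B)⟩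

end NetLipschitz

/-! ### Flows of inward pointing fields -/

section Stability

open Filter Topology
open scoped NNReal

variable {d : ℕ} {F G H : EuclideanSpace ℝ (Fin d) → ℝ → EuclideanSpace ℝ (Fin d)}

/-- On each face of the unit cube, the field `G` points strictly into the cube at all times in
`[0,1]`, which makes the cube forward invariant. -/
def PointsInward (G : EuclideanSpace ℝ (Fin d) → ℝ → EuclideanSpace ℝ (Fin d)) : Prop :=
  ∀ x ∈ unitCube d, ∀ t ∈ Icc (0 : ℝ) 1, ∀ j, (x j = 0 → 0 < G x t j) ∧ (x j = 1 → G x t j < 0)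

theorem PointsInward.congr (hG : PointsInward G)
    (h : ∀ x ∈ unitCube d, ∀ t ∈ Icc (0 : ℝ) 1, G x t = H x t) : PointsInward H :=
  fun x hx t ht j => by simpa only [h x hx t ht] using hG x hx t ht j

theorem eventually_nhdsGT_nonneg {g : ℝ → ℝ} {g' s : ℝ} (hg : HasDerivWithinAt g g' (Ioi s) s)
    (hs : 0 ≤ g s) (hg' : g s = 0 → 0 < g') : ∀ᶠ r in 𝓝[>] s, 0 ≤ g r := by
  rcases hs.eq_or_lt with hs | hs
  · have hslope : Tendsto (slope g s) (𝓝[>] s) (𝓝 g') :=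
      (hasDerivWithinAt_iff_tendsto_slope' (by simp)).1 hg
    filter_upwards [hslope.eventually_const_lt (hg' hs.symm), self_mem_nhdsWithin] with r hr hsr
    rw [slope_def_field, ← hs, sub_zero] at hr
    exact ((div_pos_iff_of_pos_right (sub_pos.2 hsr)).1 hr).le
  · filter_upwards [hg.continuousWithinAt.eventually_const_lt hs] with r hr using hr.le

namespace IsCurve

variable {α β : ℝ → EuclideanSpace ℝ (Fin d)}

theorem congr (hα : IsCurve G α) (h : ∀ t ∈ Icc (0 : ℝ) 1, G (α t) t = H (α t) t) :
    IsCurve H α :=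
  fun t ht => h t ht ▸ hα t ht

theorem mem_unitCube (hα : IsCurve G α) (hG : PointsInward G) (h0 : α 0 ∈ unitCube d) {t : ℝ}
    (ht : t ∈ Icc (0 : ℝ) 1) : α t ∈ unitCube d := by
  have hclosed : IsClosed (α ⁻¹' unitCube d ∩ Icc 0 1) := by
    rw [inter_comm]
    exact hα.continuousOn.preimage_isClosed_of_isClosed isClosed_Icc (isClosed_unitCube d)
  refine hclosed.Icc_subset_of_forall_mem_nhdsWithin h0 (fun s ⟨hsQ, hs⟩ => ?_) ht
  have hinward := hG (α s) hsQ s (Ico_subset_Icc_self hs)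
  have hderiv (j : Fin d) : HasDerivWithinAt (fun r => α r j) (G (α s) s j) (Ioi s) s :=
    ((EuclideanSpace.proj (𝕜 := ℝ) j).hasFDerivAt.comp_hasDerivWithinAt s
      (hα.hasDerivWithinAt_Ici hs)).mono Ioi_subset_Ici_self
  refine eventually_all.2 fun j => ?_
  filter_upwards [eventually_nhdsGT_nonneg (hderiv j) (hsQ j).1 (hinward j).1,
    eventually_nhdsGT_nonneg ((hderiv j).const_sub 1) (sub_nonneg.2 (hsQ j).2)
      fun h => neg_pos.2 ((hinward j).2 (sub_eq_zero.1 h).symm)] with r h h'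
  exact ⟨h, sub_nonneg.1 h'⟩

theorem dist_le_of_approx {K B : ℝ≥0} (hF : IsLipField F K B) (hα : IsCurve F α)
    (hβ : IsCurve G β) (h0 : α 0 = β 0) {δ : ℝ}
    (h : ∀ t ∈ Icc (0 : ℝ) 1, ‖G (β t) t - F (β t) t‖ ≤ δ) :
    dist (α 1) (β 1) ≤ δ * Real.exp (K + 1) := by
  have hδ : 0 ≤ δ := (norm_nonneg _).trans (h 0 (by simp))
  -- The Grönwall bound divides by the Lipschitz constant, so `K` is enlarged to `K + 1`.
  have hgronwall := dist_le_of_approx_trajectories_ODE (v := fun t x => F x t) (K := K + 1)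
    (a := 0) (b := 1) (δ := 0) (εf := 0) (εg := δ)
    (fun t => (hF.lipschitzWith t).weaken (by simp))
    hα.continuousOn (fun _ ht => hα.hasDerivWithinAt_Ici ht) (fun _ _ => by simp)
    hβ.continuousOn (fun _ ht => hβ.hasDerivWithinAt_Ici ht)
    (fun t ht => (dist_eq_norm _ _).trans_le (h t (Ico_subset_Icc_self ht))) (by simp [h0]) 1
    (by simp)
  rw [gronwallBound_of_K_ne_0 (by positivity)] at hgronwall
  push_cast at hgronwall
  simp only [zero_mul, zero_add, sub_zero, mul_one] at hgronwall
  have hexp : 0 ≤ Real.exp ((K : ℝ) + 1) - 1 := sub_nonneg.2 (Real.one_le_exp (by positivity))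
  calc dist (α 1) (β 1) ≤ δ / ((K : ℝ) + 1) * (Real.exp ((K : ℝ) + 1) - 1) := hgronwall
    _ ≤ δ * (Real.exp ((K : ℝ) + 1) - 1) := by
      gcongr
      exact div_le_self hδ (by simp)
    _ ≤ δ * Real.exp (K + 1) := by gcongr; linarith

end IsCurve

theorem wasserstein_map_le {Ω E : Type*} [MeasurableSpace Ω] [NormedAddCommGroup E]
    [MeasurableSpace E] [BorelSpace E] [SecondCountableTopology E] {P : Measure Ω}
    [IsProbabilityMeasure P] {X Y : Ω → E} (hX : AEMeasurable X P) (hY : AEMeasurable Y P) {C : ℝ}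
    (hC : ∀ᵐ ω ∂P, ‖X ω - Y ω‖ ≤ C) (p : ℝ≥0∞) :
    wasserstein p (P.map X) (P.map Y) ≤ ENNReal.ofReal C := by
  have hXY := hX.prodMk hY
  have hsub : Measurable fun z : E × E => z.1 - z.2 := measurable_fst.sub measurable_snd
  refine iInf₂_le_of_le (P.map fun ω => (X ω, Y ω)) ⟨?_, ?_⟩ ?_
  · exact AEMeasurable.map_map_of_aemeasurable measurable_fst.aemeasurable hXY
  · exact AEMeasurable.map_map_of_aemeasurable measurable_snd.aemeasurable hXY
  · rw [eLpNorm_map_measure hsub.aestronglyMeasurable hXY]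
    exact (eLpNorm_le_of_ae_bound hC).trans_eq (by simp)

namespace PointsInward

variable {K B : ℝ≥0} {Ψ : ℝ → EuclideanSpace ℝ (Fin d) → ℝ → EuclideanSpace ℝ (Fin d)}
  {X : EuclideanSpace ℝ (Fin d) → ℝ → EuclideanSpace ℝ (Fin d)}
  {P : Measure (EuclideanSpace ℝ (Fin d))}

theorem isFlowOn (hG : PointsInward G)
    (hGH : ∀ x ∈ unitCube d, ∀ t ∈ Icc (0 : ℝ) 1, G x t = H x t) (hΨ : IsEvolution H Ψ) :
    IsFlowOn G (unitCube d) (Ψ 0) := fun x hx => by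
  obtain ⟨hstart, hcurve⟩ := hΨ 0 (by simp) x
  refine ⟨hstart, hcurve.congr fun t ht => (hGH _ ?_ t ht).symm⟩
  exact hcurve.mem_unitCube (hG.congr hGH) (by rwa [hstart]) ht

theorem mem_unitCube (hG : PointsInward G) (hX : IsFlowOn G (unitCube d) X)
    {x : EuclideanSpace ℝ (Fin d)} (hx : x ∈ unitCube d) {t : ℝ} (ht : t ∈ Icc (0 : ℝ) 1) :
    X x t ∈ unitCube d :=
  IsCurve.mem_unitCube (hX x hx).2 hG (by rwa [(hX x hx).1]) ht

theorem flow_eq (hG : PointsInward G)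
    (hGH : ∀ x ∈ unitCube d, ∀ t ∈ Icc (0 : ℝ) 1, G x t = H x t) (hH : IsLipField H K B)
    (hΨ : IsEvolution H Ψ) (hX : IsFlowOn G (unitCube d) X) {x : EuclideanSpace ℝ (Fin d)}
    (hx : x ∈ unitCube d) : X x 1 = Ψ 0 x 1 := by
  obtain ⟨hstart, hcurve⟩ := hΨ 0 (by simp) x
  have hXH : IsCurve H (X x) := IsCurve.congr (hX x hx).2 fun t ht =>
    hGH _ (hG.mem_unitCube hX hx ht) t ht
  have h := hXH.dist_le hH le_rfl zero_le_one le_rfl hcurve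
  rwa [(hX x hx).1, hstart, dist_self, zero_mul, dist_le_zero] at h

theorem aemeasurable_flow (hG : PointsInward G)
    (hGH : ∀ x ∈ unitCube d, ∀ t ∈ Icc (0 : ℝ) 1, G x t = H x t) (hH : IsLipField H K B)
    (hX : IsFlowOn G (unitCube d) X) (hP : ∀ᵐ x ∂P, x ∈ unitCube d) :
    AEMeasurable (fun x => X x 1) P := by
  obtain ⟨Ψ, hΨ⟩ := hH.exists_isEvolution
  have hcont := (hΨ.lipschitzWith hH le_rfl zero_le_one le_rfl).continuous
  refine hcont.measurable.aemeasurable.congr ?_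
  filter_upwards [hP] with x hx using (hG.flow_eq hGH hH hΨ hX hx).symm

theorem wasserstein_flow_le (hG : PointsInward G) (hF : IsLipField F K B) {δ : ℝ}
    (hGF : ∀ x ∈ unitCube d, ∀ t ∈ Icc (0 : ℝ) 1, ‖G x t - F x t‖ ≤ δ)
    (hΨ : IsEvolution F Ψ) (hX : IsFlowOn G (unitCube d) X) [IsProbabilityMeasure P]
    (hP : ∀ᵐ x ∂P, x ∈ unitCube d) (hXm : AEMeasurable (fun x => X x 1) P) (p : ℝ≥0∞) :
    wasserstein p (P.map fun x => Ψ 0 x 1) (P.map fun x => X x 1) ≤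
      ENNReal.ofReal (δ * Real.exp (K + 1)) := by
  have hcont := (hΨ.lipschitzWith hF le_rfl zero_le_one le_rfl).continuous
  refine wasserstein_map_le hcont.measurable.aemeasurable hXm ?_ p
  filter_upwards [hP] with x hx
  obtain ⟨hstart, hcurve⟩ := hΨ 0 (by simp) x
  rw [← dist_eq_norm]
  exact hcurve.dist_le_of_approx hF (hX x hx).2 (by rw [hstart, (hX x hx).1]) fun t ht =>
    hGF _ (hG.mem_unitCube hX hx ht) t ht

end PointsInward

end Stability

/-! ### The perturbed transport field -/

section InwardField

open scoped NNReal

theorem UnifLocPoly.uncurry {ι J T : Type*} [Fintype ι] [DecidableEq ι] [Finite J] {k D : ℕ}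
    {a : T → ι → ℝ} {u : J → T → (ι → ℝ) → ℝ} (hu : ∀ j, UnifLocPoly k D a (u j)) :
    UnifLocPoly k D (fun τ : J × T => a τ.2) (fun τ => u τ.1 τ.2) := by
  choose M hM using hu
  obtain ⟨C, hC⟩ := (finite_range M).bddAbove
  refine ⟨C, fun ⟨j, τ⟩ => ?_⟩
  obtain ⟨p, hp, hup⟩ := hM j τ
  have hMC : M j ≤ C := hC (mem_range_self j)
  exact ⟨p, hp.mono_right hMC, fun z hz => (hup z hz).trans (by gcongr)⟩

variable {d k : ℕ} {L₁ L₂ : ℝ} {π ρ : EuclideanSpace ℝ (Fin d) → ℝ}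

/-- The `j`-th coordinate of the field transporting `π` to `ρ`, perturbed towards the center of the
cube so that all sufficiently good approximations point into the cube. -/
noncomputable def inwardCoord (ε : ℝ) (π ρ : EuclideanSpace ℝ (Fin d) → ℝ) (j : Fin d)
    (z : Fin (d + 1) → ℝ) : ℝ :=
  transportCoord π ρ j z + ε * (1 / 2 - z j.castSucc)

theorem exists_locPoly_inwardCoord (d : ℕ) (hL : 0 ≤ L₁) (hL₂ : 0 < L₂) (hk : 1 ≤ k) :
    ∃ M : ℝ, 0 ≤ M ∧ ∀ π ρ : EuclideanSpace ℝ (Fin d) → ℝ, IsCubeDensity k L₁ L₂ π →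
      IsCubeDensity k L₁ L₂ ρ → ∀ ε ∈ Icc (0 : ℝ) 1, ∀ j,
        LocPoly k (1 + k + k * (1 + k)) M (inwardCoord ε (π ∘ clampCube) (ρ ∘ clampCube) j) := by
  let Density := {q : EuclideanSpace ℝ (Fin d) → ℝ // IsCubeDensity k L₁ L₂ q}
  let T := Density × Density × Icc (0 : ℝ) 1 × Icc (0 : Fin (d + 1) → ℝ) 1
  let a : T → Fin (d + 1) → ℝ := fun τ => τ.2.2.2
  have ha : ∀ τ, a τ ∈ Icc (0 : Fin (d + 1) → ℝ) 1 := fun τ => τ.2.2.2.2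
  have htransport (j : Fin d) : UnifLocPoly k (1 + k + k * (1 + k)) a fun τ =>
      transportCoord (τ.1.1 ∘ clampCube) (τ.2.1.1 ∘ clampCube) j :=
    unifLocPoly_transportCoord (fun τ => τ.1.2) (fun τ => τ.2.1.2) hL hL₂ hk ha j
  have hcenter (j : Fin d) : UnifLocPoly k 1 a fun (τ : T) z => τ.2.2.1 * (1 / 2 - z j.castSucc) :=
    .const_mul (C := 1) ha (fun τ => abs_le.2 ⟨by linarith [τ.2.2.1.2.1], τ.2.2.1.2.2⟩)
      (.sub ha (.const (C := 1 / 2) fun _ => by norm_num) (.coord _))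
  obtain ⟨M, hM⟩ := UnifLocPoly.uncurry fun j =>
    (htransport j).add ((hcenter j).mono (D' := 1 + k + k * (1 + k)) (by omega))
  refine ⟨max M 0, le_max_right _ _, fun π ρ hπ hρ ε hε j b hb => ?_⟩
  obtain ⟨p, hp, hup⟩ := hM (j, ⟨π, hπ⟩, ⟨ρ, hρ⟩, ⟨ε, hε⟩, ⟨b, hb⟩)
  refine ⟨p, hp.mono_right (le_max_left _ _), fun z hz => (hup z hz).trans ?_⟩
  gcongr
  exact le_max_left _ _

/-- The velocity field transporting `π` to `ρ`, extended constantly from the cube. -/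
noncomputable def transportField (π ρ : EuclideanSpace ℝ (Fin d) → ℝ) :
    EuclideanSpace ℝ (Fin d) → ℝ → EuclideanSpace ℝ (Fin d) :=
  toVelocity ((fun z j => transportCoord π ρ j z) ∘ clamp)

theorem exists_isLipField_transportField (d : ℕ) (hL : 0 ≤ L₁) (hL₂ : 0 < L₂) (hk : 1 ≤ k) :
    ∃ K B, ∀ π ρ : EuclideanSpace ℝ (Fin d) → ℝ, IsCubeDensity k L₁ L₂ π →
      IsCubeDensity k L₁ L₂ ρ →
        IsLipField (transportField (π ∘ clampCube) (ρ ∘ clampCube)) K B := by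
  let Density := {q : EuclideanSpace ℝ (Fin d) → ℝ // IsCubeDensity k L₁ L₂ q}
  let T := Density × Density × Icc (0 : Fin (d + 1) → ℝ) 1
  let a : T → Fin (d + 1) → ℝ := fun τ => τ.2.2
  have ha : ∀ τ, a τ ∈ Icc (0 : Fin (d + 1) → ℝ) 1 := fun τ => τ.2.2.2
  have htransport := UnifLocPoly.uncurry fun j : Fin d => unifLocPoly_transportCoord
    (fun τ : T => τ.1.2) (fun τ => τ.2.1.2) hL hL₂ hk ha j
  obtain ⟨K, hK0, hK⟩ := htransport.exists_abs_sub_le hk fun τ => ha τ.2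
  obtain ⟨B, hB0, hB⟩ := htransport.exists_abs_le fun τ => ha τ.2
  refine ⟨_, _, fun π ρ hπ hρ => isLipField_toVelocity_comp_clamp (K := ⟨K, hK0⟩) (B := ⟨B, hB0⟩)
    (LipschitzOnWith.of_dist_le_mul fun z hz b hb => ?_) fun z hz => ?_⟩
  · exact (dist_pi_le_iff (by positivity)).2 fun j =>
      hK (j, ⟨π, hπ⟩, ⟨ρ, hρ⟩, ⟨b, hb⟩) z hz
  · exact (pi_norm_le_iff_of_nonneg hB0).2 fun j => hB (j, ⟨π, hπ⟩, ⟨ρ, hρ⟩, ⟨z, hz⟩) z hz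

theorem transportField_apply (π ρ : EuclideanSpace ℝ (Fin d) → ℝ) {x : EuclideanSpace ℝ (Fin d)}
    (hx : x ∈ unitCube d) {t : ℝ} (ht : t ∈ Icc (0 : ℝ) 1) (j : Fin d) :
    transportField π ρ x t j = transportCoord π ρ j (spaceTime x t) := by
  rw [transportField, toVelocity_comp_clamp _ hx ht]
  rfl

theorem isTransportField_transportField
    (h0 : ∀ x ∈ unitCube d, ∀ t ∈ Icc (0 : ℝ) 1, interp π ρ t x ≠ 0) :
    IsTransportField (transportField π ρ) π ρ := fun x hx t ht j => by
  rw [transportField_apply π ρ hx ht, transportCoord, spatial_spaceTime, spaceTime_last, mul_assoc,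
    inv_mul_cancel₀ (h0 x hx t ht), mul_one]

theorem map_cubeMeasure_transportField (hπ : IsCubeDensity k L₁ L₂ π)
    (hρ : IsCubeDensity k L₁ L₂ ρ) (hL : 0 ≤ L₁) (hL₂ : 0 < L₂) {K B : ℝ≥0}
    (hF : IsLipField (transportField (π ∘ clampCube) (ρ ∘ clampCube)) K B)
    {Φ : ℝ → EuclideanSpace ℝ (Fin d) → ℝ → EuclideanSpace ℝ (Fin d)}
    (hΦ : IsEvolution (transportField (π ∘ clampCube) (ρ ∘ clampCube)) Φ) :
    (cubeMeasure π).map (fun x => Φ 0 x 1) = cubeMeasure ρ := by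
  have hlower {q} (hq : IsCubeDensity k L₁ L₂ q) (x : EuclideanSpace ℝ (Fin d)) :
      L₂ ≤ (q ∘ clampCube) x :=
    hq.lower_bound _ (clampCube_mem x)
  have hP {q : EuclideanSpace ℝ (Fin d) → ℝ} (hq : IsCubeDensity k L₁ L₂ q) :
      IsProbabilityMeasure (cubeMeasure (q ∘ clampCube)) :=
    cubeMeasure_comp_clampCube q ▸ hq.isProbabilityMeasure
  have hFT := isTransportField_transportField fun x _ t ht =>
    (hL₂.trans_le (le_interp (hlower hπ x) (hlower hρ x) ht)).ne'
  rw [← cubeMeasure_comp_clampCube π, ← cubeMeasure_comp_clampCube ρ]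
  exact hΦ.map_cubeMeasure_eq hF hFT (fun x => hπ.abs_le hL (clampCube_mem x))
    (fun x => hρ.abs_le hL (clampCube_mem x)) hπ.continuous_comp_clampCube
    hρ.continuous_comp_clampCube (fun x _ => hL₂.le.trans (hlower hπ x))
    (fun x _ => hL₂.le.trans (hlower hρ x)) (hP hπ) (hP hρ)

variable {u : (Fin (d + 1) → ℝ) → Fin d → ℝ} {ε : ℝ}

theorem pointsInward_of_abs_sub_inwardCoord_le (hπ : IsCubeDensity k L₁ L₂ π)
    (hρ : IsCubeDensity k L₁ L₂ ρ) (hL : 0 ≤ L₁) (hε : 0 < ε)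
    (hu : ∀ z ∈ Icc (0 : Fin (d + 1) → ℝ) 1, ∀ j,
      |u z j - inwardCoord ε (π ∘ clampCube) (ρ ∘ clampCube) j z| ≤ ε / 4) :
    PointsInward (toVelocity u) := fun x hx t ht j => by
  have hvalue : toVelocity u x t j = u (spaceTime x t) j := rfl
  have h := abs_le.1 (hu _ (spaceTime_mem hx ht) j)
  constructor <;> intro hj <;>
    rw [inwardCoord, transportCoord_eq_zero hπ hρ hL j (by simp [hj]), spaceTime_castSucc, hj] at h
  · linarith [h.1]
  · linarith [h.2]

theorem norm_toVelocity_sub_transportField_le (hε : 0 ≤ ε)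
    (hu : ∀ z ∈ Icc (0 : Fin (d + 1) → ℝ) 1, ∀ j, |u z j - inwardCoord ε π ρ j z| ≤ ε / 4)
    {x : EuclideanSpace ℝ (Fin d)} (hx : x ∈ unitCube d) {t : ℝ} (ht : t ∈ Icc (0 : ℝ) 1) :
    ‖toVelocity u x t - transportField π ρ x t‖ ≤ d * ε := by
  have hz := spaceTime_mem hx ht
  rw [transportField, toVelocity_comp_clamp _ hx ht]
  let v : Fin d → ℝ := fun j => u (spaceTime x t) j - transportCoord π ρ j (spaceTime x t)
  suffices hv : ‖v‖ ≤ ε from (norm_toLp_two_le v).trans (by gcongr)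
  refine (pi_norm_le_iff_of_nonneg hε).2 fun j => ?_
  have happrox := abs_le.1 (hu _ hz j)
  rw [inwardCoord, spaceTime_castSucc] at happrox
  have h0 : 0 ≤ ε * x j := mul_nonneg hε (hx j).1
  have h1 : ε * x j ≤ ε * 1 := mul_le_mul_of_nonneg_left (hx j).2 hε
  exact abs_le.2 ⟨by linarith [happrox.1], by linarith [happrox.2]⟩

theorem ae_cubeMeasure_mem (q : EuclideanSpace ℝ (Fin d) → ℝ) :
    ∀ᵐ x ∂cubeMeasure q, x ∈ unitCube d :=
  (withDensity_absolutelyContinuous _ _).ae_le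
    (ae_restrict_mem (isClosed_unitCube d).measurableSet)

theorem wasserstein_map_flow_le (hπ : IsCubeDensity k L₁ L₂ π) (hρ : IsCubeDensity k L₁ L₂ ρ)
    (hL : 0 ≤ L₁) (hL₂ : 0 < L₂) {K B : ℝ≥0}
    (hF : IsLipField (transportField (π ∘ clampCube) (ρ ∘ clampCube)) K B) (hε : 0 < ε)
    (hu : ∀ z ∈ Icc (0 : Fin (d + 1) → ℝ) 1, ∀ j,
      |u z j - inwardCoord ε (π ∘ clampCube) (ρ ∘ clampCube) j z| ≤ ε / 4)
    {X : EuclideanSpace ℝ (Fin d) → ℝ → EuclideanSpace ℝ (Fin d)}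
    (hX : IsFlowOn (toVelocity u) (unitCube d) X)
    (hXm : AEMeasurable (fun x => X x 1) (cubeMeasure π)) (p : ℝ≥0∞) :
    wasserstein p (cubeMeasure ρ) ((cubeMeasure π).map fun x => X x 1) ≤
      ENNReal.ofReal (d * Real.exp (K + 1) * ε) := by
  obtain ⟨Φ, hΦ⟩ := hF.exists_isEvolution
  have := hπ.isProbabilityMeasure
  have hinward := pointsInward_of_abs_sub_inwardCoord_le hπ hρ hL hε hu
  rw [← map_cubeMeasure_transportField hπ hρ hL hL₂ hF hΦ, mul_right_comm]
  exact hinward.wasserstein_flow_le hF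
    (fun x hx t ht => norm_toVelocity_sub_transportField_le hε.le hu hx ht) hΦ hX
    (ae_cubeMeasure_mem π) hXm p

theorem ReLUSqNet.exists_isFlowOn {W : ℕ} (N : ReLUSqNet (d + 1) d W)
    (hN : PointsInward (toVelocity N.eval)) :
    ∃ X, IsFlowOn (toVelocity N.eval) (unitCube d) X := by
  obtain ⟨K, B, hlip⟩ := N.exists_isLipField
  obtain ⟨Ψ, hΨ⟩ := hlip.exists_isEvolution
  exact ⟨_, hN.isFlowOn (fun x hx t ht => (toVelocity_comp_clamp N.eval hx ht).symm) hΨ⟩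

theorem ReLUSqNet.aemeasurable_flow {W : ℕ} (N : ReLUSqNet (d + 1) d W)
    (hN : PointsInward (toVelocity N.eval))
    {X : EuclideanSpace ℝ (Fin d) → ℝ → EuclideanSpace ℝ (Fin d)}
    (hX : IsFlowOn (toVelocity N.eval) (unitCube d) X) (q : EuclideanSpace ℝ (Fin d) → ℝ) :
    AEMeasurable (fun x => X x 1) (cubeMeasure q) := by
  obtain ⟨K, B, hlip⟩ := N.exists_isLipField
  exact hN.aemeasurable_flow (fun x hx t ht => (toVelocity_comp_clamp N.eval hx ht).symm) hlip hX
    (ae_cubeMeasure_mem q)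

end InwardField

/-! ### The number of grid cells -/

theorem exists_nat_div_pow_le_and_le_rpow {A ε : ℝ} (hA : 0 < A) (hε : 0 < ε) (hε1 : ε ≤ 1) {k : ℕ}
    (hk : 1 ≤ k) : ∃ N : ℕ, 1 ≤ N ∧ A / N ^ k ≤ ε ∧
      (N : ℝ) ≤ (A ^ (1 / (k : ℝ)) + 1) * ε ^ (-(1 / (k : ℝ))) := by
  set r := (A / ε) ^ (1 / (k : ℝ)) with hr
  have hr0 : 0 < r := Real.rpow_pos_of_pos (div_pos hA hε) _
  have hrk : r ^ k = A / ε := by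
    rw [hr, one_div, Real.rpow_inv_natCast_pow (div_pos hA hε).le (by omega)]
  refine ⟨⌈r⌉₊, Nat.one_le_ceil_iff.2 hr0, ?_, ?_⟩
  · calc A / (⌈r⌉₊ : ℝ) ^ k ≤ A / r ^ k := by
          gcongr
          exact Nat.le_ceil r
      _ = ε := by rw [hrk, div_div_cancel₀ hA.ne']
  · have hone : (1 : ℝ) ≤ ε ^ (-(1 / (k : ℝ))) :=
      Real.one_le_rpow_of_pos_of_le_one_of_nonpos hε hε1 (neg_nonpos.2 (by positivity))
    calc (⌈r⌉₊ : ℝ) ≤ r + 1 := (Nat.ceil_lt_add_one hr0.le).le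
      _ = A ^ (1 / (k : ℝ)) * ε ^ (-(1 / (k : ℝ))) + 1 := by
        rw [hr, Real.div_rpow hA.le hε.le, Real.rpow_neg hε.le, div_eq_mul_inv]
      _ ≤ (A ^ (1 / (k : ℝ)) + 1) * ε ^ (-(1 / (k : ℝ))) := by linarith

theorem mul_pow_le_mul_rpow {c C N H ε s : ℝ} (hc : 0 ≤ c) (hN0 : 0 ≤ N) (hε : 0 ≤ ε)
    (hN : N ≤ H * ε ^ (-(1 / s))) (n : ℕ) (hC : c * H ^ n ≤ C) :
    c * N ^ n ≤ C * ε ^ (-((n : ℝ) / s)) :=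
  calc c * N ^ n ≤ c * (H * ε ^ (-(1 / s))) ^ n := by gcongr
    _ = c * H ^ n * ε ^ (-((n : ℝ) / s)) := by
      rw [mul_pow, ← Real.rpow_mul_natCast hε, mul_assoc]
      ring_nf
    _ ≤ C * ε ^ (-((n : ℝ) / s)) := by gcongr

theorem exists_grid_size {k : ℕ} (hk : 1 ≤ k) {A c : ℝ} (hA : 0 < A) (hc : 0 ≤ c) (n : ℕ) :
    ∃ C : ℝ, ∀ ε : ℝ, 0 < ε → ε ≤ 1 → ∃ N : ℕ, 1 ≤ N ∧ A / N ^ k ≤ ε / 4 ∧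
      c * N ^ n ≤ C * ε ^ (-((n : ℝ) / (k : ℝ))) ∧ A * N ≤ C * ε ^ (-(1 / (k : ℝ))) := by
  let H : ℝ := (4 * A) ^ (1 / (k : ℝ)) + 1
  refine ⟨max (c * H ^ n) (A * H), fun ε hε hε1 => ?_⟩
  obtain ⟨N, hN1, hNε, hNH⟩ :=
    exists_nat_div_pow_le_and_le_rpow (A := 4 * A) (by positivity) hε hε1 hk
  refine ⟨N, hN1, ?_, ?_, ?_⟩
  · rw [mul_div_assoc] at hNε
    linarith
  · exact mul_pow_le_mul_rpow hc N.cast_nonneg hε.le hNH n (le_max_left _ _)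
  · simpa using mul_pow_le_mul_rpow hA.le N.cast_nonneg hε.le hNH 1
      ((pow_one H).symm ▸ le_max_right _ _)

theorem mainTheorem10 (d k : ℕ) (hd : 1 ≤ d) (hk : 1 ≤ k) :
    ∃ Cdk : ℝ, ∀ L₁ L₂ : ℝ, 1 < L₁ → 0 < L₂ →
      ∃ C' C : ℝ, ∀ ρ π : EuclideanSpace ℝ (Fin d) → ℝ,
        IsCubeDensity k L₁ L₂ ρ → IsCubeDensity k L₁ L₂ π →
        ∀ ε : ℝ, 0 < ε → ε ≤ 1 →
          ∃ (L W S : ℕ) (B : ℝ), ∃ g ∈ reluSqClass (d + 1) d L W S B,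
            (L : ℝ) ≤ Cdk ∧
            (W : ℝ) ≤ C' * ε ^ (-(((d : ℝ) + 1) / (k : ℝ))) ∧
            (S : ℝ) ≤ C' * ε ^ (-(((d : ℝ) + 1) / (k : ℝ))) ∧
            B ≤ C' * ε ^ (-(1 / (k : ℝ))) ∧
            (∃ X, IsFlowOn (toVelocity g) (unitCube d) X) ∧
            ∀ X, IsFlowOn (toVelocity g) (unitCube d) X →
              AEMeasurable (fun x => X x 1) (cubeMeasure π) ∧
              ∀ p : ℝ≥0∞, 1 ≤ p →
                wasserstein p (cubeMeasure ρ) ((cubeMeasure π).map (fun x => X x 1)) ≤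
                  ENNReal.ofReal (C * ε) := by
  obtain ⟨L, K, hnet⟩ := exists_net_approx (d + 1) d k (1 + k + k * (1 + k))
  refine ⟨L, fun L₁ L₂ hL₁ hL₂ => ?_⟩
  have hL : 0 ≤ L₁ := zero_le_one.trans hL₁.le
  obtain ⟨M, hM, hlocPoly⟩ := exists_locPoly_inwardCoord d hL hL₂ hk
  obtain ⟨KF, BF, hlip⟩ := exists_isLipField_transportField d hL hL₂ hk
  obtain ⟨C₁, hC₁, hnet⟩ := hnet M hM
  obtain ⟨C', hgrid⟩ := exists_grid_size hk hC₁ K.cast_nonneg (d + 1)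
  refine ⟨C', d * Real.exp (KF + 1), fun ρ π hρ hπ ε hε hε1 => ?_⟩
  obtain ⟨N, hN, hNε, hNsize, hNbound⟩ := hgrid ε hε hε1
  obtain ⟨W, net, hdepth, hW, hS, hB, happrox⟩ :=
    hnet N hN _ (hlocPoly π ρ hπ hρ ε ⟨hε.le, hε1⟩)
  have hsize {n : ℕ} (hn : n ≤ K * N ^ (d + 1)) :
      (n : ℝ) ≤ C' * ε ^ (-(((d : ℝ) + 1) / (k : ℝ))) :=
    (show (n : ℝ) ≤ K * N ^ (d + 1) from mod_cast hn).trans (by exact_mod_cast hNsize)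
  have hclose z hz j := (happrox z hz j).trans hNε
  have hinward := pointsInward_of_abs_sub_inwardCoord_le hπ hρ hL hε hclose
  refine ⟨L, W, net.sparsity, C₁ * N, net.eval, ⟨net, hdepth, le_rfl, hB, rfl⟩, le_rfl, hsize hW,
    hsize hS, hNbound, net.exists_isFlowOn hinward, fun X hX => ?_⟩
  have hXm := net.aemeasurable_flow hinward hX π
  exact ⟨hXm, fun p _ =>
    wasserstein_map_flow_le hπ hρ hL hL₂ (hlip π ρ hπ hρ) hε hclose hX hXm p⟩
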